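/- Conventions. A rigid $C^*$-tensor category $\mathcal T$ is a $\mathbb C$-linear monoidal $C^*$-category (a dagger category whose hom-spaces are Banach spaces with $\|g\circ f\|\le\|g\|\,\|f\|$, $\|f^\dagger\circ f\|=\|f\|^2$ and every $f^\dagger\circ f$ a positive element) in which the dagger is antilinear and compatible with $\otimes$, the associator and unitors are unitary, there are a zero object, orthogonal direct sums and splittings of dagger idempotents, all endomorphism algebras are finite-dimensional, and every object has a dual. The unit object $\mathbb 1$ need not be simple. A finite-dimensional commutative $C^*$-algebra has a canonical trace $\mathrm{Tr}$, the linear functional with value $1$ on each minimal projection. A standard separable Frobenius algebra (SSFA) in $\mathcal T$ is an object $A$ with $m:A\otimes A\to A$ and $u:\mathbb 1\to A$, associative and unital, such that $(m\otimes \mathrm{id})(\mathrm{id}\otimes m^\dagger)=m^\dagger m=(\mathrm{id}\otimes m)(m^\dagger\otimes\mathrm{id})$, $m m^\dagger=\mathrm{id}_A$ and, for the cup $c=m^\dagger u$ and the cap $u^\dagger m=c^\dagger$, $\mathrm{Tr}[c^\dagger(\mathrm{id}\otimes T)c]=\mathrm{Tr}[(u^\dagger m)(T\otimes \mathrm{id})(u^\dagger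 m)^\dagger]$ for all $T\in\mathrm{End}(A)$. A unitary $*$-isomorphism $f:A\to B$ of algebras with such data is a unitary morphism with $f m_A=m_B(f\otimes f)$, $f u_A=u_B$ and $f^\dagger=(\mathrm{id}_A\otimes u_B^\dagger m_B)(\mathrm{id}_A\otimes f\otimes\mathrm{id}_B)(m_A^\dagger u_A\otimes\mathrm{id}_B)$ (up to associators and unitors). For SSFAs $A,B$, a dagger $A$-$B$ bimodule is an object $M$ with commuting unital associative actions $l:A\otimes M\to M$ and $r:M\otimes B\to M$ such that $(u^\dagger m\otimes\mathrm{id}_M)(\mathrm{id}_A\otimes l^\dagger)=l$ and $(\mathrm{id}_M\otimes u^\dagger m)(r^\dagger\otimes\mathrm{id}_B)=r$. The dagger 2-category $\mathrm{Bimod}(\mathcal T)$ has SSFAs in $\mathcal T$ as objects, dagger $A$-$B$ bimodules as 1-morphisms $A\to B$, and bimodule homomorphisms as 2-morphisms, with the dagger of $\mathcal T$. The composite of $M:A\to B$ and $N:B\to D$, written $M\otimes N$, is the relative tensor product $M\otimes_B N$, the splitting of the dagger idempotent $(r_M\otimes l_N)(\mathrm{id}_M\otimes m_B^\dagger u_B\otimes\mathrm{id}_N)$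 on the object $M\otimes N$ of $\mathcal T$; the identity 1-morphism on $A$ is the bimodule $A$. Writing $\mathbb 1$ also for the trivial SSFA, $\mathcal T\cong \mathrm{End}(\mathbb 1)$ by viewing objects and morphisms of $\mathcal T$ as bimodules and bimodule homomorphisms over $\mathbb 1$. SSFAs $A,\tilde A$ are Morita equivalent if they are equivalent in $\mathrm{Bimod}(\mathcal T)$: there are 1-morphisms $X:A\to\tilde A$, $Y:\tilde A\to A$ and unitary 2-morphisms $\mathrm{id}_{\tilde A}\to Y\otimes X$, $X\otimes Y\to\mathrm{id}_A$. A right dual of a 1-morphism $X:r\to s$ consists of $X^*:s\to r$ and 2-morphisms $\eta:\mathrm{id}_s\to X^*\otimes X$, $\epsilon:X\otimes X^*\to\mathrm{id}_r$ satisfying the snake equations. It is standard if $\mathrm{Tr}[\eta^\dagger(\mathrm{id}_{X^*}\otimes T)\eta]=\mathrm{Tr}[\epsilon(T\otimes\mathrm{id}_{X^*})\epsilon^\dagger]$ for all $T\in\mathrm{End}(X)$, where $\mathrm{Tr}$ is the canonical trace on $\mathrm{End}(\mathrm{id}_s)$, respectively $\mathrm{End}(\mathrm{id}_r)$. With a standard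 right dual, $\dim_L(X)=\eta^\dagger\eta\in\mathrm{End}(\mathrm{id}_s)$; $X$ is separable if $\dim_L(X)$ is invertible, and then $n_X$ is its positive square root. The pair of pants algebra of a separable $X$ is the object $X\otimes X^*$ of $\mathrm{End}(r)$ with multiplication $\mathrm{id}_X\otimes(n_X^{-1}\eta^\dagger)\otimes\mathrm{id}_{X^*}$ and unit $(\mathrm{id}_X\otimes n_X\otimes\mathrm{id}_{X^*})\,\epsilon^\dagger$. Lemma. Let $\mathcal T$ be a rigid $C^*$-tensor category and let $A,\tilde A$ be SSFAs in $\mathcal T$. Then $A$ is Morita equivalent to $\tilde A$ if and only if there is a separable 1-morphism $M:\mathbb 1\to\tilde A$ in $\mathrm{Bimod}(\mathcal T)$, with a standard right dual $M^*$, such that $A$, regarded as an algebra in $\mathrm{End}(\mathbb 1)\cong\mathcal T$, is unitarily $*$-isomorphic to the pair of pants algebra $M\otimes M^*$. -/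

import Mathlib

open CategoryTheory MonoidalCategory

universe w v u

set_option linter.unusedSectionVars false

noncomputable section

namespace BimodT

/-- A dagger on a category: an involutive contravariant endofunctor, identity on objects. -/
class DaggerCategory (C : Type u) [Category.{v} C] where
  dagger : ∀ {X Y : C}, (X ⟶ Y) → (Y ⟶ X)
  dagger_dagger : ∀ {X Y : C} (f : X ⟶ Y), dagger (dagger f) = f
  dagger_id : ∀ X : C, dagger (𝟙 X) = 𝟙 X
  dagger_comp : ∀ {X Y Z : C} (f : X ⟶ Y) (g : Y ⟶ Z),
    dagger (f ≫ g) = dagger g ≫ dagger f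

postfix:max "†" => DaggerCategory.dagger

attribute [simp] DaggerCategory.dagger_dagger DaggerCategory.dagger_id DaggerCategory.dagger_comp

/-- A `C⋆`-category. -/
class CStarCategory (C : Type u) [Category.{v} C] [Preadditive C] [Linear ℂ C] extends
    DaggerCategory C where
  dagger_add : ∀ {X Y : C} (f g : X ⟶ Y), dagger (f + g) = dagger f + dagger g
  dagger_smul : ∀ {X Y : C} (c : ℂ) (f : X ⟶ Y), dagger (c • f) = (starRingEnd ℂ c) • dagger f
  norm : ∀ {X Y : C}, (X ⟶ Y) → ℝ
  norm_add_le : ∀ {X Y : C} (f g : X ⟶ Y), norm (f + g) ≤ norm f + norm g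
  norm_smul : ∀ {X Y : C} (c : ℂ) (f : X ⟶ Y), norm (c • f) = ‖c‖ * norm f
  eq_zero_of_norm_eq_zero : ∀ {X Y : C} (f : X ⟶ Y), norm f = 0 → f = 0
  /-- Cauchy sequences of morphisms converge. -/
  complete : ∀ {X Y : C} (s : ℕ → (X ⟶ Y)),
    (∀ ε : ℝ, 0 < ε → ∃ N, ∀ m n, N ≤ m → N ≤ n → norm (s m - s n) < ε) →
      ∃ l : X ⟶ Y, ∀ ε : ℝ, 0 < ε → ∃ N, ∀ n, N ≤ n → norm (s n - l) < ε
  norm_comp_le : ∀ {X Y Z : C} (f : X ⟶ Y) (g : Y ⟶ Z), norm (f ≫ g) ≤ norm f * norm g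
  norm_comp_dagger : ∀ {X Y : C} (f : X ⟶ Y), norm (f ≫ dagger f) = norm f ^ 2
  /-- The endomorphism `f† ∘ f` is a positive element of the `C⋆`-algebra `End X`. -/
  positive : ∀ {X Y : C} (f : X ⟶ Y), ∃ g : X ⟶ X, f ≫ dagger f = g ≫ dagger g

/-- A (semisimple) rigid `C⋆`-tensor category; the tensor unit is not assumed to be simple. -/
class RigidCStarTensorCategory (C : Type u) [Category.{v} C] [Preadditive C] [Linear ℂ C]
    [MonoidalCategory C] [MonoidalPreadditive C] [MonoidalLinear ℂ C] extends
    CStarCategory C where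
  dagger_whiskerLeft : ∀ (X : C) {Y Z : C} (f : Y ⟶ Z), dagger (X ◁ f) = X ◁ dagger f
  dagger_whiskerRight : ∀ {X Y : C} (f : X ⟶ Y) (Z : C), dagger (f ▷ Z) = dagger f ▷ Z
  dagger_associator : ∀ X Y Z : C, dagger (α_ X Y Z).hom = (α_ X Y Z).inv
  dagger_leftUnitor : ∀ X : C, dagger (λ_ X).hom = (λ_ X).inv
  dagger_rightUnitor : ∀ X : C, dagger (ρ_ X).hom = (ρ_ X).inv
  /-- There is a zero object. -/
  exists_zero : ∃ Z : C, 𝟙 Z = 0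
  /-- There are orthogonal direct sums. -/
  exists_directSum : ∀ X Y : C, ∃ (S : C) (i : X ⟶ S) (j : Y ⟶ S),
    i ≫ dagger i = 𝟙 X ∧ j ≫ dagger j = 𝟙 Y ∧ dagger i ≫ i + dagger j ≫ j = 𝟙 S
  /-- Dagger idempotents split. -/
  exists_splitting : ∀ (X : C) (p : X ⟶ X), dagger p = p → p ≫ p = p →
    ∃ (V : C) (i : V ⟶ X), i ≫ dagger i = 𝟙 V ∧ dagger i ≫ i = p
  finiteDimensional_end : ∀ X : C, FiniteDimensional ℂ (X ⟶ X)
  /-- Every object `X` has a right dual `Y`, with cup `𝟙 ⟶ Y ⊗ X` and cap `X ⊗ Y ⟶ 𝟙`. -/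
  exists_dual : ∀ X : C, ∃ Y : C, Nonempty (ExactPairing Y X)

attribute [simp] RigidCStarTensorCategory.dagger_whiskerLeft
  RigidCStarTensorCategory.dagger_whiskerRight RigidCStarTensorCategory.dagger_associator
  RigidCStarTensorCategory.dagger_leftUnitor RigidCStarTensorCategory.dagger_rightUnitor

section Dagger

variable {C : Type u} [Category.{v} C] [DaggerCategory C]

def IsUnitary {X Y : C} (f : X ⟶ Y) : Prop := f ≫ f† = 𝟙 X ∧ f† ≫ f = 𝟙 Y

/-- A positive endomorphism: one of the form `g† ∘ g`. -/
def IsPositive {X : C} (f : X ⟶ X) : Prop := ∃ (Y : C) (g : X ⟶ Y), f = g ≫ g†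

end Dagger

/-- The canonical trace on a finite-dimensional commutative `C⋆`-algebra of endomorphisms:
the trace of the operator of multiplication by `f`. It is the unique linear functional
that takes the value `1` on every minimal projection. -/
def canonicalTrace {C : Type u} [Category.{v} C] [Preadditive C] [Linear ℂ C] {X : C}
    (f : X ⟶ X) : ℂ :=
  LinearMap.trace ℂ (X ⟶ X) (Linear.leftComp ℂ X f)

lemma trace_mul_minimal {R : Type*} [CommRing R] [Algebra ℂ R] [FiniteDimensional ℂ R]
    (s : R → R) (hs : ∀ a, s (s a) = a) (hm : ∀ a b, s (a * b) = s a * s b)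
    (ha : ∀ a b, s (a - b) = s a - s b)
    (h0 : ∀ a, a * s a = 0 → a = 0) (p : R) (hp : p * p = p) (hp0 : p ≠ 0)
    (hmin : ∀ q, s q = q → q * q = q → q * p = q → q = 0 ∨ q = p) :
    LinearMap.trace ℂ R (LinearMap.mulLeft ℂ p) = 1 := by
  have hred : ∀ c : R, c * c = 0 → c = 0 := by
    intro c hc
    refine h0 c (h0 _ ?_)
    rw [hm, hs]
    calc _ = c * c * (s c * s c) := by ring
      _ = 0 := by rw [hc, zero_mul]
  have h1 : s 1 = 1 := by
    have := hm 1 (s 1)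
    rw [one_mul, hs] at this
    simpa using this.symm
  have hidem : ∀ e : R, e * e = e → s e = e := by
    have key : ∀ e : R, e * e = e → e = e * s e := by
      intro e he
      have := h0 (e * (1 - s e)) (by
        rw [hm, ha, hs, h1]
        calc _ = (e - e * e) * (s e * (1 - s e)) := by ring
          _ = 0 := by rw [he, sub_self, zero_mul])
      rw [mul_sub, mul_one] at this
      exact sub_eq_zero.mp this
    intro e he
    have hse : s e * s e = s e := by rw [← hm, he]
    have h2 := key _ hse
    rw [hs, mul_comm, ← key e he] at h2
    exact h2
  have hscalar : ∀ a : R, a * p = a → ∃ c : ℂ, a = c • p := by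
    intro a hap
    let V : Submodule ℂ R := LinearMap.range (LinearMap.mulLeft ℂ p)
    have hV : ∀ x ∈ V, x * p = x := by
      rintro _ ⟨y, rfl⟩
      simp only [LinearMap.mulLeft_apply]
      rw [mul_comm, ← mul_assoc, hp]
    have hpV : p ∈ V := ⟨p, by simp [hp]⟩
    have mk : ∀ b : R, ∀ x ∈ V, LinearMap.mulLeft ℂ b x ∈ V := by
      rintro b _ ⟨y, rfl⟩
      exact ⟨b * y, by simp; ring⟩
    have hnt : Nontrivial V := ⟨⟨⟨p, hpV⟩, 0, fun h => hp0 (congrArg Subtype.val h)⟩⟩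
    obtain ⟨c, hc⟩ := Module.End.exists_eigenvalue ((LinearMap.mulLeft ℂ a).restrict (mk a))
    obtain ⟨x, hx⟩ := hc.exists_hasEigenvector
    have hx1 : a * x.1 = c • x.1 := by
      have := congrArg Subtype.val hx.apply_eq_smul
      simpa using this
    have hx0 : x.1 ≠ 0 := fun h => hx.2 (Subtype.ext h)
    refine ⟨c, ?_⟩
    set b := a - c • p with hb
    have hbx : b * x.1 = 0 := by
      rw [hb, sub_mul, hx1, smul_mul_assoc, mul_comm p, hV _ x.2, sub_self]
    have hbp : b * p = b := by rw [hb, sub_mul, hap, smul_mul_assoc, hp]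
    obtain ⟨n, hn, hn1⟩ := ((LinearMap.mulLeft ℂ b).eventually_isCompl_ker_pow_range_pow.and
      (Filter.eventually_ge_atTop 1)).exists
    rw [LinearMap.pow_mulLeft] at hn
    obtain ⟨y, hy, _, ⟨z, rfl⟩, hyz⟩ := Submodule.mem_sup.1
      (hn.sup_eq_top ▸ Submodule.mem_top (x := p))
    simp only [LinearMap.mem_ker, LinearMap.mulLeft_apply] at hy hyz
    obtain ⟨n, rfl⟩ := Nat.exists_eq_add_of_le' hn1
    have hred' : IsReduced R := (isReduced_iff_pow_one_lt 2 one_lt_two).2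
      fun c hc => hred c (by rw [← pow_two, hc])
    have hby : b * y = 0 := by
      refine (pow_eq_zero_iff (Nat.succ_ne_zero n)).1 (?_ : (b * y) ^ (n + 1) = 0)
      rw [mul_pow, pow_succ y, mul_comm (y ^ n), ← mul_assoc, hy, zero_mul]
    have hbnp : b ^ (n + 1) * p = b ^ (n + 1) := by rw [pow_succ, mul_assoc, hbp]
    have hyp : y * p = y := by
      have h2 : y = p - b ^ (n + 1) * z := by rw [← hyz]; ring
      rw [h2, sub_mul, hp, mul_right_comm, hbnp]
    have hyy : y * y = y := by
      have h2 : y * (y + b ^ (n + 1) * z) = y := by rw [hyz, hyp]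
      rw [mul_add, ← mul_assoc y, mul_comm y (b ^ _), hy, zero_mul, add_zero] at h2
      exact h2
    have hy0 : y ≠ 0 := by
      rintro rfl
      apply hx0
      rw [← hV _ x.2, ← hyz, zero_add, pow_succ]
      calc _ = b ^ n * z * (b * x.1) := by ring
        _ = 0 := by rw [hbx, mul_zero]
    rcases hmin y (hidem y hyy) hyy hyp with h | h
    · exact absurd h hy0
    · rw [h, hbp] at hby
      exact sub_eq_zero.1 hby
  have hproj : LinearMap.IsProj (ℂ ∙ p) (LinearMap.mulLeft ℂ p) := by
    constructor
    · intro a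
      obtain ⟨c, hc⟩ := hscalar (p * a) (by rw [mul_right_comm, hp])
      exact Submodule.mem_span_singleton.2 ⟨c, hc.symm⟩
    · intro a h
      obtain ⟨c, rfl⟩ := Submodule.mem_span_singleton.1 h
      simp [hp]
  rw [hproj.trace, finrank_span_singleton hp0, Nat.cast_one]

/-- The canonical trace takes the value `1` on every minimal projection. -/
lemma canonicalTrace_minimal {C : Type u} [Category.{v} C] [Preadditive C] [Linear ℂ C]
    [DaggerCategory C] {X : C} [FiniteDimensional ℂ (X ⟶ X)]
    (hcomm : ∀ f g : X ⟶ X, f ≫ g = g ≫ f)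
    (hsub : ∀ f g : X ⟶ X, (f - g)† = f† - g†)
    (hpos : ∀ f : X ⟶ X, f ≫ f† = 0 → f = 0)
    (p : X ⟶ X) (hp : p ≫ p = p) (hp0 : p ≠ 0)
    (hmin : ∀ q : X ⟶ X, q† = q → q ≫ q = q → q ≫ p = q → q = 0 ∨ q = p) :
    canonicalTrace p = 1 := by
  let _ : CommRing (End X) :=
    { (inferInstance : Ring (End X)) with mul_comm := fun a b => hcomm b a }
  have _ : FiniteDimensional ℂ (End X) := ‹_›
  have e : Linear.leftComp ℂ X p = LinearMap.mulLeft (A := End X) ℂ p := by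
    ext g
    exact hcomm p g
  rw [canonicalTrace, e]
  exact trace_mul_minimal (R := End X) (fun a : X ⟶ X => (a† : X ⟶ X))
    DaggerCategory.dagger_dagger (fun a b => (DaggerCategory.dagger_comp (X := X) b a).trans (hcomm _ _)) hsub
    (fun a h => hpos a ((hcomm _ _).trans h)) p hp hp0
    (fun q h1 h2 h3 => hmin q h1 h2 ((hcomm _ _).trans h3))

/-- The underlying data of an algebra in a monoidal category. -/
structure AlgebraData (C : Type u) [Category.{v} C] [MonoidalCategory C] where
  X : C
  mul : X ⊗ X ⟶ X
  one : 𝟙_ C ⟶ X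

namespace AlgebraData

variable {C : Type u} [Category.{v} C] [MonoidalCategory C] [DaggerCategory C]

/-- The cup `m† ∘ u`. -/
def cup (A : AlgebraData C) : 𝟙_ C ⟶ A.X ⊗ A.X := A.one ≫ A.mul†

/-- The cap `u† ∘ m`. -/
def cap (A : AlgebraData C) : A.X ⊗ A.X ⟶ 𝟙_ C := A.mul ≫ A.one†

structure IsStarHom (A B : AlgebraData C) (f : A.X ⟶ B.X) : Prop where
  map_mul : A.mul ≫ f = (f ⊗ₘ f) ≫ B.mul
  map_one : A.one ≫ f = B.one
  map_star : f† = (λ_ B.X).inv ≫ A.cup ▷ B.X ≫ (α_ A.X A.X B.X).hom ≫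
    A.X ◁ (f ▷ B.X) ≫ A.X ◁ B.cap ≫ (ρ_ A.X).hom

/-- `A` and `B` are unitarily `⋆`-isomorphic. -/
def UnitarilyStarIsomorphic (A B : AlgebraData C) : Prop :=
  ∃ f : A.X ⟶ B.X, IsStarHom A B f ∧ IsUnitary f

end AlgebraData

section T

variable (C : Type u) [Category.{v} C] [Preadditive C] [Linear ℂ C]
    [MonoidalCategory C] [MonoidalPreadditive C] [MonoidalLinear ℂ C] [RigidCStarTensorCategory C]

/-- A standard separable Frobenius algebra. -/
structure SSFA extends AlgebraData C where
  assoc : mul ▷ X ≫ mul = (α_ X X X).hom ≫ X ◁ mul ≫ mul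
  one_mul : one ▷ X ≫ mul = (λ_ X).hom
  mul_one : X ◁ one ≫ mul = (ρ_ X).hom
  frobenius_left : X ◁ mul† ≫ (α_ X X X).inv ≫ mul ▷ X = mul ≫ mul†
  frobenius_right : mul† ▷ X ≫ (α_ X X X).hom ≫ X ◁ mul = mul ≫ mul†
  separable : mul† ≫ mul = 𝟙 X
  /-- The self-duality of `X` given by the Frobenius cup and cap is standard. -/
  standard : ∀ T : X ⟶ X,
    canonicalTrace (toAlgebraData.cup ≫ X ◁ T ≫ toAlgebraData.cup†) =
      canonicalTrace (toAlgebraData.cap† ≫ T ▷ X ≫ toAlgebraData.cap)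

end T
section T

variable {C : Type u} [Category.{v} C] [Preadditive C] [Linear ℂ C]
    [MonoidalCategory C] [MonoidalPreadditive C] [MonoidalLinear ℂ C] [RigidCStarTensorCategory C]

@[simp] lemma dagger_associator_inv (X Y Z : C) : (α_ X Y Z).inv† = (α_ X Y Z).hom := by
  rw [← RigidCStarTensorCategory.dagger_associator, DaggerCategory.dagger_dagger]

@[simp] lemma dagger_leftUnitor_inv (X : C) : (λ_ X).inv† = (λ_ X).hom := by
  rw [← RigidCStarTensorCategory.dagger_leftUnitor, DaggerCategory.dagger_dagger]

@[simp] lemma dagger_rightUnitor_inv (X : C) : (ρ_ X).inv† = (ρ_ X).hom := by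
  rw [← RigidCStarTensorCategory.dagger_rightUnitor, DaggerCategory.dagger_dagger]

/-- `act` is a left dagger `A`-module structure on `M`. -/
structure IsLeftDaggerModule (A : SSFA C) (M : C) (act : A.X ⊗ M ⟶ M) : Prop where
  assoc : A.mul ▷ M ≫ act = (α_ A.X A.X M).hom ≫ A.X ◁ act ≫ act
  unit : A.one ▷ M ≫ act = (λ_ M).hom
  dagger : A.X ◁ act† ≫ (α_ A.X A.X M).inv ≫ A.cap ▷ M ≫ (λ_ M).hom = act

/-- `act` is a right dagger `B`-module structure on `M`. -/
structure IsRightDaggerModule (B : SSFA C) (M : C) (act : M ⊗ B.X ⟶ M) : Prop where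
  assoc : M ◁ B.mul ≫ act = (α_ M B.X B.X).inv ≫ act ▷ B.X ≫ act
  unit : M ◁ B.one ≫ act = (ρ_ M).hom
  dagger : act† ▷ B.X ≫ (α_ M B.X B.X).hom ≫ M ◁ B.cap ≫ (ρ_ M).hom = act

variable (A B D E : SSFA C)

/-- The trivial standard separable Frobenius algebra on the tensor unit. -/
def SSFA.trivial : SSFA C where
  X := 𝟙_ C
  mul := (λ_ (𝟙_ C)).hom
  one := 𝟙 (𝟙_ C)
  assoc := by monoidal
  one_mul := by monoidal
  mul_one := by monoidal
  frobenius_left := by simp only [RigidCStarTensorCategory.dagger_leftUnitor]; monoidal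
  frobenius_right := by simp only [RigidCStarTensorCategory.dagger_leftUnitor]; monoidal
  separable := by simp
  standard := by
    intro T
    congr 1
    simp [AlgebraData.cup, AlgebraData.cap, ← unitors_equal, unitors_inv_equal]

/-- An `A`-`B` dagger bimodule. -/
structure DaggerBimodule where
  X : C
  actL : A.X ⊗ X ⟶ X
  actR : X ⊗ B.X ⟶ X
  isLeft : IsLeftDaggerModule A X actL
  isRight : IsRightDaggerModule B X actR
  comm : actL ▷ B.X ≫ actR = (α_ A.X X B.X).hom ≫ A.X ◁ actR ≫ actL

variable {A B D E}

lemma IsLeftDaggerModule.act_dagger {M : C} {act : A.X ⊗ M ⟶ M}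
    (h : IsLeftDaggerModule A M act) :
    act† = (λ_ M).inv ≫ A.cup ▷ M ≫ (α_ A.X A.X M).hom ≫ A.X ◁ act := by
  conv_lhs => rw [← h.dagger]
  simp [AlgebraData.cup, AlgebraData.cap]

lemma IsRightDaggerModule.act_dagger {M : C} {act : M ⊗ B.X ⟶ M}
    (h : IsRightDaggerModule B M act) :
    act† = (ρ_ M).inv ≫ M ◁ B.cup ≫ (α_ M B.X B.X).inv ≫ act ▷ B.X := by
  conv_lhs => rw [← h.dagger]
  simp [AlgebraData.cup, AlgebraData.cap]


lemma SSFA.dagger_one_mul (A : SSFA C) : A.mul† ≫ A.one† ▷ A.X = (λ_ A.X).inv := by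
  simpa using congrArg (fun f => f†) A.one_mul

lemma SSFA.dagger_mul_one (A : SSFA C) : A.mul† ≫ A.X ◁ A.one† = (ρ_ A.X).inv := by
  simpa using congrArg (fun f => f†) A.mul_one

lemma isLeftDaggerModule_self : IsLeftDaggerModule A A.X A.mul where
  assoc := A.assoc
  unit := A.one_mul
  dagger := by
    have h := A.frobenius_left
    simp only [AlgebraData.cap, comp_whiskerRight, Category.assoc]
    rw [reassoc_of% h, reassoc_of% A.dagger_one_mul]
    simp

lemma isRightDaggerModule_self : IsRightDaggerModule A A.X A.mul where
  assoc := by rw [A.assoc]; simp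
  unit := A.mul_one
  dagger := by
    have h := A.frobenius_right
    simp only [AlgebraData.cap, MonoidalCategory.whiskerLeft_comp, Category.assoc]
    rw [reassoc_of% h, reassoc_of% A.dagger_mul_one]
    simp

/-- The left action on the first factor of a tensor product. -/
lemma IsLeftDaggerModule.tensor {M : C} {act : A.X ⊗ M ⟶ M}
    (h : IsLeftDaggerModule A M act) (N : C) :
    IsLeftDaggerModule A (M ⊗ N) ((α_ A.X M N).inv ≫ act ▷ N) where
  assoc := by
    have := congrArg (fun f => (α_ _ _ _).inv ≫ f ▷ N) h.assoc
    simp at this ⊢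
    simp [this]
  unit := by
    have := congrArg (fun f => (α_ _ _ _).inv ≫ f ▷ N) h.unit
    simpa using this
  dagger := by
    have := congrArg (fun f => (α_ _ _ _).inv ≫ f ▷ N) h.dagger
    simp at this ⊢
    rw [← this]

lemma IsRightDaggerModule.tensor {M : C} {act : M ⊗ B.X ⟶ M}
    (h : IsRightDaggerModule B M act) (N : C) :
    IsRightDaggerModule B (N ⊗ M) ((α_ N M B.X).hom ≫ N ◁ act) where
  assoc := by
    have := congrArg (fun f => (α_ _ _ _).hom ≫ N ◁ f) h.assoc
    simp at this ⊢
    simp [this]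
  unit := by
    have := congrArg (fun f => (α_ _ _ _).hom ≫ N ◁ f) h.unit
    simpa using this
  dagger := by
    have := congrArg (fun f => (α_ _ _ _).hom ≫ N ◁ f) h.dagger
    simp at this ⊢
    rw [← this]

/-- The left action on the splitting of a dagger idempotent commuting with the action. -/
lemma IsLeftDaggerModule.split {M V : C} {act : A.X ⊗ M ⟶ M}
    (h : IsLeftDaggerModule A M act) (i : V ⟶ M) (hi : i ≫ i† = 𝟙 V)
    (hc : A.X ◁ (i† ≫ i) ≫ act = act ≫ i† ≫ i) :
    IsLeftDaggerModule A V (A.X ◁ i ≫ act ≫ i†) where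
  assoc := by
    have e1 := h.assoc
    have e2 : act ≫ i† ≫ i ≫ i† = act ≫ i† := by rw [hi, Category.comp_id]
    simp only [MonoidalCategory.whiskerLeft_comp, Category.assoc] at hc ⊢
    rw [reassoc_of% hc, e2, ← whisker_exchange_assoc, reassoc_of% e1]
    simp
  unit := by
    rw [← whisker_exchange_assoc, reassoc_of% h.unit]
    simp [hi]
  dagger := by
    have e : act ≫ i† = (A.X ◁ act† ≫ (α_ A.X A.X M).inv ≫ A.cap ▷ M ≫ (λ_ M).hom) ≫ i† := by
      rw [h.dagger]
    conv_rhs => rw [e]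
    simp only [DaggerCategory.dagger_comp, RigidCStarTensorCategory.dagger_whiskerLeft,
      DaggerCategory.dagger_dagger, MonoidalCategory.whiskerLeft_comp, Category.assoc,
      ← leftUnitor_naturality]
    rw [← whisker_exchange_assoc]
    simp

/-- The right action on the splitting of a dagger idempotent commuting with the action. -/
lemma IsRightDaggerModule.split {M V : C} {act : M ⊗ B.X ⟶ M}
    (h : IsRightDaggerModule B M act) (i : V ⟶ M) (hi : i ≫ i† = 𝟙 V)
    (hc : (i† ≫ i) ▷ B.X ≫ act = act ≫ i† ≫ i) :
    IsRightDaggerModule B V (i ▷ B.X ≫ act ≫ i†) where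
  assoc := by
    have e1 := h.assoc
    have e2 : act ≫ i† ≫ i ≫ i† = act ≫ i† := by rw [hi, Category.comp_id]
    simp only [MonoidalCategory.comp_whiskerRight, Category.assoc] at hc ⊢
    rw [reassoc_of% hc, e2, whisker_exchange_assoc, reassoc_of% e1]
    simp
  unit := by
    rw [whisker_exchange_assoc, reassoc_of% h.unit]
    simp [hi]
  dagger := by
    have e : act ≫ i† = (act† ▷ B.X ≫ (α_ M B.X B.X).hom ≫ M ◁ B.cap ≫ (ρ_ M).hom) ≫ i† := by
      rw [h.dagger]
    conv_rhs => rw [e]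
    simp only [DaggerCategory.dagger_comp, RigidCStarTensorCategory.dagger_whiskerRight,
      DaggerCategory.dagger_dagger, MonoidalCategory.comp_whiskerRight, Category.assoc,
      ← rightUnitor_naturality]
    rw [whisker_exchange_assoc]
    simp

namespace DaggerBimodule

/-- The idempotent on `M ⊗ N` whose splitting is the relative tensor product. -/
def idem (M : DaggerBimodule A B) (N : DaggerBimodule B D) : M.X ⊗ N.X ⟶ M.X ⊗ N.X :=
  M.X ◁ ((λ_ N.X).inv ≫ B.cup ▷ N.X ≫ (α_ B.X B.X N.X).hom) ≫
    (α_ M.X B.X (B.X ⊗ N.X)).inv ≫ (M.actR ⊗ₘ N.actL)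

variable (M : DaggerBimodule A B) (N : DaggerBimodule B D) (P : DaggerBimodule D E)

lemma idem_eq_left : M.idem N = M.X ◁ N.actL† ≫ (α_ M.X B.X N.X).inv ≫ M.actR ▷ N.X := by
  rw [N.isLeft.act_dagger, idem, MonoidalCategory.tensorHom_def, ← whisker_exchange]
  simp

lemma idem_eq_right : M.idem N = M.actR† ▷ N.X ≫ (α_ M.X B.X N.X).hom ≫ M.X ◁ N.actL := by
  rw [M.isRight.act_dagger, idem, MonoidalCategory.tensorHom_def]
  simp

lemma idem_dagger : (M.idem N)† = M.idem N := by
  conv_rhs => rw [idem_eq_right]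
  rw [idem_eq_left]
  simp

lemma idem_idem : M.idem N ≫ M.idem N = M.idem N := by
  have h1 : (α_ B.X B.X N.X).hom ≫ B.X ◁ N.actL ≫ N.actL = B.mul ▷ N.X ≫ N.actL :=
    N.isLeft.assoc.symm
  have h2 : N.actL† ≫ B.X ◁ N.actL† ≫ (α_ B.X B.X N.X).inv = N.actL† ≫ B.mul† ▷ N.X := by
    simpa using congrArg (fun f => f†) h1
  have h3 : M.actR ▷ B.X ≫ M.actR = (α_ M.X B.X B.X).hom ≫ M.X ◁ B.mul ≫ M.actR := by
    rw [M.isRight.assoc]; simp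
  have h4 : B.mul† ▷ N.X ≫ B.mul ▷ N.X = 𝟙 _ := by
    rw [← comp_whiskerRight, B.separable, id_whiskerRight]
  rw [idem_eq_left]
  simp only [Category.assoc]
  rw [← whisker_exchange_assoc]
  calc _ = M.X ◁ (N.actL† ≫ B.X ◁ N.actL† ≫ (α_ B.X B.X N.X).inv) ≫ (α_ _ _ _).inv ≫
        (α_ _ _ _).inv ▷ _ ≫ (M.actR ▷ B.X ≫ M.actR) ▷ N.X := by simp
    _ = M.X ◁ (N.actL† ≫ B.mul† ▷ N.X ≫ B.mul ▷ N.X) ≫ (α_ _ _ _).inv ≫ M.actR ▷ N.X := by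
        rw [h2, h3]; simp
    _ = _ := by rw [h4]; simp

/-- The object underlying the relative tensor product. -/
def relObj : C :=
  (RigidCStarTensorCategory.exists_splitting _ _ (M.idem_dagger N) (M.idem_idem N)).choose

/-- The isometry from the relative tensor product to the tensor product. -/
def incl : M.relObj N ⟶ M.X ⊗ N.X :=
  (RigidCStarTensorCategory.exists_splitting _ _
    (M.idem_dagger N) (M.idem_idem N)).choose_spec.choose

lemma incl_isometry : M.incl N ≫ (M.incl N)† = 𝟙 _ :=
  (RigidCStarTensorCategory.exists_splitting _ _
    (M.idem_dagger N) (M.idem_idem N)).choose_spec.choose_spec.1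

lemma incl_dagger_incl : (M.incl N)† ≫ M.incl N = M.idem N :=
  (RigidCStarTensorCategory.exists_splitting _ _
    (M.idem_dagger N) (M.idem_idem N)).choose_spec.choose_spec.2

lemma incl_idem : M.incl N ≫ M.idem N = M.incl N := by
  rw [← incl_dagger_incl, ← Category.assoc, incl_isometry, Category.id_comp]

lemma idem_incl_dagger : M.idem N ≫ (M.incl N)† = (M.incl N)† := by
  rw [← incl_dagger_incl, Category.assoc, incl_isometry, Category.comp_id]

/-- The idempotent commutes with the left action on the first factor. -/
lemma idem_actL : A.X ◁ M.idem N ≫ (α_ A.X M.X N.X).inv ≫ M.actL ▷ N.X =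
    ((α_ A.X M.X N.X).inv ≫ M.actL ▷ N.X) ≫ M.idem N := by
  have h : (α_ A.X M.X B.X).inv ≫ M.actL ▷ B.X ≫ M.actR = A.X ◁ M.actR ≫ M.actL := by
    rw [M.comm]; simp
  have h' : A.X ◁ M.actR ▷ N.X ≫ (α_ _ _ _).inv ≫ M.actL ▷ N.X =
    (α_ _ _ _).inv ≫ (α_ _ _ _).inv ▷ N.X ≫ M.actL ▷ B.X ▷ N.X ≫ M.actR ▷ N.X := by
    simpa using congrArg (fun f => (α_ _ _ _).inv ≫ f ▷ N.X) h.symm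
  rw [idem_eq_left]
  simp only [Category.assoc, MonoidalCategory.whiskerLeft_comp]
  rw [← whisker_exchange_assoc, h']
  simp

lemma idem_actR : M.idem N ▷ D.X ≫ (α_ M.X N.X D.X).hom ≫ M.X ◁ N.actR =
    ((α_ M.X N.X D.X).hom ≫ M.X ◁ N.actR) ≫ M.idem N := by
  have h := N.comm
  have h' : M.X ◁ N.actL ▷ D.X ≫ M.X ◁ N.actR =
    M.X ◁ (α_ _ _ _).hom ≫ M.X ◁ B.X ◁ N.actR ≫ M.X ◁ N.actL := by
    simpa using congrArg (fun f => M.X ◁ f) h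
  rw [idem_eq_right]
  simp only [Category.assoc, MonoidalCategory.comp_whiskerRight]
  rw [whisker_exchange_assoc]
  simp [h']

/-- The trivial bimodule `A`. -/
def unit (A : SSFA C) : DaggerBimodule A A where
  X := A.X
  actL := A.mul
  actR := A.mul
  isLeft := isLeftDaggerModule_self
  isRight := isRightDaggerModule_self
  comm := A.assoc

/-- The relative tensor product of dagger bimodules. -/
def rel : DaggerBimodule A D where
  X := M.relObj N
  actL := A.X ◁ M.incl N ≫ ((α_ A.X M.X N.X).inv ≫ M.actL ▷ N.X) ≫ (M.incl N)†
  actR := M.incl N ▷ D.X ≫ ((α_ M.X N.X D.X).hom ≫ M.X ◁ N.actR) ≫ (M.incl N)†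
  isLeft := (M.isLeft.tensor N.X).split (M.incl N) (M.incl_isometry N)
    (by rw [incl_dagger_incl, idem_actL])
  isRight := (N.isRight.tensor M.X).split (M.incl N) (M.incl_isometry N)
    (by rw [incl_dagger_incl, idem_actR])
  comm := by
    have h1 := M.idem_actL N
    have h2 := M.idem_actR N
    simp only [Category.assoc, MonoidalCategory.comp_whiskerRight,
      MonoidalCategory.whiskerLeft_comp] at h1 h2 ⊢
    have h1' : A.X ◁ (M.incl N)† ≫ A.X ◁ M.incl N = A.X ◁ M.idem N := by
      rw [← MonoidalCategory.whiskerLeft_comp, incl_dagger_incl]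
    have h2' : (M.incl N)† ▷ D.X ≫ M.incl N ▷ D.X = M.idem N ▷ D.X := by
      rw [← MonoidalCategory.comp_whiskerRight, incl_dagger_incl]
    rw [reassoc_of% h2', reassoc_of% h2, reassoc_of% h1', reassoc_of% h1, idem_incl_dagger]
    have h3 := whisker_exchange M.actL N.actR
    have h4 : A.X ◁ M.X ◁ N.actR ≫ (α_ A.X M.X N.X).inv ≫ M.actL ▷ N.X =
        (α_ _ _ _).inv ≫ M.actL ▷ (N.X ⊗ D.X) ≫ M.X ◁ N.actR := by
      rw [← h3]; simp
    rw [reassoc_of% h4]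
    simp

/-- Bimodule homomorphisms. -/
@[ext]
structure Hom {A B : SSFA C} (M N : DaggerBimodule A B) where
  hom : M.X ⟶ N.X
  left : A.X ◁ hom ≫ N.actL = M.actL ≫ hom
  right : hom ▷ B.X ≫ N.actR = M.actR ≫ hom

instance : Category (DaggerBimodule A B) where
  Hom M N := Hom M N
  id M := ⟨𝟙 M.X, by simp, by simp⟩
  comp f g := ⟨f.hom ≫ g.hom, by simp [g.left, reassoc_of% f.left],
    by simp [g.right, reassoc_of% f.right]⟩

@[ext] lemma hom_ext {M N : DaggerBimodule A B} {f g : M ⟶ N} (h : f.hom = g.hom) : f = g :=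
  Hom.ext h

@[simp] lemma id_hom (M : DaggerBimodule A B) : Hom.hom (𝟙 M) = 𝟙 M.X := rfl

@[simp] lemma comp_hom {M N K : DaggerBimodule A B} (f : M ⟶ N) (g : N ⟶ K) :
    (f ≫ g).hom = f.hom ≫ g.hom := rfl

lemma whiskerLeft_neg' (X : C) {Y Z : C} (f : Y ⟶ Z) : X ◁ (-f) = -(X ◁ f) :=
  (tensorLeft X).map_neg

lemma neg_whiskerRight' {Y Z : C} (f : Y ⟶ Z) (X : C) : (-f) ▷ X = -(f ▷ X) :=
  (tensorRight X).map_neg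

instance {M N : DaggerBimodule A B} : Zero (M ⟶ N) := ⟨⟨0, by simp, by simp⟩⟩

instance {M N : DaggerBimodule A B} : Add (M ⟶ N) :=
  ⟨fun f g => ⟨f.hom + g.hom, by simp [f.left, g.left], by simp [f.right, g.right]⟩⟩

instance {M N : DaggerBimodule A B} : Neg (M ⟶ N) :=
  ⟨fun f => ⟨-f.hom, by simp [whiskerLeft_neg', f.left], by simp [neg_whiskerRight', f.right]⟩⟩

instance {M N : DaggerBimodule A B} : AddCommGroup (M ⟶ N) where
  add_assoc f g h := hom_ext (add_assoc _ _ _)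
  zero_add f := hom_ext (zero_add _)
  add_zero f := hom_ext (add_zero _)
  add_comm f g := hom_ext (add_comm _ _)
  neg_add_cancel f := hom_ext (neg_add_cancel f.hom)
  nsmul := nsmulRec
  zsmul := zsmulRec

@[simp] lemma add_hom {M N : DaggerBimodule A B} (f g : M ⟶ N) :
    (f + g).hom = f.hom + g.hom := rfl

instance {M N : DaggerBimodule A B} : Module ℂ (M ⟶ N) where
  smul c f := ⟨c • f.hom, by simp [f.left], by simp [f.right]⟩
  one_smul f := hom_ext (one_smul ℂ f.hom)
  mul_smul c d f := hom_ext (mul_smul c d f.hom)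
  smul_zero c := hom_ext (smul_zero c)
  smul_add c f g := hom_ext (smul_add c f.hom g.hom)
  add_smul c d f := hom_ext (add_smul c d f.hom)
  zero_smul f := hom_ext (zero_smul ℂ f.hom)

@[simp] lemma smul_hom {M N : DaggerBimodule A B} (c : ℂ) (f : M ⟶ N) :
    (c • f).hom = c • f.hom := rfl

instance : Preadditive (DaggerBimodule A B) where
  add_comp _ _ _ f g h := by ext; simp
  comp_add _ _ _ f g h := by ext; simp

instance : Linear ℂ (DaggerBimodule A B) where
  homModule _ _ := inferInstance
  smul_comp _ _ _ c f g := by ext; simp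
  comp_smul _ _ _ f c g := by ext; simp

/-- The dagger of a bimodule homomorphism is its dagger in `C`. -/
instance : DaggerCategory (DaggerBimodule A B) where
  dagger {M N} f := ⟨f.hom†, by
      have h : f.hom ≫ N.actL† = M.actL† ≫ A.X ◁ f.hom := by
        rw [N.isLeft.act_dagger, M.isLeft.act_dagger]
        simp only [Category.assoc, ← MonoidalCategory.whiskerLeft_comp, ← f.left]
        simp only [MonoidalCategory.whiskerLeft_comp, ← associator_naturality_right_assoc]
        rw [← whisker_exchange_assoc]
        simp
      simpa using (congrArg (fun f => f†) h).symm, by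
      have h : f.hom ≫ N.actR† = M.actR† ≫ f.hom ▷ B.X := by
        rw [N.isRight.act_dagger, M.isRight.act_dagger]
        simp only [Category.assoc, ← MonoidalCategory.comp_whiskerRight, ← f.right]
        simp only [MonoidalCategory.comp_whiskerRight, ← associator_inv_naturality_left_assoc]
        rw [whisker_exchange_assoc]
        simp
      simpa using (congrArg (fun f => f†) h).symm⟩
  dagger_dagger f := hom_ext (DaggerCategory.dagger_dagger f.hom)
  dagger_id M := hom_ext (DaggerCategory.dagger_id M.X)
  dagger_comp f g := hom_ext (DaggerCategory.dagger_comp f.hom g.hom)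

@[simp] lemma dagger_hom {M N : DaggerBimodule A B} (f : M ⟶ N) : (f†).hom = f.hom† := rfl

/-- A unitary bimodule homomorphism as an isomorphism. -/
@[simps] def isoOfUnitary {M N : DaggerBimodule A B} (f : M ⟶ N)
    (h₁ : f.hom ≫ f.hom† = 𝟙 M.X) (h₂ : f.hom† ≫ f.hom = 𝟙 N.X) : M ≅ N where
  hom := f
  inv := f†
  hom_inv_id := hom_ext h₁
  inv_hom_id := hom_ext h₂

/-- The isometry `M ⊗_B N ⟶ M ⊗ N`. -/
def inc (M : DaggerBimodule A B) (N : DaggerBimodule B D) : (M.rel N).X ⟶ M.X ⊗ N.X := M.incl N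

section Composition

variable {M M' : DaggerBimodule A B} {N N' : DaggerBimodule B D} {P P' : DaggerBimodule D E}

lemma inc_isometry : M.inc N ≫ (M.inc N)† = 𝟙 _ := M.incl_isometry N

lemma inc_dagger_inc : (M.inc N)† ≫ M.inc N = M.idem N := M.incl_dagger_incl N

lemma inc_idem : M.inc N ≫ M.idem N = M.inc N := M.incl_idem N

lemma idem_inc_dagger : M.idem N ≫ (M.inc N)† = (M.inc N)† := M.idem_incl_dagger N

lemma inc_cancel {Z : C} {f g : Z ⟶ (M.rel N).X} (h : f ≫ M.inc N = g ≫ M.inc N) : f = g := by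
  have := congrArg (fun f => f ≫ (M.inc N)†) h
  simpa [inc_isometry] using this

lemma idem_right (f : M ⟶ M') : f.hom ▷ N.X ≫ M'.idem N = M.idem N ≫ f.hom ▷ N.X := by
  have h : f.hom ▷ B.X ▷ N.X ≫ M'.actR ▷ N.X = M.actR ▷ N.X ≫ f.hom ▷ N.X := by
    simpa using congrArg (fun f => f ▷ N.X) f.right
  rw [idem_eq_left, idem_eq_left, ← whisker_exchange_assoc]
  simp [h]

lemma idem_left (g : N ⟶ N') : M.X ◁ g.hom ≫ M.idem N' = M.idem N ≫ M.X ◁ g.hom := by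
  have h : M.X ◁ B.X ◁ g.hom ≫ M.X ◁ N'.actL = M.X ◁ N.actL ≫ M.X ◁ g.hom := by
    simpa using congrArg (fun f => M.X ◁ f) g.left
  rw [idem_eq_right, idem_eq_right, whisker_exchange_assoc]
  simp [h]

variable (M N P) in
lemma actL_inc : (M.rel N).actL ≫ M.inc N =
    A.X ◁ M.inc N ≫ (α_ A.X M.X N.X).inv ≫ M.actL ▷ N.X := by
  have h0 : (M.rel N).actL = A.X ◁ M.inc N ≫ ((α_ A.X M.X N.X).inv ≫ M.actL ▷ N.X) ≫
    (M.inc N)† := rfl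
  have h := M.idem_actL N
  simp only [h0, Category.assoc] at h ⊢
  rw [inc_dagger_inc, ← h, ← MonoidalCategory.whiskerLeft_comp_assoc, inc_idem]

variable (M N P) in
lemma actR_inc : (M.rel N).actR ≫ M.inc N =
    M.inc N ▷ D.X ≫ (α_ M.X N.X D.X).hom ≫ M.X ◁ N.actR := by
  have h0 : (M.rel N).actR = M.inc N ▷ D.X ≫ ((α_ M.X N.X D.X).hom ≫ M.X ◁ N.actR) ≫
    (M.inc N)† := rfl
  have h := M.idem_actR N
  simp only [h0, Category.assoc] at h ⊢
  rw [inc_dagger_inc, ← h, ← MonoidalCategory.comp_whiskerRight_assoc, inc_idem]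

lemma right_aux (f : M ⟶ M') :
    (M.inc N ≫ f.hom ▷ N.X ≫ (M'.inc N)†) ≫ M'.inc N = M.inc N ≫ f.hom ▷ N.X := by
  simp only [Category.assoc, inc_dagger_inc, idem_right]
  rw [← Category.assoc, inc_idem]

lemma left_aux (g : N ⟶ N') :
    (M.inc N ≫ M.X ◁ g.hom ≫ (M.inc N')†) ≫ M.inc N' = M.inc N ≫ M.X ◁ g.hom := by
  simp only [Category.assoc, inc_dagger_inc, idem_left]
  rw [← Category.assoc, inc_idem]

/-- The relative tensor product `f ⊗_B 𝟙`. -/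
def relRight (f : M ⟶ M') (N : DaggerBimodule B D) : M.rel N ⟶ M'.rel N where
  hom := M.inc N ≫ f.hom ▷ N.X ≫ (M'.inc N)†
  left := inc_cancel (M := M') (N := N) <| by
    have h' := congrArg (fun f => A.X ◁ M.inc N ≫ (α_ _ _ _).inv ≫ f ▷ N.X) f.left
    rw [Category.assoc, Category.assoc, actL_inc, right_aux, ← whiskerLeft_comp_assoc,
      right_aux, reassoc_of% (actL_inc M N)]
    simpa using h'
  right := inc_cancel (M := M') (N := N) <| by
    rw [Category.assoc, Category.assoc, actR_inc, right_aux, ← comp_whiskerRight_assoc,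
      right_aux, reassoc_of% (actR_inc M N)]
    simp only [comp_whiskerRight, Category.assoc, whisker_exchange]
    simp

/-- The relative tensor product `𝟙 ⊗_B g`. -/
def relLeft (M : DaggerBimodule A B) (g : N ⟶ N') : M.rel N ⟶ M.rel N' where
  hom := M.inc N ≫ M.X ◁ g.hom ≫ (M.inc N')†
  left := inc_cancel (M := M) (N := N') <| by
    rw [Category.assoc, Category.assoc, actL_inc, left_aux, ← whiskerLeft_comp_assoc,
      left_aux, reassoc_of% (actL_inc M N)]
    simp only [whiskerLeft_comp, Category.assoc, ← whisker_exchange]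
    simp
  right := inc_cancel (M := M) (N := N') <| by
    have h' := congrArg (fun f => M.inc N ▷ D.X ≫ (α_ _ _ _).hom ≫ M.X ◁ f) g.right
    rw [Category.assoc, Category.assoc, actR_inc, left_aux, ← comp_whiskerRight_assoc,
      left_aux, reassoc_of% (actR_inc M N)]
    simpa using h'

lemma relRight_inc (f : M ⟶ M') (N : DaggerBimodule B D) :
    (relRight f N).hom ≫ M'.inc N = M.inc N ≫ f.hom ▷ N.X := right_aux f

lemma relLeft_inc (M : DaggerBimodule A B) (g : N ⟶ N') :
    (relLeft M g).hom ≫ M.inc N' = M.inc N ≫ M.X ◁ g.hom := left_aux g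

/-! ### Unitors -/

lemma actL_sep (M : DaggerBimodule A B) : M.actL† ≫ M.actL = 𝟙 M.X := by
  rw [M.isLeft.act_dagger]
  simp only [Category.assoc, ← M.isLeft.assoc, AlgebraData.cup, comp_whiskerRight]
  rw [← comp_whiskerRight_assoc A.mul†, A.separable, id_whiskerRight, Category.id_comp,
    M.isLeft.unit, Iso.inv_hom_id]

lemma actR_sep (M : DaggerBimodule A B) : M.actR† ≫ M.actR = 𝟙 M.X := by
  rw [M.isRight.act_dagger]
  have h := M.isRight.assoc
  simp only [Category.assoc, ← h, AlgebraData.cup, whiskerLeft_comp]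
  rw [← whiskerLeft_comp_assoc _ B.mul†, B.separable, MonoidalCategory.whiskerLeft_id,
    Category.id_comp, M.isRight.unit, Iso.inv_hom_id]

lemma idem_unit_left (M : DaggerBimodule A B) : (unit A).idem M = M.actL ≫ M.actL† := by
  have h1 : A.mul† = _ := isLeftDaggerModule_self.act_dagger (A := A)
  have h2 := M.isLeft.assoc
  have h3 : A.X ◁ A.X ◁ M.actL ≫ A.X ◁ M.actL =
    A.X ◁ (α_ _ _ _).inv ≫ A.X ◁ A.mul ▷ M.X ≫ A.X ◁ M.actL := by
    rw [← MonoidalCategory.whiskerLeft_comp, ← MonoidalCategory.whiskerLeft_comp,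
      ← MonoidalCategory.whiskerLeft_comp, h2, Iso.inv_hom_id_assoc]
  rw [idem_eq_right, M.isLeft.act_dagger]
  change A.mul† ▷ M.X ≫ _ = _
  rw [h1, leftUnitor_inv_naturality_assoc, whisker_exchange_assoc,
    associator_naturality_right_assoc, h3]
  simp [unit]

lemma idem_unit_right (M : DaggerBimodule A B) : M.idem (unit B) = M.actR ≫ M.actR† := by
  have h1 : B.mul† = _ := isRightDaggerModule_self.act_dagger (B := B)
  have h2 := M.isRight.assoc
  have h3 : M.actR ▷ B.X ▷ B.X ≫ M.actR ▷ B.X =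
    (α_ _ _ _).hom ▷ _ ≫ (M.X ◁ B.mul) ▷ B.X ≫ M.actR ▷ B.X := by
    rw [← comp_whiskerRight, ← comp_whiskerRight,
      ← comp_whiskerRight, h2, Iso.hom_inv_id_assoc]
  rw [idem_eq_left, M.isRight.act_dagger]
  change M.X ◁ B.mul† ≫ _ = _
  rw [h1, rightUnitor_inv_naturality_assoc, ← whisker_exchange_assoc,
    associator_inv_naturality_left_assoc, h3]
  simp [unit]

/-- The isometry `A ⊗_A M ⟶ A ⊗ M`. -/
def incL (M : DaggerBimodule A B) : ((unit A).rel M).X ⟶ A.X ⊗ M.X := (unit A).inc M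

/-- The isometry `M ⊗_B B ⟶ M ⊗ B`. -/
def incR (M : DaggerBimodule A B) : (M.rel (unit B)).X ⟶ M.X ⊗ B.X := M.inc (unit B)

lemma incL_isometry (M : DaggerBimodule A B) : M.incL ≫ M.incL† = 𝟙 _ :=
  inc_isometry (M := unit A) (N := M)

lemma incR_isometry (M : DaggerBimodule A B) : M.incR ≫ M.incR† = 𝟙 _ :=
  inc_isometry (M := M) (N := unit B)

lemma incL_dagger_incL (M : DaggerBimodule A B) : M.incL† ≫ M.incL = M.actL ≫ M.actL† :=
  (inc_dagger_inc (M := unit A) (N := M)).trans (idem_unit_left M)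

lemma incR_dagger_incR (M : DaggerBimodule A B) : M.incR† ≫ M.incR = M.actR ≫ M.actR† :=
  (inc_dagger_inc (M := M) (N := unit B)).trans (idem_unit_right M)

lemma incL_idem (M : DaggerBimodule A B) : M.incL ≫ M.actL ≫ M.actL† = M.incL := by
  rw [← incL_dagger_incL, ← Category.assoc, incL_isometry, Category.id_comp]

lemma incR_idem (M : DaggerBimodule A B) : M.incR ≫ M.actR ≫ M.actR† = M.incR := by
  rw [← incR_dagger_incR, ← Category.assoc, incR_isometry, Category.id_comp]

lemma actL_incL (M : DaggerBimodule A B) : ((unit A).rel M).actL ≫ M.incL =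
    A.X ◁ M.incL ≫ (α_ A.X A.X M.X).inv ≫ A.mul ▷ M.X := actL_inc (unit A) M

lemma actR_incL (M : DaggerBimodule A B) : ((unit A).rel M).actR ≫ M.incL =
    M.incL ▷ B.X ≫ (α_ A.X M.X B.X).hom ≫ A.X ◁ M.actR := actR_inc (unit A) M

lemma actL_incR (M : DaggerBimodule A B) : (M.rel (unit B)).actL ≫ M.incR =
    A.X ◁ M.incR ≫ (α_ A.X M.X B.X).inv ≫ M.actL ▷ B.X := actL_inc M (unit B)

lemma actR_incR (M : DaggerBimodule A B) : (M.rel (unit B)).actR ≫ M.incR =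
    M.incR ▷ B.X ≫ (α_ M.X B.X B.X).hom ≫ M.X ◁ B.mul := actR_inc M (unit B)

/-- The left unitor. -/
def leftU (M : DaggerBimodule A B) : (unit A).rel M ≅ M :=
  isoOfUnitary ⟨M.incL ≫ M.actL, by
      rw [reassoc_of% (actL_incL M), whiskerLeft_comp_assoc, M.isLeft.assoc,
        Iso.inv_hom_id_assoc], by
      rw [reassoc_of% (actR_incL M), comp_whiskerRight_assoc, M.comm]⟩
    (show (M.incL ≫ M.actL) ≫ (M.incL ≫ M.actL)† = _ by
      rw [DaggerCategory.dagger_comp, Category.assoc, reassoc_of% M.incL_idem, incL_isometry])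
    (show (M.incL ≫ M.actL)† ≫ (M.incL ≫ M.actL) = _ by
      rw [DaggerCategory.dagger_comp, Category.assoc, reassoc_of% M.incL_dagger_incL,
        actL_sep, Category.comp_id, actL_sep])

/-- The right unitor. -/
def rightU (M : DaggerBimodule A B) : M.rel (unit B) ≅ M :=
  isoOfUnitary ⟨M.incR ≫ M.actR, by
      rw [reassoc_of% (actL_incR M), whiskerLeft_comp_assoc, M.comm, Iso.inv_hom_id_assoc], by
      rw [reassoc_of% (actR_incR M), comp_whiskerRight_assoc, M.isRight.assoc,
        Iso.hom_inv_id_assoc]⟩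
    (show (M.incR ≫ M.actR) ≫ (M.incR ≫ M.actR)† = _ by
      rw [DaggerCategory.dagger_comp, Category.assoc, reassoc_of% M.incR_idem, incR_isometry])
    (show (M.incR ≫ M.actR)† ≫ (M.incR ≫ M.actR) = _ by
      rw [DaggerCategory.dagger_comp, Category.assoc, reassoc_of% M.incR_dagger_incR,
        actR_sep, Category.comp_id, actR_sep])

lemma leftU_hom (M : DaggerBimodule A B) : (leftU M).hom.hom = M.incL ≫ M.actL := rfl

lemma rightU_hom (M : DaggerBimodule A B) : (rightU M).hom.hom = M.incR ≫ M.actR := rfl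

/-! ### The associator -/

lemma idem_rel_right (M : DaggerBimodule A B) (N : DaggerBimodule B D) (P : DaggerBimodule D E) :
    M.idem (N.rel P) ≫ M.X ◁ N.inc P =
      M.X ◁ N.inc P ≫ (α_ _ _ _).inv ≫ M.idem N ▷ P.X ≫ (α_ _ _ _).hom := by
  rw [idem_eq_right, idem_eq_right, Category.assoc, Category.assoc,
    ← MonoidalCategory.whiskerLeft_comp, actL_inc]
  simp only [MonoidalCategory.whiskerLeft_comp, comp_whiskerRight, Category.assoc]
  rw [← associator_naturality_right_assoc, ← whisker_exchange_assoc]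
  simp

lemma idem_rel_left (M : DaggerBimodule A B) (N : DaggerBimodule B D) (P : DaggerBimodule D E) :
    (M.rel N).idem P ≫ M.inc N ▷ P.X =
      M.inc N ▷ P.X ≫ (α_ _ _ _).hom ≫ M.X ◁ N.idem P ≫ (α_ _ _ _).inv := by
  rw [idem_eq_left, idem_eq_left, Category.assoc, Category.assoc,
    ← MonoidalCategory.comp_whiskerRight, actR_inc]
  simp only [MonoidalCategory.whiskerLeft_comp, comp_whiskerRight, Category.assoc]
  rw [← associator_inv_naturality_left_assoc, whisker_exchange_assoc]
  simp

/-- The underlying morphism of the associator. -/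
def assocHom (M : DaggerBimodule A B) (N : DaggerBimodule B D) (P : DaggerBimodule D E) :
    ((M.rel N).rel P).X ⟶ (M.rel (N.rel P)).X :=
  (M.rel N).inc P ≫ M.inc N ▷ P.X ≫ (α_ _ _ _).hom ≫ M.X ◁ (N.inc P)† ≫ (M.inc (N.rel P))†

lemma assocHom_inc (M : DaggerBimodule A B) (N : DaggerBimodule B D) (P : DaggerBimodule D E) :
    assocHom M N P ≫ M.inc (N.rel P) ≫ M.X ◁ N.inc P =
      (M.rel N).inc P ≫ M.inc N ▷ P.X ≫ (α_ _ _ _).hom := by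
  have h : (M.rel N).inc P ≫ M.inc N ▷ P.X ≫ (α_ _ _ _).hom ≫ M.X ◁ N.idem P =
      (M.rel N).inc P ≫ M.inc N ▷ P.X ≫ (α_ _ _ _).hom := by
    have := congrArg (fun f => (M.rel N).inc P ≫ f ≫ (α_ _ _ _).hom) (idem_rel_left M N P)
    rw [← Category.assoc, ← Category.assoc, inc_idem] at this
    simpa using this.symm
  simp only [assocHom, Category.assoc]
  rw [reassoc_of% (inc_dagger_inc (M := M) (N := N.rel P)), idem_rel_right,
    ← whiskerLeft_comp_assoc, inc_dagger_inc, reassoc_of% h, Iso.hom_inv_id_assoc,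
    ← comp_whiskerRight_assoc, inc_idem]

lemma assocHom_dagger_inc (M : DaggerBimodule A B) (N : DaggerBimodule B D)
    (P : DaggerBimodule D E) : (assocHom M N P)† ≫ (M.rel N).inc P ≫ M.inc N ▷ P.X =
      M.inc (N.rel P) ≫ M.X ◁ N.inc P ≫ (α_ _ _ _).inv := by
  have h : M.inc (N.rel P) ≫ M.X ◁ N.inc P ≫ (α_ _ _ _).inv ≫ M.idem N ▷ P.X =
      M.inc (N.rel P) ≫ M.X ◁ N.inc P ≫ (α_ _ _ _).inv := by
    have := congrArg (fun f => M.inc (N.rel P) ≫ f ≫ (α_ _ _ _).inv) (idem_rel_right M N P)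
    rw [← Category.assoc, ← Category.assoc, inc_idem] at this
    simpa using this.symm
  simp only [assocHom, Category.assoc, DaggerCategory.dagger_comp, DaggerCategory.dagger_dagger,
    RigidCStarTensorCategory.dagger_whiskerLeft, RigidCStarTensorCategory.dagger_whiskerRight,
    RigidCStarTensorCategory.dagger_associator]
  rw [reassoc_of% (inc_dagger_inc (M := M.rel N) (N := P)), idem_rel_left,
    ← comp_whiskerRight_assoc, inc_dagger_inc, reassoc_of% h, Iso.inv_hom_id_assoc,
    ← whiskerLeft_comp_assoc, inc_idem]

lemma inc_cancel_left {M : DaggerBimodule A B} {N : DaggerBimodule B D} {P : DaggerBimodule D E}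
    {Z : C} {f g : Z ⟶ (M.rel (N.rel P)).X}
    (h : f ≫ M.inc (N.rel P) ≫ M.X ◁ N.inc P = g ≫ M.inc (N.rel P) ≫ M.X ◁ N.inc P) : f = g := by
  refine inc_cancel ?_
  have := congrArg (fun f => f ≫ M.X ◁ (N.inc P)†) h
  simpa [← MonoidalCategory.whiskerLeft_comp, inc_isometry] using this

lemma inc_cancel_right {M : DaggerBimodule A B} {N : DaggerBimodule B D} {P : DaggerBimodule D E}
    {Z : C} {f g : Z ⟶ ((M.rel N).rel P).X}
    (h : f ≫ (M.rel N).inc P ≫ M.inc N ▷ P.X = g ≫ (M.rel N).inc P ≫ M.inc N ▷ P.X) :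
    f = g := by
  refine inc_cancel ?_
  have := congrArg (fun f => f ≫ (M.inc N)† ▷ P.X) h
  simpa [← MonoidalCategory.comp_whiskerRight, inc_isometry] using this

/-- The associator. -/
def assoc (M : DaggerBimodule A B) (N : DaggerBimodule B D) (P : DaggerBimodule D E) :
    (M.rel N).rel P ≅ M.rel (N.rel P) :=
  isoOfUnitary ⟨assocHom M N P, by
      refine inc_cancel_left ?_
      simp only [Category.assoc]
      rw [assocHom_inc, reassoc_of% actL_inc, reassoc_of% actL_inc, ← whisker_exchange,
        ← comp_whiskerRight_assoc, actL_inc]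
      have h := congrArg (fun f => A.X ◁ f ≫ (α_ _ _ _).inv) (assocHom_inc M N P)
      simp at h ⊢
      rw [reassoc_of% h]
      simp, by
      refine inc_cancel_left ?_
      simp only [Category.assoc]
      rw [assocHom_inc, reassoc_of% actR_inc, reassoc_of% actR_inc, whisker_exchange_assoc,
        ← whiskerLeft_comp, actR_inc]
      have h := congrArg (fun f => f ▷ E.X ≫ (α_ _ _ _).hom) (assocHom_inc M N P)
      simp at h ⊢
      rw [reassoc_of% h]
      simp⟩
    (inc_cancel_right <| show (assocHom M N P ≫ (assocHom M N P)†) ≫ _ = _ by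
      rw [Category.assoc, assocHom_dagger_inc, reassoc_of% assocHom_inc]; simp)
    (inc_cancel_left <| show ((assocHom M N P)† ≫ assocHom M N P) ≫ _ = _ by
      rw [Category.assoc, assocHom_inc, reassoc_of% assocHom_dagger_inc]; simp)

lemma assoc_hom (M : DaggerBimodule A B) (N : DaggerBimodule B D) (P : DaggerBimodule D E) :
    (assoc M N P).hom.hom = assocHom M N P := rfl

lemma pentagon_aux {F : SSFA C} (M : DaggerBimodule A B) (N : DaggerBimodule B D)
    (P : DaggerBimodule D E) (Q : DaggerBimodule E F) :
    (relRight (assoc M N P).hom Q).hom ≫ assocHom M (N.rel P) Q ≫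
      (relLeft M (assoc N P Q).hom).hom =
    assocHom (M.rel N) P Q ≫ assocHom M N (P.rel Q) := by
  have hc : ∀ {Z : C} {f g : Z ⟶ M.X ⊗ (N.rel (P.rel Q)).X},
      f ≫ M.X ◁ (N.inc (P.rel Q) ≫ N.X ◁ P.inc Q) =
        g ≫ M.X ◁ (N.inc (P.rel Q) ≫ N.X ◁ P.inc Q) → f = g := by
    intro Z f g h
    have := congrArg (fun f => f ≫ M.X ◁ (N.inc (P.rel Q) ≫ N.X ◁ P.inc Q)†) h
    have e : (N.inc (P.rel Q) ≫ N.X ◁ P.inc Q) ≫ (N.inc (P.rel Q) ≫ N.X ◁ P.inc Q)† = 𝟙 _ := by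
      rw [DaggerCategory.dagger_comp, RigidCStarTensorCategory.dagger_whiskerLeft,
        Category.assoc, ← whiskerLeft_comp_assoc, inc_isometry,
        MonoidalCategory.whiskerLeft_id, Category.id_comp, inc_isometry]
    simpa only [Category.assoc, ← MonoidalCategory.whiskerLeft_comp, e,
      MonoidalCategory.whiskerLeft_id, Category.comp_id] using this
  refine inc_cancel (hc ?_)
  have h1 : (assoc N P Q).hom.hom ≫ N.inc (P.rel Q) ≫ N.X ◁ P.inc Q = _ := assocHom_inc N P Q
  have h2 := congrArg (fun f => f ▷ Q.X) (assocHom_inc M N P)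
  simp only [comp_whiskerRight] at h2
  have h3 := assocHom_inc M N (P.rel Q)
  simp only [Category.assoc]
  rw [reassoc_of% relLeft_inc, ← MonoidalCategory.whiskerLeft_comp, h1,
    MonoidalCategory.whiskerLeft_comp, MonoidalCategory.whiskerLeft_comp,
    reassoc_of% (assocHom_inc M (N.rel P) Q), reassoc_of% relRight_inc,
    MonoidalCategory.whiskerLeft_comp, reassoc_of% h3, ← associator_naturality_right,
    ← whisker_exchange_assoc, reassoc_of% (assocHom_inc (M.rel N) P Q),
    ← associator_naturality_middle_assoc, assoc_hom, reassoc_of% h2]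
  simp

lemma triangle_aux (M : DaggerBimodule A B) (N : DaggerBimodule B D) :
    assocHom M (unit B) N ≫ (relLeft M (leftU N).hom).hom = (relRight (rightU M).hom N).hom := by
  refine inc_cancel ?_
  have h : assocHom M (unit B) N ≫ M.inc ((unit B).rel N) ≫ M.X ◁ N.incL =
    (M.rel (unit B)).inc N ≫ M.incR ▷ N.X ≫ (α_ M.X B.X N.X).hom := assocHom_inc M (unit B) N
  have h1 : M.incR ▷ N.X = (rightU M).hom.hom ▷ N.X ≫ M.actR† ▷ N.X := by
    rw [rightU_hom, ← comp_whiskerRight, Category.assoc, incR_idem]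
  rw [Category.assoc, relLeft_inc, relRight_inc, leftU_hom, MonoidalCategory.whiskerLeft_comp,
    reassoc_of% h, h1, Category.assoc, ← idem_eq_right, idem_right, ← Category.assoc, inc_idem]

end Composition

end DaggerBimodule

open DaggerBimodule

/-- The 2-category of standard separable Frobenius algebras, dagger bimodules and bimodule
homomorphisms. -/
instance : Bicategory (SSFA C) where
  Hom A B := DaggerBimodule A B
  id A := DaggerBimodule.unit A
  comp M N := M.rel N
  homCategory A B := inferInstanceAs (Category (DaggerBimodule A B))
  whiskerLeft M _ _ g := relLeft M g
  whiskerRight f N := relRight f N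
  associator M N P := DaggerBimodule.assoc M N P
  leftUnitor M := leftU M
  rightUnitor M := rightU M
  whiskerLeft_id M N := hom_ext <| inc_cancel <| by
    rw [relLeft_inc]
    change _ ≫ _ ◁ 𝟙 _ = 𝟙 _ ≫ _
    simp
  whiskerLeft_comp M N P Q f g := hom_ext <| inc_cancel <| by
    change _ = ((relLeft M f).hom ≫ (relLeft M g).hom) ≫ _
    rw [relLeft_inc, Category.assoc, relLeft_inc, reassoc_of% relLeft_inc,
      ← MonoidalCategory.whiskerLeft_comp]
    rfl
  id_whiskerLeft {A B M N} f := by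
    rw [← Category.assoc, Iso.eq_comp_inv]
    refine hom_ext ?_
    change (relLeft (unit A) f).hom ≫ N.incL ≫ N.actL = (M.incL ≫ M.actL) ≫ f.hom
    have h : (relLeft (unit A) f).hom ≫ N.incL = M.incL ≫ A.X ◁ f.hom :=
      relLeft_inc (unit A) f
    rw [reassoc_of% h, f.left, Category.assoc]
  comp_whiskerLeft M N P P' f := by
    rw [← Category.assoc, Iso.eq_comp_inv]
    refine hom_ext <| inc_cancel_left ?_
    change ((relLeft (M.rel N) f).hom ≫ assocHom M N P') ≫ _ =
      (assocHom M N P ≫ (relLeft M (relLeft N f)).hom) ≫ _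
    rw [Category.assoc, assocHom_inc, reassoc_of% relLeft_inc, whisker_exchange_assoc,
      Category.assoc, reassoc_of% relLeft_inc, ← MonoidalCategory.whiskerLeft_comp,
      relLeft_inc, MonoidalCategory.whiskerLeft_comp, reassoc_of% assocHom_inc]
    simp
  id_whiskerRight M N := hom_ext <| inc_cancel <| by
    rw [relRight_inc]
    change _ ≫ 𝟙 _ ▷ _ = 𝟙 _ ≫ _
    simp
  comp_whiskerRight f g N := hom_ext <| inc_cancel <| by
    change _ = ((relRight f N).hom ≫ (relRight g N).hom) ≫ _
    rw [relRight_inc, Category.assoc, relRight_inc, reassoc_of% relRight_inc,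
      ← MonoidalCategory.comp_whiskerRight]
    rfl
  whiskerRight_id {A B M N} f := by
    rw [← Category.assoc, Iso.eq_comp_inv]
    refine hom_ext ?_
    change (relRight f (unit B)).hom ≫ N.incR ≫ N.actR = (M.incR ≫ M.actR) ≫ f.hom
    have h : (relRight f (unit B)).hom ≫ N.incR = M.incR ≫ f.hom ▷ B.X :=
      relRight_inc f (unit B)
    rw [reassoc_of% h, f.right, Category.assoc]
  whiskerRight_comp {_ _ _ _ M M'} f N P := by
    rw [Iso.eq_inv_comp]
    refine hom_ext <| inc_cancel_left ?_
    change (assocHom M N P ≫ (relRight f (N.rel P)).hom) ≫ _ =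
      ((relRight (relRight f N) P).hom ≫ assocHom M' N P) ≫ _
    rw [Category.assoc, reassoc_of% relRight_inc, ← whisker_exchange, Category.assoc,
      assocHom_inc, reassoc_of% relRight_inc, ← comp_whiskerRight_assoc, relRight_inc,
      comp_whiskerRight_assoc, reassoc_of% assocHom_inc]
    simp
  whisker_assoc M N N' f P := by
    rw [← Category.assoc, Iso.eq_comp_inv]
    refine hom_ext <| inc_cancel_left ?_
    change ((relRight (relLeft M f) P).hom ≫ assocHom M N' P) ≫ _ =
      (assocHom M N P ≫ (relLeft M (relRight f P)).hom) ≫ _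
    rw [Category.assoc, assocHom_inc, reassoc_of% relRight_inc, ← comp_whiskerRight_assoc,
      relLeft_inc, comp_whiskerRight_assoc,
      Category.assoc, reassoc_of% relLeft_inc, ← MonoidalCategory.whiskerLeft_comp,
      relRight_inc, MonoidalCategory.whiskerLeft_comp, reassoc_of% assocHom_inc]
    simp
  whisker_exchange {_ _ _ M M' N N'} f g := hom_ext <| inc_cancel <| by
    change ((relLeft M g).hom ≫ (relRight f N').hom) ≫ _ =
      ((relRight f N).hom ≫ (relLeft M' g).hom) ≫ _
    rw [Category.assoc, relRight_inc, reassoc_of% relLeft_inc, Category.assoc, relLeft_inc,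
      reassoc_of% relRight_inc, whisker_exchange]
  pentagon M N P Q := hom_ext (pentagon_aux M N P Q)
  triangle M N := hom_ext (triangle_aux M N)

/-! ### The linear dagger structure on the hom categories -/

instance (A B : SSFA C) : Preadditive (A ⟶ B) :=
  inferInstanceAs (Preadditive (DaggerBimodule A B))

instance (A B : SSFA C) : Linear ℂ (A ⟶ B) := inferInstanceAs (Linear ℂ (DaggerBimodule A B))

instance (A B : SSFA C) : DaggerCategory (A ⟶ B) :=
  inferInstanceAs (DaggerCategory (DaggerBimodule A B))

/-! ### The embedding of `C` in the 2-category -/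

/-- An object of `C` as a bimodule over the trivial algebra. -/
def ofObj (X : C) : (SSFA.trivial : SSFA C) ⟶ SSFA.trivial where
  X := X
  actL := (λ_ X).hom
  actR := (ρ_ X).hom
  isLeft :=
    { assoc := by simp only [SSFA.trivial]; monoidal
      unit := by simp [SSFA.trivial]
      dagger := by
        simp only [AlgebraData.cap, SSFA.trivial, RigidCStarTensorCategory.dagger_leftUnitor,
          DaggerCategory.dagger_id, Category.comp_id]
        monoidal }
  isRight :=
    { assoc := by simp only [SSFA.trivial]; monoidal
      unit := by simp [SSFA.trivial]
      dagger := by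
        simp only [AlgebraData.cap, SSFA.trivial, RigidCStarTensorCategory.dagger_rightUnitor,
          DaggerCategory.dagger_id, Category.comp_id]
        monoidal }
  comm := by simp only [SSFA.trivial]; monoidal

/-- A morphism of `C` as a bimodule homomorphism over the trivial algebra. -/
def ofMor {X Y : C} (f : X ⟶ Y) : ofObj X ⟶ ofObj Y :=
  Hom.mk (M := ofObj X) (N := ofObj Y) f (leftUnitor_naturality f) (rightUnitor_naturality f)

lemma idem_ofObj (X Y : C) : DaggerBimodule.idem (ofObj X) (ofObj Y) = 𝟙 (X ⊗ Y) := by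
  rw [idem_eq_left]
  change X ◁ (λ_ Y).hom† ≫ (α_ X (𝟙_ C) Y).inv ≫ (ρ_ X).hom ▷ Y = _
  simp

/-- The unitary structure isomorphism of the embedding, from the relative tensor product over the
trivial algebra to the tensor product in `C`. -/
def ofObjTensor (X Y : C) : ofObj X ≫ ofObj Y ≅ ofObj (X ⊗ Y) :=
  isoOfUnitary (Hom.mk (M := DaggerBimodule.rel (ofObj X) (ofObj Y)) (N := ofObj (X ⊗ Y))
    (inc (ofObj X) (ofObj Y))
    (by
      refine Eq.trans ?_ (actL_inc (ofObj X) (ofObj Y)).symm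
      change _ ≫ (λ_ (X ⊗ Y)).hom = _ ≫ (α_ (𝟙_ C) X Y).inv ≫ (λ_ X).hom ▷ Y
      rw [leftUnitor_tensor_hom]
      rfl)
    (by
      refine Eq.trans ?_ (actR_inc (ofObj X) (ofObj Y)).symm
      change _ ≫ (ρ_ (X ⊗ Y)).hom = _ ≫ (α_ X Y (𝟙_ C)).hom ≫ X ◁ (ρ_ Y).hom
      rw [rightUnitor_tensor_hom]
      rfl))
    inc_isometry (inc_dagger_inc.trans (idem_ofObj X Y))

/-- The image in `End(𝟙)` of an algebra in `C`. -/
def embed (A : AlgebraData C) : AlgebraData ((SSFA.trivial : SSFA C) ⟶ SSFA.trivial) where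
  X := ofObj A.X
  mul := (ofObjTensor A.X A.X).hom ≫ ofMor A.mul
  one := Hom.mk (M := DaggerBimodule.unit SSFA.trivial) (N := ofObj A.X) A.one
    (leftUnitor_naturality A.one)
    (by
      change A.one ▷ 𝟙_ C ≫ (ρ_ A.X).hom = (λ_ (𝟙_ C)).hom ≫ A.one
      rw [rightUnitor_naturality, unitors_equal])

end T

section TwoCategory

open Bicategory

variable {𝓑 : Type u} [Bicategory.{w, v} 𝓑] [∀ a b : 𝓑, DaggerCategory (a ⟶ b)]

/-- Equivalence of objects in a dagger 2-category. -/
def Equivalent (r s : 𝓑) : Prop :=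
  ∃ (X : r ⟶ s) (Y : s ⟶ r) (α : 𝟙 s ⟶ Y ≫ X) (β : X ≫ Y ⟶ 𝟙 r), IsUnitary α ∧ IsUnitary β

variable [∀ a b : 𝓑, Preadditive (a ⟶ b)] [∀ a b : 𝓑, Linear ℂ (a ⟶ b)]

/-- A standard right dual of a 1-morphism `X : r ⟶ s`: a right dual `[dual, η, ε]`, with
`η : 𝟙 s ⟶ dual ≫ X` the unit and `ε : X ≫ dual ⟶ 𝟙 r` the counit, such that the two induced
traces on `End X` coincide. -/
structure StandardDual {r s : 𝓑} (X : r ⟶ s) where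
  dual : s ⟶ r
  adj : Bicategory.Adjunction dual X
  standard : ∀ T : X ⟶ X,
    canonicalTrace (adj.unit ≫ dual ◁ T ≫ adj.unit†) =
      canonicalTrace (adj.counit† ≫ T ▷ dual ≫ adj.counit)

namespace StandardDual

variable {r s : 𝓑} {X : r ⟶ s} (D : StandardDual X)

/-- The left dimension `η† ∘ η`. -/
def dimL : 𝟙 s ⟶ 𝟙 s := D.adj.unit ≫ D.adj.unit†

/-- The 1-morphism `X` is separable: its left dimension is invertible. -/
def IsSeparable : Prop := IsIso D.dimL

/-- The pair of pants algebra on `X ⊗ X*`, where `n` is the positive square root of the left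
dimension of `X`. -/
def pairOfPants (n : 𝟙 s ≅ 𝟙 s) : AlgebraData (r ⟶ r) where
  X := X ≫ D.dual
  mul := (α_ X D.dual (X ≫ D.dual)).hom ≫ X ◁ (α_ D.dual X D.dual).inv ≫
    X ◁ ((D.adj.unit† ≫ n.inv) ▷ D.dual) ≫ X ◁ (leftUnitor D.dual).hom
  one := D.adj.counit† ≫ X ◁ ((leftUnitor D.dual).inv ≫ n.hom ▷ D.dual ≫ (leftUnitor D.dual).hom)

end StandardDual

end TwoCategory

/-- Morita equivalence of standard separable Frobenius algebras. -/
def MoritaEquivalent {C : Type u} [Category.{v} C] [Preadditive C] [Linear ℂ C]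
    [MonoidalCategory C] [MonoidalPreadditive C] [MonoidalLinear ℂ C] [RigidCStarTensorCategory C]
    (A B : SSFA C) : Prop := Equivalent A B

end BimodT

end

/-! From pants to Morita equivalence. Let `M` go from the trivial algebra to `B`, with dual `N`, and
let `c : N ≫ M ⟶ 𝟙 B` be the daggered unit of the duality corrected by `n⁻¹`. The algebra on `M ⊗ N`
multiplies by `c` in the middle, and acts on `M` from the left and on `N` from the right, again by
`c`. Pulling these actions back along the unitary `f : A ≅ M ⊗ N` makes `M` an `A`-`B` bimodule and
`N` a `B`-`A` bimodule. Then `M ⊗_B N ≅ A` by `f†`. The idempotent cutting `N ⊗_A M` out of `N ⊗ M`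
is `c ≫ c†` (`Pants.actR_actL`). Since `dim_L = n²`, `c†` is an isometry and splits this idempotent,
so `N ⊗_A M ≅ B`. `moritaEquivalent_of_maps` assembles the two unitaries.

From Morita equivalence to pants. A unitary equivalence `X`, `Y` is refined to an adjunction with
unitary unit `η` and counit `ε`. Forgetting the `A`-actions leaves modules `M`, `N` over `B` that
are still adjoint: the cup is unchanged and the counit `ε` is followed by `A.one†`. The unit stays
isometric, and `ε†` identifies `A` with `M ⊗ N` as an algebra (`toPants`), because the triangle
identity turns the pants action on `X` into the original `A`-action.

What remains is standardness. Put `E(T) = η†(id ⊗ T)η` in `End (𝟙 B)`. The trace of `T` taken with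
the counit depends only on `E(T)`: it equals `ψ(E(T))`, where `ψ` is the functional `weight`. This
rests on the standardness of `A`, applied to an endomorphism of the right module `A`
(`canonicalTrace_cap_conj`). The trace taken with the unit is `Tr(E(T))`, so the duality is standard
up to the discrepancy between `Tr` and `ψ`, two faithful positive functionals on a
finite-dimensional commutative C*-algebra, that is, on a power of `ℂ`. A positive invertible `h`
with `Tr(h² z) = ψ(h⁻² z)` exists (`IsDefiniteStar.exists_weight`), and rescaling the unit by `h`
and the counit by `h⁻¹` makes the duality standard. Its left dimension is `h²`, so `n = h`, and the
factors `n` and `n⁻¹` in the pair of pants algebra exactly undo the rescaling. The algebra is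
therefore the one already identified with `A`. -/

namespace BimodT

/-! ### Dagger bicategories. -/

/-- Compatibility of the daggers on the hom categories of a bicategory with its structure. -/
class IsDaggerBicategory (𝓑 : Type u) [Bicategory.{w, v} 𝓑]
    [∀ a b : 𝓑, DaggerCategory (a ⟶ b)] : Prop where
  dagger_whiskerLeft : ∀ {a b c : 𝓑} (f : a ⟶ b) {g h : b ⟶ c} (η : g ⟶ h),
    (Bicategory.whiskerLeft f η)† = Bicategory.whiskerLeft f η†
  dagger_whiskerRight : ∀ {a b c : 𝓑} {f g : a ⟶ b} (η : f ⟶ g) (h : b ⟶ c),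
    (Bicategory.whiskerRight η h)† = Bicategory.whiskerRight η† h
  dagger_associator : ∀ {a b c d : 𝓑} (f : a ⟶ b) (g : b ⟶ c) (h : c ⟶ d),
    (Bicategory.associator f g h).hom† = (Bicategory.associator f g h).inv
  dagger_leftUnitor : ∀ {a b : 𝓑} (f : a ⟶ b),
    (Bicategory.leftUnitor f).hom† = (Bicategory.leftUnitor f).inv
  dagger_rightUnitor : ∀ {a b : 𝓑} (f : a ⟶ b),
    (Bicategory.rightUnitor f).hom† = (Bicategory.rightUnitor f).inv

namespace IsDaggerBicategory

attribute [simp] dagger_whiskerLeft dagger_whiskerRight dagger_associator dagger_leftUnitor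
  dagger_rightUnitor

variable {𝓑 : Type u} [Bicategory.{w, v} 𝓑] [∀ a b : 𝓑, DaggerCategory (a ⟶ b)]
  [IsDaggerBicategory 𝓑]

@[simp] lemma dagger_associator_inv {a b c d : 𝓑} (f : a ⟶ b) (g : b ⟶ c) (h : c ⟶ d) :
    (Bicategory.associator f g h).inv† = (Bicategory.associator f g h).hom := by
  rw [← dagger_associator, DaggerCategory.dagger_dagger]

@[simp] lemma dagger_leftUnitor_inv {a b : 𝓑} (f : a ⟶ b) :
    (Bicategory.leftUnitor f).inv† = (Bicategory.leftUnitor f).hom := by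
  rw [← dagger_leftUnitor, DaggerCategory.dagger_dagger]

@[simp] lemma dagger_rightUnitor_inv {a b : 𝓑} (f : a ⟶ b) :
    (Bicategory.rightUnitor f).inv† = (Bicategory.rightUnitor f).hom := by
  rw [← dagger_rightUnitor, DaggerCategory.dagger_dagger]

end IsDaggerBicategory

/-! ### The algebra on `M ⊗ N` and its modules `M` and `N`. -/

namespace Pants

local infixr:80 (priority := 2000) " ⊗≫ " => CategoryTheory.bicategoricalComp
local infixr:81 (priority := 2000) " ◁ " => Bicategory.whiskerLeft
local infixl:81 (priority := 2000) " ▷ " => Bicategory.whiskerRight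
local notation (priority := 2000) "α_" => Bicategory.associator
local notation (priority := 2000) "λ_" => Bicategory.leftUnitor
local notation (priority := 2000) "ρ_" => Bicategory.rightUnitor

variable {𝓑 : Type u} [Bicategory.{w, v} 𝓑] {r s : 𝓑} {M : r ⟶ s} {N : s ⟶ r}

/-- The multiplication of `M ≫ N` induced by `c : N ≫ M ⟶ 𝟙 s`. -/
def mul (c : N ≫ M ⟶ 𝟙 s) : (M ≫ N) ≫ (M ≫ N) ⟶ M ≫ N :=
  (α_ M N (M ≫ N)).hom ≫ M ◁ (α_ N M N).inv ≫ M ◁ (c ▷ N) ≫ M ◁ (λ_ N).hom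

/-- The left action of `M ≫ N` on `M`. -/
def actL (c : N ≫ M ⟶ 𝟙 s) : (M ≫ N) ≫ M ⟶ M :=
  (α_ M N M).hom ≫ M ◁ c ≫ (ρ_ M).hom

/-- The right action of `M ≫ N` on `N`. -/
def actR (c : N ≫ M ⟶ 𝟙 s) : N ≫ (M ≫ N) ⟶ N :=
  (α_ N M N).inv ≫ c ▷ N ≫ (λ_ N).hom

variable (c : N ≫ M ⟶ 𝟙 s)

/-- Seeing the product as an action whiskered by `N` (or by `M`, in the next lemma) reduces facts
about the algebra to facts about its two modules. -/
lemma mul_eq_actL : mul c = (α_ (M ≫ N) M N).inv ≫ actL c ▷ N := by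
  rw [mul, actL]
  bicategory

lemma mul_eq_actR : mul c = (α_ M N (M ≫ N)).hom ≫ M ◁ actR c := by
  rw [mul, actR]
  bicategory

/-- The two copies of `c` sit on disjoint strands, so associativity is the interchange law. -/
lemma mul_actL : mul c ▷ M ≫ actL c =
    (α_ (M ≫ N) (M ≫ N) M).hom ≫ (M ≫ N) ◁ actL c ≫ actL c := by
  calc _ = 𝟙 _ ⊗≫ M ◁ (c ▷ (N ≫ M) ≫ 𝟙 _ ◁ c) ⊗≫ 𝟙 _ := by
        rw [mul, actL]; bicategory
    _ = _ := by
        rw [← Bicategory.whisker_exchange, actL]; bicategory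

lemma mul_actR : N ◁ mul c ≫ actR c =
    (α_ N (M ≫ N) (M ≫ N)).inv ≫ actR c ▷ (M ≫ N) ≫ actR c := by
  calc _ = 𝟙 _ ⊗≫ ((N ≫ M) ◁ c ≫ c ▷ 𝟙 _) ▷ N ⊗≫ 𝟙 _ := by
        rw [mul, actR]; bicategory
    _ = _ := by
        rw [Bicategory.whisker_exchange, actR]; bicategory

section Unit

variable {c} {e : 𝟙 r ⟶ M ≫ N}

lemma one_actL (h : e ▷ M ≫ (α_ M N M).hom ≫ M ◁ c = (λ_ M).hom ≫ (ρ_ M).inv) :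
    e ▷ M ≫ actL c = (λ_ M).hom := by
  rw [actL, reassoc_of% h, Iso.inv_hom_id, Category.comp_id]

lemma one_actR (h : N ◁ e ≫ (α_ N M N).inv ≫ c ▷ N = (ρ_ N).hom ≫ (λ_ N).inv) :
    N ◁ e ≫ actR c = (ρ_ N).hom := by
  rw [actR, reassoc_of% h, Iso.inv_hom_id, Category.comp_id]

lemma one_mul (h : e ▷ M ≫ (α_ M N M).hom ≫ M ◁ c = (λ_ M).hom ≫ (ρ_ M).inv) :
    e ▷ (M ≫ N) ≫ mul c = (λ_ (M ≫ N)).hom := by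
  have := congrArg (fun f => (α_ _ _ _).inv ≫ f ▷ N) (one_actL h)
  rw [mul_eq_actL]
  simpa using this

lemma mul_one (h : N ◁ e ≫ (α_ N M N).inv ≫ c ▷ N = (ρ_ N).hom ≫ (λ_ N).inv) :
    (M ≫ N) ◁ e ≫ mul c = (ρ_ (M ≫ N)).hom := by
  have := congrArg (fun f => (α_ _ _ _).hom ≫ M ◁ f) (one_actR h)
  rw [mul_eq_actR]
  simpa using this

end Unit

section Dagger

variable [∀ a b : 𝓑, DaggerCategory (a ⟶ b)] [IsDaggerBicategory 𝓑]

/-- Again only interchange: `c†` and `c` occupy disjoint strands, so no relation between them is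
needed. -/
lemma frobenius_actL : (M ≫ N) ◁ (actL c)† ≫ (α_ (M ≫ N) (M ≫ N) M).inv ≫ mul c ▷ M =
    actL c ≫ (actL c)† := by
  calc _ = 𝟙 _ ⊗≫ M ◁ ((N ≫ M) ◁ c† ≫ c ▷ (N ≫ M)) ⊗≫ 𝟙 _ := by
        simp only [mul, actL, DaggerCategory.dagger_comp, IsDaggerBicategory.dagger_whiskerLeft,
          IsDaggerBicategory.dagger_associator, IsDaggerBicategory.dagger_rightUnitor]
        bicategory
    _ = _ := by
        rw [Bicategory.whisker_exchange]
        simp only [actL, DaggerCategory.dagger_comp, IsDaggerBicategory.dagger_whiskerLeft,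
          IsDaggerBicategory.dagger_associator, IsDaggerBicategory.dagger_rightUnitor]
        bicategory

lemma frobenius_actR : (actR c)† ▷ (M ≫ N) ≫ (α_ N (M ≫ N) (M ≫ N)).hom ≫ N ◁ mul c =
    actR c ≫ (actR c)† := by
  calc _ = 𝟙 _ ⊗≫ (c† ▷ (N ≫ M) ≫ (N ≫ M) ◁ c) ▷ N ⊗≫ 𝟙 _ := by
        simp only [mul, actR, DaggerCategory.dagger_comp, IsDaggerBicategory.dagger_whiskerRight,
          IsDaggerBicategory.dagger_associator_inv, IsDaggerBicategory.dagger_leftUnitor]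
        bicategory
    _ = _ := by
        rw [← Bicategory.whisker_exchange]
        simp only [actR, DaggerCategory.dagger_comp, IsDaggerBicategory.dagger_whiskerRight,
          IsDaggerBicategory.dagger_associator_inv, IsDaggerBicategory.dagger_leftUnitor]
        bicategory

lemma frobenius_mul : (mul c)† ▷ (M ≫ N) ≫ (α_ (M ≫ N) (M ≫ N) (M ≫ N)).hom ≫
    (M ≫ N) ◁ mul c = mul c ≫ (mul c)† := by
  calc _ = (α_ M N (M ≫ N)).hom ≫ M ◁ ((actR c)† ▷ (M ≫ N) ≫ (α_ N (M ≫ N) (M ≫ N)).hom ≫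
          N ◁ mul c) ≫ (α_ M N (M ≫ N)).inv := by
        simp only [mul_eq_actR c, DaggerCategory.dagger_comp,
          IsDaggerBicategory.dagger_whiskerLeft, IsDaggerBicategory.dagger_associator]
        bicategory
    _ = _ := by
        rw [frobenius_actR]
        simp only [mul_eq_actR c, DaggerCategory.dagger_comp,
          IsDaggerBicategory.dagger_whiskerLeft, IsDaggerBicategory.dagger_associator]
        simp

/-- The left side is the endomorphism of `N ⊗ M` that defines the tensor product over the pants
algebra. Once `c† ≫ c = 𝟙`, the right side is visibly a projection split by `c†`, which identifies
that tensor product with `𝟙 s`. -/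
lemma actR_actL : (actR c)† ▷ M ≫ (α_ N (M ≫ N) M).hom ≫ N ◁ actL c = c ≫ c† := by
  calc _ = 𝟙 _ ⊗≫ (c† ▷ (N ≫ M) ≫ (N ≫ M) ◁ c) ⊗≫ 𝟙 _ := by
        simp only [actL, actR, DaggerCategory.dagger_comp, IsDaggerBicategory.dagger_whiskerRight,
          IsDaggerBicategory.dagger_associator_inv, IsDaggerBicategory.dagger_leftUnitor]
        bicategory
    _ = _ := by
        rw [← Bicategory.whisker_exchange]
        bicategory

section Unit

variable {c} {e : 𝟙 r ⟶ M ≫ N}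

/-- The Frobenius relation brings the expression to `actL c ≫ (actL c)†` followed by `e†`, and the
daggered unit law removes the last two factors. -/
lemma dagger_actL (h : e ▷ M ≫ (α_ M N M).hom ≫ M ◁ c = (λ_ M).hom ≫ (ρ_ M).inv) :
    (M ≫ N) ◁ (actL c)† ≫ (α_ (M ≫ N) (M ≫ N) M).inv ≫ (mul c ≫ e†) ▷ M ≫ (λ_ M).hom =
      actL c := by
  have h1 : (actL c)† ≫ e† ▷ M = (λ_ M).inv := by
    simpa using congrArg (fun f => f†) (one_actL h)
  have h2 := frobenius_actL c
  rw [Bicategory.comp_whiskerRight, Category.assoc, reassoc_of% h2, reassoc_of% h1, Iso.inv_hom_id,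
    Category.comp_id]

lemma dagger_actR (h : N ◁ e ≫ (α_ N M N).inv ≫ c ▷ N = (ρ_ N).hom ≫ (λ_ N).inv) :
    (actR c)† ▷ (M ≫ N) ≫ (α_ N (M ≫ N) (M ≫ N)).hom ≫ N ◁ (mul c ≫ e†) ≫ (ρ_ N).hom =
      actR c := by
  have h1 : (actR c)† ≫ N ◁ e† = (ρ_ N).inv := by
    simpa using congrArg (fun f => f†) (one_actR h)
  have h2 := frobenius_actR c
  rw [Bicategory.whiskerLeft_comp, Category.assoc, reassoc_of% h2, reassoc_of% h1, Iso.inv_hom_id,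
    Category.comp_id]

/-- One of the snake equations for the Frobenius cup and cap. -/
lemma snake (h₁ : e ▷ M ≫ (α_ M N M).hom ≫ M ◁ c = (λ_ M).hom ≫ (ρ_ M).inv)
    (h₂ : N ◁ e ≫ (α_ N M N).inv ≫ c ▷ N = (ρ_ N).hom ≫ (λ_ N).inv) :
    (λ_ (M ≫ N)).inv ≫ (e ≫ (mul c)†) ▷ (M ≫ N) ≫ (α_ (M ≫ N) (M ≫ N) (M ≫ N)).hom ≫
      (M ≫ N) ◁ (mul c ≫ e†) ≫ (ρ_ (M ≫ N)).hom = 𝟙 _ := by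
  have h3 : (mul c)† ≫ (M ≫ N) ◁ e† = (ρ_ (M ≫ N)).inv := by
    simpa using congrArg (fun f => f†) (mul_one h₂)
  have h4 := one_mul h₁
  rw [Bicategory.comp_whiskerRight, Bicategory.whiskerLeft_comp]
  simp only [Category.assoc]
  rw [reassoc_of% (frobenius_mul c), reassoc_of% h4, reassoc_of% h3]
  simp

end Unit

end Dagger

end Pants

/-! ### Daggered adjunctions and the normalised pair of pants. -/

section Adjunctions

local infixr:80 (priority := 2000) " ⊗≫ " => CategoryTheory.bicategoricalComp
local infixr:81 (priority := 2000) " ◁ " => Bicategory.whiskerLeft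
local infixl:81 (priority := 2000) " ▷ " => Bicategory.whiskerRight
local notation (priority := 2000) "α_" => Bicategory.associator
local notation (priority := 2000) "λ_" => Bicategory.leftUnitor
local notation (priority := 2000) "ρ_" => Bicategory.rightUnitor

variable {𝓑 : Type u} [Bicategory.{w, v} 𝓑] [∀ a b : 𝓑, DaggerCategory (a ⟶ b)]
  [IsDaggerBicategory 𝓑] {r s : 𝓑}

/-- The dagger reverses the snake equations, so `counit†` and `unit†` serve as the `e` and `c` of
the preceding part. -/
lemma counit_dagger_unit_dagger_left {M : r ⟶ s} {N : s ⟶ r} (adj : Bicategory.Adjunction N M) :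
    adj.counit† ▷ M ≫ (α_ M N M).hom ≫ M ◁ adj.unit† = (λ_ M).hom ≫ (ρ_ M).inv := by
  have h : M ◁ adj.unit ≫ (α_ M N M).inv ≫ adj.counit ▷ M = (ρ_ M).hom ≫ (λ_ M).inv := by
    rw [← adj.right_triangle]; bicategory
  simpa using congrArg (fun f => f†) h

lemma counit_dagger_unit_dagger_right {M : r ⟶ s} {N : s ⟶ r} (adj : Bicategory.Adjunction N M) :
    N ◁ adj.counit† ≫ (α_ N M N).inv ≫ adj.unit† ▷ N = (ρ_ N).hom ≫ (λ_ N).inv := by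
  have h : adj.unit ▷ N ≫ (α_ N M N).hom ≫ N ◁ adj.counit = (λ_ N).hom ≫ (ρ_ N).inv := by
    rw [← adj.left_triangle]; bicategory
  simpa using congrArg (fun f => f†) h

namespace StandardDual

variable [∀ a b : 𝓑, Preadditive (a ⟶ b)] [∀ a b : 𝓑, Linear ℂ (a ⟶ b)] {X : r ⟶ s}
  (D : StandardDual X)

lemma pairOfPants_mul (n : 𝟙 s ≅ 𝟙 s) :
    (D.pairOfPants n).mul = Pants.mul (D.adj.unit† ≫ n.inv) := rfl

lemma pairOfPants_one (n : 𝟙 s ≅ 𝟙 s) : (D.pairOfPants n).one = D.adj.counit† ≫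
    X ◁ ((λ_ D.dual).inv ≫ n.hom ▷ D.dual ≫ (λ_ D.dual).hom) := rfl

/-- The factors `n` and `n⁻¹` act in the same region, labelled `s`. Interchange brings them together
and they cancel, leaving the snake equation of the unnormalised data. -/
lemma pairOfPants_snake_left (n : 𝟙 s ≅ 𝟙 s) : (D.pairOfPants n).one ▷ X ≫
    (α_ X D.dual X).hom ≫ X ◁ (D.adj.unit† ≫ n.inv) = (λ_ X).hom ≫ (ρ_ X).inv := by
  rw [← counit_dagger_unit_dagger_left D.adj]
  calc _ = D.adj.counit† ▷ X ⊗≫ X ◁ ((n.hom ▷ (D.dual ≫ X)) ≫ 𝟙 s ◁ D.adj.unit†) ⊗≫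
        X ◁ n.inv := by
        rw [pairOfPants_one]; bicategory
    _ = D.adj.counit† ▷ X ⊗≫ X ◁ D.adj.unit† ⊗≫ X ◁ (n.hom ≫ n.inv) := by
        rw [← Bicategory.whisker_exchange]; bicategory
    _ = _ := by
        rw [Iso.hom_inv_id]; bicategory

lemma pairOfPants_snake_right (n : 𝟙 s ≅ 𝟙 s) : D.dual ◁ (D.pairOfPants n).one ≫
    (α_ D.dual X D.dual).inv ≫ (D.adj.unit† ≫ n.inv) ▷ D.dual =
      (ρ_ D.dual).hom ≫ (λ_ D.dual).inv := by
  rw [← counit_dagger_unit_dagger_right D.adj]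
  calc _ = D.dual ◁ D.adj.counit† ⊗≫ (((D.dual ≫ X) ◁ n.hom) ≫ D.adj.unit† ▷ 𝟙 s) ▷ D.dual ⊗≫
        n.inv ▷ D.dual := by
        rw [pairOfPants_one]; bicategory
    _ = D.dual ◁ D.adj.counit† ⊗≫ D.adj.unit† ▷ D.dual ⊗≫ (n.hom ≫ n.inv) ▷ D.dual := by
        rw [Bicategory.whisker_exchange]; bicategory
    _ = _ := by
        rw [Iso.hom_inv_id]; bicategory

end StandardDual

end Adjunctions

/-! ### Bimodules form a dagger bicategory. -/

section Instance

variable {C : Type u} [Category.{v} C] [Preadditive C] [Linear ℂ C]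
    [MonoidalCategory C] [MonoidalPreadditive C] [MonoidalLinear ℂ C] [RigidCStarTensorCategory C]

open DaggerBimodule

instance : IsDaggerBicategory (SSFA C) where
  dagger_whiskerLeft {A B D} M {N N'} g := hom_ext <| by
    change (M.inc N ≫ M.X ◁ g.hom ≫ (M.inc N')†)† = M.inc N' ≫ M.X ◁ g.hom† ≫ (M.inc N)†
    simp
  dagger_whiskerRight {A B D} {M M'} f N := hom_ext <| by
    change (M.inc N ≫ f.hom ▷ N.X ≫ (M'.inc N)†)† = M'.inc N ≫ f.hom† ▷ N.X ≫ (M.inc N)†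
    simp
  -- The structure isomorphisms come from `isoOfUnitary`, whose inverse is the dagger by definition.
  dagger_associator _ _ _ := rfl
  dagger_leftUnitor _ := rfl
  dagger_rightUnitor _ := rfl

end Instance

/-! ### Modules over `embed A` in the 2-category as modules over `A`. -/

section OverTrivial

variable {C : Type u} [Category.{v} C] [Preadditive C] [Linear ℂ C]
    [MonoidalCategory C] [MonoidalPreadditive C] [MonoidalLinear ℂ C] [RigidCStarTensorCategory C]
    {A B D E : SSFA C}

namespace DaggerBimodule

/-- The unit of the trivial algebra is an identity morphism, so the unit law already determines the
action. -/
lemma actR_trivial (M : DaggerBimodule A SSFA.trivial) : M.actR = (ρ_ M.X).hom :=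
  ((congrArg (· ≫ M.actR) (MonoidalCategory.whiskerLeft_id M.X (𝟙_ C))).trans
    (Category.id_comp M.actR)).symm.trans M.isRight.unit

lemma actL_trivial (M : DaggerBimodule SSFA.trivial B) : M.actL = (λ_ M.X).hom :=
  ((congrArg (· ≫ M.actL) (MonoidalCategory.id_whiskerRight (𝟙_ C) M.X)).trans
    (Category.id_comp M.actL)).symm.trans M.isLeft.unit

lemma idem_trivial (M : DaggerBimodule A SSFA.trivial) (N : DaggerBimodule SSFA.trivial B) :
    M.idem N = 𝟙 (M.X ⊗ N.X) := by
  rw [idem_eq_left, actR_trivial, actL_trivial]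
  change M.X ◁ (λ_ N.X).hom† ≫ (α_ M.X (𝟙_ C) N.X).inv ≫ (ρ_ M.X).hom ▷ N.X = _
  simp

/-- Over the trivial algebra the inclusion of the relative tensor product is thus unitary; this is
what allows equations to be moved between the 2-category and `C`. -/
lemma inc_dagger_inc_trivial (M : DaggerBimodule A SSFA.trivial)
    (N : DaggerBimodule SSFA.trivial B) : (M.inc N)† ≫ M.inc N = 𝟙 (M.X ⊗ N.X) :=
  inc_dagger_inc.trans (idem_trivial M N)

end DaggerBimodule

open DaggerBimodule

section Transfer

variable {X M P Q R S Z : C} {m : X ⊗ X ⟶ X}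

/-- In this group of lemmas `i`, `j`, `k`, `k'`, `k''` play the role of inclusions of tensor
products over the trivial algebra, and `a`, `b` that of the associator and its inverse, known only
through their compatibility with the inclusions. Cancelling the inclusions turns a module axiom of
the 2-category into the axiom in `C`. -/
lemma transfer_assoc_left {i : P ⟶ X ⊗ M} {j : Q ⟶ X ⊗ X} {k : R ⟶ Q ⊗ M} {k' : S ⟶ X ⊗ P}
    {l : P ⟶ M} {a : R ⟶ S}
    (hi' : i ≫ i† = 𝟙 _) (hj : j† ≫ j = 𝟙 _) (hk : k† ≫ k = 𝟙 _)
    (ha : a ≫ k' ≫ X ◁ i = k ≫ j ▷ M ≫ (α_ X X M).hom)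
    (h : (k ≫ (j ≫ m) ▷ M ≫ i†) ≫ l = a ≫ (k' ≫ X ◁ l ≫ i†) ≫ l) :
    m ▷ M ≫ i† ≫ l = (α_ X X M).hom ≫ X ◁ (i† ≫ l) ≫ i† ≫ l := by
  have e : j† ▷ M ≫ k† ≫ k ≫ j ▷ M = 𝟙 _ := by
    rw [reassoc_of% hk, ← comp_whiskerRight, hj, id_whiskerRight]
  have hl : X ◁ l = X ◁ i ≫ X ◁ (i† ≫ l) := by
    rw [← MonoidalCategory.whiskerLeft_comp, reassoc_of% hi']
  have h2 := congrArg (fun f => j† ▷ M ≫ k† ≫ f) h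
  simp only [hl, Category.assoc, comp_whiskerRight] at h2
  rw [reassoc_of% ha, reassoc_of% e, reassoc_of% e] at h2
  exact h2

lemma transfer_unit_left {i : P ⟶ X ⊗ M} {k : Q ⟶ 𝟙_ C ⊗ M} {u : 𝟙_ C ⟶ X} {l : P ⟶ M}
    (hk : k† ≫ k = 𝟙 _) (h : (k ≫ u ▷ M ≫ i†) ≫ l = k ≫ (λ_ M).hom) :
    u ▷ M ≫ i† ≫ l = (λ_ M).hom := by
  have h2 := congrArg (fun f => k† ≫ f) h
  simp only [Category.assoc] at h2
  rwa [reassoc_of% hk, reassoc_of% hk] at h2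

lemma transfer_dagger_left {i : P ⟶ X ⊗ M} {j : Q ⟶ X ⊗ X} {k : R ⟶ Q ⊗ M} {k' : S ⟶ X ⊗ P}
    {k'' : Z ⟶ 𝟙_ C ⊗ M} {u : X ⟶ 𝟙_ C} {l : P ⟶ M} {b : S ⟶ R}
    (hi : i† ≫ i = 𝟙 _) (hk' : k'† ≫ k' = 𝟙 _) (hk'' : k''† ≫ k'' = 𝟙 _)
    (hb : b ≫ k ≫ j ▷ M = k' ≫ X ◁ i ≫ (α_ X X M).inv)
    (h : (i ≫ X ◁ l† ≫ k'†) ≫ b ≫ (k ≫ ((j ≫ m) ≫ u) ▷ M ≫ k''†) ≫ k'' ≫ (λ_ M).hom = l) :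
    X ◁ (i† ≫ l)† ≫ (α_ X X M).inv ≫ (m ≫ u) ▷ M ≫ (λ_ M).hom = i† ≫ l := by
  conv_rhs => rw [← h]
  simp only [Category.assoc, comp_whiskerRight]
  rw [reassoc_of% hi, reassoc_of% hb, reassoc_of% hk', reassoc_of% hk'']
  simp

lemma transfer_assoc_right {i : P ⟶ M ⊗ X} {j : Q ⟶ X ⊗ X} {k : R ⟶ M ⊗ Q} {k' : S ⟶ P ⊗ X}
    {l : P ⟶ M} {b : R ⟶ S}
    (hi' : i ≫ i† = 𝟙 _) (hj : j† ≫ j = 𝟙 _) (hk : k† ≫ k = 𝟙 _)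
    (hb : b ≫ k' ≫ i ▷ X = k ≫ M ◁ j ≫ (α_ M X X).inv)
    (h : (k ≫ M ◁ (j ≫ m) ≫ i†) ≫ l = b ≫ (k' ≫ l ▷ X ≫ i†) ≫ l) :
    M ◁ m ≫ i† ≫ l = (α_ M X X).inv ≫ (i† ≫ l) ▷ X ≫ i† ≫ l := by
  have e : M ◁ j† ≫ k† ≫ k ≫ M ◁ j = 𝟙 _ := by
    rw [reassoc_of% hk, ← MonoidalCategory.whiskerLeft_comp, hj,
      MonoidalCategory.whiskerLeft_id]
  have hl : l ▷ X = i ▷ X ≫ (i† ≫ l) ▷ X := by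
    rw [← comp_whiskerRight, reassoc_of% hi']
  have h2 := congrArg (fun f => M ◁ j† ≫ k† ≫ f) h
  simp only [hl, Category.assoc, MonoidalCategory.whiskerLeft_comp] at h2
  rw [reassoc_of% hb, reassoc_of% e, reassoc_of% e] at h2
  exact h2

lemma transfer_unit_right {i : P ⟶ M ⊗ X} {k : Q ⟶ M ⊗ 𝟙_ C} {u : 𝟙_ C ⟶ X} {l : P ⟶ M}
    (hk : k† ≫ k = 𝟙 _) (h : (k ≫ M ◁ u ≫ i†) ≫ l = k ≫ (ρ_ M).hom) :
    M ◁ u ≫ i† ≫ l = (ρ_ M).hom := by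
  have h2 := congrArg (fun f => k† ≫ f) h
  simp only [Category.assoc] at h2
  rwa [reassoc_of% hk, reassoc_of% hk] at h2

lemma transfer_dagger_right {i : P ⟶ M ⊗ X} {j : Q ⟶ X ⊗ X} {k : R ⟶ M ⊗ Q} {k' : S ⟶ P ⊗ X}
    {k'' : Z ⟶ M ⊗ 𝟙_ C} {u : X ⟶ 𝟙_ C} {l : P ⟶ M} {a : S ⟶ R}
    (hi : i† ≫ i = 𝟙 _) (hk' : k'† ≫ k' = 𝟙 _) (hk'' : k''† ≫ k'' = 𝟙 _)
    (ha : a ≫ k ≫ M ◁ j = k' ≫ i ▷ X ≫ (α_ M X X).hom)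
    (h : (i ≫ l† ▷ X ≫ k'†) ≫ a ≫ (k ≫ M ◁ ((j ≫ m) ≫ u) ≫ k''†) ≫ k'' ≫ (ρ_ M).hom = l) :
    (i† ≫ l)† ▷ X ≫ (α_ M X X).hom ≫ M ◁ (m ≫ u) ≫ (ρ_ M).hom = i† ≫ l := by
  conv_rhs => rw [← h]
  simp only [Category.assoc, MonoidalCategory.whiskerLeft_comp]
  rw [reassoc_of% hi, reassoc_of% ha, reassoc_of% hk', reassoc_of% hk'']
  simp

end Transfer

/-- A dagger module over `embed A` in the 2-category gives a dagger module over `A`. -/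
lemma isLeftDaggerModule_of_embed {M : (SSFA.trivial : SSFA C) ⟶ B}
    (l : (embed A.toAlgebraData).X ≫ M ⟶ M)
    (assoc : Bicategory.whiskerRight (embed A.toAlgebraData).mul M ≫ l =
      (Bicategory.associator _ _ M).hom ≫ Bicategory.whiskerLeft _ l ≫ l)
    (unit : Bicategory.whiskerRight (embed A.toAlgebraData).one M ≫ l =
      (Bicategory.leftUnitor M).hom)
    (dagger : Bicategory.whiskerLeft _ l† ≫ (Bicategory.associator _ _ M).inv ≫
      Bicategory.whiskerRight (embed A.toAlgebraData).cap M ≫ (Bicategory.leftUnitor M).hom = l) :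
    IsLeftDaggerModule A M.X ((inc (ofObj A.X) M)† ≫ Hom.hom l) where
  assoc := transfer_assoc_left inc_isometry
    (inc_dagger_inc_trivial (ofObj A.X) (ofObj A.X))
    (inc_dagger_inc_trivial (ofObj A.X ≫ ofObj A.X) M)
    (assocHom_inc (ofObj A.X) (ofObj A.X) M) (congrArg Hom.hom assoc)
  unit := by
    have h := congrArg Hom.hom unit
    refine transfer_unit_left (inc_dagger_inc_trivial (DaggerBimodule.unit SSFA.trivial) M)
      (h.trans ?_)
    exact congrArg (fun f => _ ≫ f) (actL_trivial M)
  dagger := by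
    refine transfer_dagger_left (inc_dagger_inc_trivial (ofObj A.X) M)
      (inc_dagger_inc_trivial (ofObj A.X) (ofObj A.X ≫ M))
      (inc_dagger_inc_trivial (DaggerBimodule.unit SSFA.trivial) M)
      (assocHom_dagger_inc (ofObj A.X) (ofObj A.X) M) (Eq.trans ?_ (congrArg Hom.hom dagger))
    exact congrArg (fun f => _ ≫ _ ≫ _ ≫ _ ≫ f) (actL_trivial M).symm

/-- A dagger module over `embed A` in the 2-category gives a dagger module over `A`. -/
lemma isRightDaggerModule_of_embed {N : B ⟶ (SSFA.trivial : SSFA C)}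
    (l : N ≫ (embed A.toAlgebraData).X ⟶ N)
    (assoc : Bicategory.whiskerLeft N (embed A.toAlgebraData).mul ≫ l =
      (Bicategory.associator N _ _).inv ≫ Bicategory.whiskerRight l _ ≫ l)
    (unit : Bicategory.whiskerLeft N (embed A.toAlgebraData).one ≫ l =
      (Bicategory.rightUnitor N).hom)
    (dagger : Bicategory.whiskerRight l† _ ≫ (Bicategory.associator N _ _).hom ≫
      Bicategory.whiskerLeft N (embed A.toAlgebraData).cap ≫ (Bicategory.rightUnitor N).hom = l) :
    IsRightDaggerModule A N.X ((inc N (ofObj A.X))† ≫ Hom.hom l) where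
  assoc := transfer_assoc_right inc_isometry
    (inc_dagger_inc_trivial (ofObj A.X) (ofObj A.X))
    (inc_dagger_inc_trivial N (ofObj A.X ≫ ofObj A.X))
    (assocHom_dagger_inc N (ofObj A.X) (ofObj A.X)) (congrArg Hom.hom assoc)
  unit := by
    refine transfer_unit_right (inc_dagger_inc_trivial N (DaggerBimodule.unit SSFA.trivial))
      ((congrArg Hom.hom unit).trans ?_)
    exact congrArg (fun f => _ ≫ f) (actR_trivial N)
  dagger := by
    refine transfer_dagger_right (inc_dagger_inc_trivial N (ofObj A.X))
      (inc_dagger_inc_trivial (N ≫ ofObj A.X) (ofObj A.X))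
      (inc_dagger_inc_trivial N (DaggerBimodule.unit SSFA.trivial))
      (assocHom_inc N (ofObj A.X) (ofObj A.X)) (Eq.trans ?_ (congrArg Hom.hom dagger))
    exact congrArg (fun f => _ ≫ _ ≫ _ ≫ _ ≫ f) (actR_trivial N).symm

end OverTrivial

/-! ### Pulling the pants actions back along a unitary algebra map. -/

section PantsModules

local infixr:80 (priority := 2000) " ⊗≫ " => CategoryTheory.bicategoricalComp
local infixr:81 (priority := 2000) " ◁ " => Bicategory.whiskerLeft
local infixl:81 (priority := 2000) " ▷ " => Bicategory.whiskerRight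
local notation (priority := 2000) "α_" => Bicategory.associator
local notation (priority := 2000) "λ_" => Bicategory.leftUnitor
local notation (priority := 2000) "ρ_" => Bicategory.rightUnitor

variable {𝓑 : Type u} [Bicategory.{w, v} 𝓑] [∀ a b : 𝓑, DaggerCategory (a ⟶ b)]
  [IsDaggerBicategory 𝓑] {r s : 𝓑} {M : r ⟶ s} {N : s ⟶ r}
  {A : AlgebraData (r ⟶ r)} {c : N ≫ M ⟶ 𝟙 s} {e : 𝟙 r ⟶ M ≫ N} {f : A.X ⟶ M ≫ N}

namespace Pants

lemma map_actL_assoc (hf : A.mul ≫ f = (f ▷ A.X ≫ (M ≫ N) ◁ f) ≫ mul c) :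
    A.mul ▷ M ≫ f ▷ M ≫ actL c =
      (α_ A.X A.X M).hom ≫ A.X ◁ (f ▷ M ≫ actL c) ≫ f ▷ M ≫ actL c := by
  have h1 : A.mul ▷ M ≫ f ▷ M ≫ actL c =
      (f ▷ A.X) ▷ M ≫ ((M ≫ N) ◁ f) ▷ M ≫ mul c ▷ M ≫ actL c := by
    rw [← Bicategory.comp_whiskerRight_assoc, hf]
    simp
  rw [h1, mul_actL]
  have h2 := Bicategory.whisker_exchange f (f ▷ M ≫ actL c)
  rw [Bicategory.whiskerLeft_comp] at h2
  simp only [Category.assoc] at h2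
  simp [reassoc_of% h2]

lemma map_actR_assoc (hf : A.mul ≫ f = (f ▷ A.X ≫ (M ≫ N) ◁ f) ≫ mul c) :
    N ◁ A.mul ≫ N ◁ f ≫ actR c =
      (α_ N A.X A.X).inv ≫ (N ◁ f ≫ actR c) ▷ A.X ≫ N ◁ f ≫ actR c := by
  have h1 : N ◁ A.mul ≫ N ◁ f ≫ actR c =
      N ◁ f ▷ A.X ≫ N ◁ (M ≫ N) ◁ f ≫ N ◁ mul c ≫ actR c := by
    rw [← Bicategory.whiskerLeft_comp_assoc, hf]
    simp
  rw [h1, mul_actR]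
  rw [Bicategory.associator_inv_naturality_right_assoc,
    Bicategory.associator_inv_naturality_middle_assoc, Bicategory.whisker_exchange_assoc,
    Bicategory.comp_whiskerRight, Category.assoc]

lemma map_actL_unit (h : e ▷ M ≫ (α_ M N M).hom ≫ M ◁ c = (λ_ M).hom ≫ (ρ_ M).inv)
    (hu : A.one ≫ f = e) : A.one ▷ M ≫ f ▷ M ≫ actL c = (λ_ M).hom := by
  rw [← Bicategory.comp_whiskerRight_assoc, hu, one_actL h]

lemma map_actR_unit (h : N ◁ e ≫ (α_ N M N).inv ≫ c ▷ N = (ρ_ N).hom ≫ (λ_ N).inv)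
    (hu : A.one ≫ f = e) : N ◁ A.one ≫ N ◁ f ≫ actR c = (ρ_ N).hom := by
  rw [← Bicategory.whiskerLeft_comp_assoc, hu, one_actR h]

lemma mul_map_left (hm : A.mul ≫ f = (f ▷ A.X ≫ (M ≫ N) ◁ f) ≫ mul c) :
    A.mul ≫ f = A.X ◁ f ≫ (α_ A.X M N).inv ≫ (f ▷ M ≫ actL c) ▷ N := by
  rw [hm, ← Bicategory.whisker_exchange, mul_eq_actL]
  simp

lemma mul_map_right (hm : A.mul ≫ f = (f ▷ A.X ≫ (M ≫ N) ◁ f) ≫ mul c) :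
    A.mul ≫ f = f ▷ A.X ≫ (α_ M N A.X).hom ≫ M ◁ (N ◁ f ≫ actR c) := by
  rw [hm, mul_eq_actR]
  simp

/-- From `A.one ≫ f = e` and `f ≫ f† = 𝟙` it follows that `A.one† = f ≫ e†`; the cap of `A` is then
the pants cap precomposed with `f ⊗ f`. -/
lemma cap_eq (hm : A.mul ≫ f = (f ▷ A.X ≫ (M ≫ N) ◁ f) ≫ mul c) (hu : A.one ≫ f = e)
    (hf : f ≫ f† = 𝟙 _) : A.cap = (f ▷ A.X ≫ (M ≫ N) ◁ f) ≫ mul c ≫ e† := by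
  rw [← Category.assoc (_ ≫ _) (mul c), ← hm, AlgebraData.cap, ← hu, DaggerCategory.dagger_comp,
    Category.assoc, reassoc_of% hf]

/-- The pulled-back action brings in an `f†` and the cap of `A` two copies of `f`. One copy cancels
against `f†`, the other slides out to the front, and the dagger law of the pants action remains. -/
lemma map_actL_dagger
    (h : e ▷ M ≫ (α_ M N M).hom ≫ M ◁ c = (λ_ M).hom ≫ (ρ_ M).inv)
    (hm : A.mul ≫ f = (f ▷ A.X ≫ (M ≫ N) ◁ f) ≫ mul c) (hu : A.one ≫ f = e)
    (hf : f ≫ f† = 𝟙 _) (hf' : f† ≫ f = 𝟙 _) :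
    A.X ◁ (f ▷ M ≫ actL c)† ≫ (α_ A.X A.X M).inv ≫ A.cap ▷ M ≫ (λ_ M).hom =
      f ▷ M ≫ actL c := by
  conv_rhs => rw [← dagger_actL h]
  rw [cap_eq hm hu hf]
  have h1 : A.X ◁ f† ▷ M ≫ A.X ◁ f ▷ M = 𝟙 _ := by
    rw [← Bicategory.whiskerLeft_comp, ← Bicategory.comp_whiskerRight, hf']; simp
  have h2 : A.X ◁ f† ▷ M ≫ f ▷ (A.X ≫ M) ≫ (M ≫ N) ◁ f ▷ M = f ▷ _ := by
    rw [← Bicategory.whisker_exchange, reassoc_of% h1]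
  simp only [DaggerCategory.dagger_comp, IsDaggerBicategory.dagger_whiskerRight,
    Bicategory.whiskerLeft_comp, Bicategory.comp_whiskerRight, Category.assoc]
  calc _ = A.X ◁ (actL c)† ≫ (A.X ◁ f† ▷ M ≫ f ▷ (A.X ≫ M) ≫ (M ≫ N) ◁ f ▷ M) ≫
        (α_ _ _ _).inv ≫ mul c ▷ M ≫ e† ▷ M ≫ (λ_ M).hom := by simp
    _ = _ := by rw [h2, Bicategory.whisker_exchange_assoc]

lemma map_actR_dagger
    (h : N ◁ e ≫ (α_ N M N).inv ≫ c ▷ N = (ρ_ N).hom ≫ (λ_ N).inv)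
    (hm : A.mul ≫ f = (f ▷ A.X ≫ (M ≫ N) ◁ f) ≫ mul c) (hu : A.one ≫ f = e)
    (hf : f ≫ f† = 𝟙 _) (hf' : f† ≫ f = 𝟙 _) :
    (N ◁ f ≫ actR c)† ▷ A.X ≫ (α_ N A.X A.X).hom ≫ N ◁ A.cap ≫ (ρ_ N).hom =
      N ◁ f ≫ actR c := by
  conv_rhs => rw [← dagger_actR h]
  rw [cap_eq hm hu hf, Bicategory.whisker_exchange f f |>.symm]
  have h1 : (N ◁ f†) ▷ A.X ≫ (N ◁ f) ▷ A.X = 𝟙 _ := by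
    rw [← Bicategory.comp_whiskerRight, ← Bicategory.whiskerLeft_comp, hf']; simp
  have h2 : (N ◁ f†) ▷ A.X ≫ (N ≫ A.X) ◁ f ≫ (N ◁ f) ▷ (M ≫ N) = (N ≫ M ≫ N) ◁ f := by
    rw [Bicategory.whisker_exchange, reassoc_of% h1]
  simp only [DaggerCategory.dagger_comp, IsDaggerBicategory.dagger_whiskerLeft,
    Bicategory.whiskerLeft_comp, Bicategory.comp_whiskerRight, Category.assoc]
  calc _ = (actR c)† ▷ A.X ≫ ((N ◁ f†) ▷ A.X ≫ (N ≫ A.X) ◁ f ≫ (N ◁ f) ▷ (M ≫ N)) ≫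
        (α_ _ _ _).hom ≫ N ◁ mul c ≫ N ◁ e† ≫ (ρ_ N).hom := by simp
    _ = _ := by rw [h2, ← Bicategory.whisker_exchange_assoc]

lemma map_actR_actL (hf : f† ≫ f = 𝟙 _) :
    (N ◁ f ≫ actR c)† ▷ M ≫ (α_ N A.X M).hom ≫ N ◁ (f ▷ M ≫ actL c) = c ≫ c† := by
  have h1 : N ◁ f† ▷ M ≫ N ◁ f ▷ M = 𝟙 _ := by
    rw [← Bicategory.whiskerLeft_comp, ← Bicategory.comp_whiskerRight, hf]; simp
  rw [← actR_actL]
  simp [reassoc_of% h1]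

/-- The `star` condition is automatic for unitary morphisms of algebras. -/
lemma map_star (h₁ : e ▷ M ≫ (α_ M N M).hom ≫ M ◁ c = (λ_ M).hom ≫ (ρ_ M).inv)
    (h₂ : N ◁ e ≫ (α_ N M N).inv ≫ c ▷ N = (ρ_ N).hom ≫ (λ_ N).inv)
    (hm : A.mul ≫ f = (f ▷ A.X ≫ (M ≫ N) ◁ f) ≫ mul c) (hu : A.one ≫ f = e)
    (hf : f ≫ f† = 𝟙 _) (hf' : f† ≫ f = 𝟙 _) :
    f† = (λ_ (M ≫ N)).inv ≫ A.cup ▷ (M ≫ N) ≫ (α_ A.X A.X (M ≫ N)).hom ≫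
      A.X ◁ (f ▷ (M ≫ N)) ≫ A.X ◁ (mul c ≫ e†) ≫ (ρ_ A.X).hom := by
  -- The cup of `A` is the pants cup followed by `f† ⊗ f†`. The second `f†` cancels against the `f`
  -- of the star condition (`h4`), while the first survives the snake and gives the left side.
  have h3 : A.cup = (e ≫ (mul c)†) ≫ f† ▷ (M ≫ N) ≫ A.X ◁ f† := by
    have := congrArg (fun f => f†) (cap_eq hm hu hf)
    simp only [AlgebraData.cap, DaggerCategory.dagger_comp, DaggerCategory.dagger_dagger,
      IsDaggerBicategory.dagger_whiskerLeft, IsDaggerBicategory.dagger_whiskerRight,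
      Category.assoc] at this
    rw [AlgebraData.cup, this, Bicategory.whisker_exchange, Category.assoc]
  have h4 : f† ▷ (M ≫ N) ▷ (M ≫ N) ≫ (A.X ◁ f†) ▷ (M ≫ N) ≫ (α_ A.X A.X (M ≫ N)).hom ≫
      A.X ◁ (f ▷ (M ≫ N)) = (α_ _ _ _).hom ≫ f† ▷ ((M ≫ N) ≫ (M ≫ N)) := by
    have h1 : A.X ◁ f† ▷ (M ≫ N) ≫ A.X ◁ f ▷ (M ≫ N) = 𝟙 _ := by
      rw [← Bicategory.whiskerLeft_comp, ← Bicategory.comp_whiskerRight, hf']; simp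
    rw [Bicategory.associator_naturality_middle_assoc, h1, Category.comp_id,
      Bicategory.associator_naturality_left]
  have h5 := snake h₁ h₂
  rw [h3]
  simp only [Bicategory.comp_whiskerRight, Category.assoc] at h4 ⊢
  rw [reassoc_of% h4, ← Bicategory.whisker_exchange_assoc]
  have h6 : f† ▷ 𝟙 r ≫ (ρ_ A.X).hom = (ρ_ (M ≫ N)).hom ≫ f† := by simp
  rw [h6]
  simp only [Bicategory.comp_whiskerRight, Category.assoc] at h5
  rw [reassoc_of% h5]

end Pants

end PantsModules

/-! ### From the pair of pants to a Morita equivalence. -/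

section OfPants

variable {C : Type u} [Category.{v} C] [Preadditive C] [Linear ℂ C]
    [MonoidalCategory C] [MonoidalPreadditive C] [MonoidalLinear ℂ C] [RigidCStarTensorCategory C]
    {A B : SSFA C}

open DaggerBimodule

section Transfer

variable {X Y M N P Q R S Z : C}

/-- That `l` is a morphism of right modules (`hl`) is the bimodule commutation law, once the
inclusion `i` is cancelled. -/
lemma transfer_comm {i : P ⟶ X ⊗ M} {l : P ⟶ M} {a : M ⊗ Y ⟶ M} {a' : P ⊗ Y ⟶ P}
    (hi : i† ≫ i = 𝟙 _) (hi' : i ≫ i† = 𝟙 _)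
    (ha' : a' ≫ i = i ▷ Y ≫ (α_ X M Y).hom ≫ X ◁ a) (hl : l ▷ Y ≫ a = a' ≫ l) :
    (i† ≫ l) ▷ Y ≫ a = (α_ X M Y).hom ≫ X ◁ a ≫ i† ≫ l := by
  have h1 : a' = i ▷ Y ≫ (α_ X M Y).hom ≫ X ◁ a ≫ i† := by
    simpa [hi'] using congrArg (fun f => f ≫ i†) ha'
  rw [comp_whiskerRight, Category.assoc, hl, h1]
  simp only [Category.assoc, ← comp_whiskerRight_assoc, hi, id_whiskerRight, Category.id_comp]

lemma transfer_comm' {i : P ⟶ N ⊗ X} {l : P ⟶ N} {a : Y ⊗ N ⟶ N} {a' : Y ⊗ P ⟶ P}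
    (hi : i† ≫ i = 𝟙 _) (hi' : i ≫ i† = 𝟙 _)
    (ha' : a' ≫ i = Y ◁ i ≫ (α_ Y N X).inv ≫ a ▷ X) (hl : Y ◁ l ≫ a = a' ≫ l) :
    a ▷ X ≫ i† ≫ l = (α_ Y N X).hom ≫ Y ◁ (i† ≫ l) ≫ a := by
  have h1 : a' = Y ◁ i ≫ (α_ Y N X).inv ≫ a ▷ X ≫ i† := by
    simpa [hi'] using congrArg (fun f => f ≫ i†) ha'
  rw [MonoidalCategory.whiskerLeft_comp, Category.assoc, hl, h1]
  simp only [Category.assoc, ← MonoidalCategory.whiskerLeft_comp_assoc, hi,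
    MonoidalCategory.whiskerLeft_id, Category.id_comp, Iso.hom_inv_id_assoc]

lemma transfer_map_left {m : X ⊗ X ⟶ X} {f : X ⟶ P} {j : Q ⟶ X ⊗ X} {q : R ⟶ X ⊗ P}
    {k : S ⟶ Z ⊗ N} {i : Z ⟶ X ⊗ M} {l : Z ⟶ M} {p : P ⟶ M ⊗ N} {b : R ⟶ S}
    (hj : j† ≫ j = 𝟙 _) (hq : q† ≫ q = 𝟙 _) (hi : i ≫ i† = 𝟙 _)
    (hb : b ≫ k ≫ i ▷ N = q ≫ X ◁ p ≫ (α_ X M N).inv)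
    (h : (j ≫ m) ≫ f = (j ≫ X ◁ f ≫ q†) ≫ b ≫ (k ≫ l ▷ N ≫ p†)) :
    m ≫ f = X ◁ f ≫ X ◁ p ≫ ((α_ X M N).inv ≫ (i† ≫ l) ▷ N) ≫ p† := by
  have hl : l ▷ N = i ▷ N ≫ (i† ≫ l) ▷ N := by
    rw [← comp_whiskerRight, reassoc_of% hi]
  have h2 := congrArg (fun f => j† ≫ f) h
  simp only [hl, Category.assoc] at h2
  rw [reassoc_of% hj, reassoc_of% hb, reassoc_of% hj, reassoc_of% hq] at h2
  simpa using h2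

lemma transfer_map_right {m : X ⊗ X ⟶ X} {f : X ⟶ P} {j : Q ⟶ X ⊗ X} {q : R ⟶ P ⊗ X}
    {k : S ⟶ M ⊗ Z} {i : Z ⟶ N ⊗ X} {l : Z ⟶ N} {p : P ⟶ M ⊗ N} {b : R ⟶ S}
    (hj : j† ≫ j = 𝟙 _) (hq : q† ≫ q = 𝟙 _) (hi : i ≫ i† = 𝟙 _)
    (hb : b ≫ k ≫ M ◁ i = q ≫ p ▷ X ≫ (α_ M N X).hom)
    (h : (j ≫ m) ≫ f = (j ≫ f ▷ X ≫ q†) ≫ b ≫ (k ≫ M ◁ l ≫ p†)) :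
    m ≫ f = f ▷ X ≫ p ▷ X ≫ ((α_ M N X).hom ≫ M ◁ (i† ≫ l)) ≫ p† := by
  have hl : M ◁ l = M ◁ i ≫ M ◁ (i† ≫ l) := by
    rw [← MonoidalCategory.whiskerLeft_comp, reassoc_of% hi]
  have h2 := congrArg (fun f => j† ≫ f) h
  simp only [hl, Category.assoc] at h2
  rw [reassoc_of% hj, reassoc_of% hb, reassoc_of% hj, reassoc_of% hq] at h2
  simpa using h2

/-- The left side is the idempotent for `N ⊗_A M` written in `C`; the right side is the projection
`c ≫ c†` of the 2-category, conjugated by the unitary inclusion `p`. -/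
lemma transfer_idem {i : P ⟶ X ⊗ M} {l : P ⟶ M} {j : Q ⟶ N ⊗ X} {r : Q ⟶ N} {p : R ⟶ N ⊗ M}
    {k : S ⟶ Q ⊗ M} {q : Z ⟶ N ⊗ P} {c : R ⟶ Y}
    (hp : p† ≫ p = 𝟙 _) (hk : k† ≫ k = 𝟙 _) (hq : q† ≫ q = 𝟙 _)
    (h : (p ≫ r† ▷ M ≫ k†) ≫ (k ≫ j ▷ M ≫ (α_ N X M).hom ≫ N ◁ i† ≫ q†) ≫
      (q ≫ N ◁ l ≫ p†) = c ≫ c†) :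
    (j† ≫ r)† ▷ M ≫ (α_ N X M).hom ≫ N ◁ (i† ≫ l) = p† ≫ c ≫ c† ≫ p := by
  rw [← reassoc_of% h]
  simp [reassoc_of% hp, reassoc_of% hk, reassoc_of% hq, hp]

lemma dagger_intertwine_left {m : X ⊗ Y ⟶ Y} {g : Y ⟶ Z} {a : X ⊗ Z ⟶ Z}
    (hg : g ≫ g† = 𝟙 _) (hg' : g† ≫ g = 𝟙 _) (h : m ≫ g = X ◁ g ≫ a) :
    X ◁ g† ≫ m = a ≫ g† := by
  calc _ = X ◁ g† ≫ (m ≫ g) ≫ g† := by simp [hg]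
    _ = _ := by
      rw [h, Category.assoc, ← whiskerLeft_comp_assoc, hg', MonoidalCategory.whiskerLeft_id,
        Category.id_comp]

lemma dagger_intertwine_right {m : Y ⊗ X ⟶ Y} {g : Y ⟶ Z} {a : Z ⊗ X ⟶ Z}
    (hg : g ≫ g† = 𝟙 _) (hg' : g† ≫ g = 𝟙 _) (h : m ≫ g = g ▷ X ≫ a) :
    g† ▷ X ≫ m = a ≫ g† := by
  calc _ = g† ▷ X ≫ (m ≫ g) ≫ g† := by simp [hg]
    _ = _ := by
      rw [h, Category.assoc, ← comp_whiskerRight_assoc, hg', id_whiskerRight,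
        Category.id_comp]

/-- Here `i` and `z` include `N ⊗ M` taken over the trivial algebra and over `A`. By `hz`, the
isometries `v ≫ i` and `z` split the same projection, so `v ≫ i ≫ z†` is the canonical comparison
between the two splittings; it inherits linearity from `v`. -/
lemma coev_left {m : Y ⊗ Q ⟶ Q} {v : Q ⟶ P} {i : P ⟶ N ⊗ M} {z : R ⟶ N ⊗ M} {a : Y ⊗ N ⟶ N}
    {b : Y ⊗ P ⟶ P} (hi : i ≫ i† = 𝟙 _) (hv : v ≫ v† = 𝟙 _)
    (hz : z† ≫ z = i† ≫ v† ≫ v ≫ i) (hb : b ≫ i = Y ◁ i ≫ (α_ Y N M).inv ≫ a ▷ M)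
    (h : Y ◁ v ≫ b = m ≫ v) :
    Y ◁ (v ≫ i ≫ z†) ≫ Y ◁ z ≫ ((α_ Y N M).inv ≫ a ▷ M) ≫ z† = m ≫ v ≫ i ≫ z† := by
  have e : (v ≫ i ≫ z†) ≫ z = v ≫ i := by
    simp [hz, reassoc_of% hi, reassoc_of% hv]
  rw [← whiskerLeft_comp_assoc, e, MonoidalCategory.whiskerLeft_comp, ← reassoc_of% h,
    reassoc_of% hb]
  simp

lemma coev_right {m : Q ⊗ Y ⟶ Q} {v : Q ⟶ P} {i : P ⟶ N ⊗ M} {z : R ⟶ N ⊗ M} {a : M ⊗ Y ⟶ M}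
    {b : P ⊗ Y ⟶ P} (hi : i ≫ i† = 𝟙 _) (hv : v ≫ v† = 𝟙 _)
    (hz : z† ≫ z = i† ≫ v† ≫ v ≫ i) (hb : b ≫ i = i ▷ Y ≫ (α_ N M Y).hom ≫ N ◁ a)
    (h : v ▷ Y ≫ b = m ≫ v) :
    (v ≫ i ≫ z†) ▷ Y ≫ z ▷ Y ≫ ((α_ N M Y).hom ≫ N ◁ a) ≫ z† = m ≫ v ≫ i ≫ z† := by
  have e : (v ≫ i ≫ z†) ≫ z = v ≫ i := by
    simp [hz, reassoc_of% hi, reassoc_of% hv]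
  rw [← comp_whiskerRight_assoc, e, comp_whiskerRight, ← reassoc_of% h, reassoc_of% hb]
  simp

lemma coev_isometry {v : Q ⟶ P} {i : P ⟶ Y} {z : R ⟶ Y} (hi : i ≫ i† = 𝟙 _)
    (hv : v ≫ v† = 𝟙 _) (hz : z† ≫ z = i† ≫ v† ≫ v ≫ i) :
    (v ≫ i ≫ z†) ≫ (v ≫ i ≫ z†)† = 𝟙 _ := by
  simp [reassoc_of% hz, reassoc_of% hi, hv]

lemma coev_coisometry {v : Q ⟶ P} {i : P ⟶ Y} {z : R ⟶ Y} (hz' : z ≫ z† = 𝟙 _)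
    (hz : z† ≫ z = i† ≫ v† ≫ v ≫ i) : (v ≫ i ≫ z†)† ≫ (v ≫ i ≫ z†) = 𝟙 _ := by
  simp only [DaggerCategory.dagger_comp, DaggerCategory.dagger_dagger, Category.assoc]
  rw [← reassoc_of% hz, reassoc_of% hz', hz']

end Transfer

/-- The bimodule obtained from a one-sided module and a compatible action of `embed A`. -/
noncomputable def bimoduleOfLeft {M : (SSFA.trivial : SSFA C) ⟶ B} (l : (embed A.toAlgebraData).X ≫ M ⟶ M)
    (h : IsLeftDaggerModule A M.X ((inc (ofObj A.X) M)† ≫ Hom.hom l)) : A ⟶ B where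
  X := M.X
  actL := (inc (ofObj A.X) M)† ≫ Hom.hom l
  actR := M.actR
  isLeft := h
  isRight := M.isRight
  comm := transfer_comm (inc_dagger_inc_trivial (ofObj A.X) M) inc_isometry
    (actR_inc (ofObj A.X) M) (Hom.right l)

/-- The bimodule obtained from a one-sided module and a compatible action of `embed A`. -/
noncomputable def bimoduleOfRight {N : B ⟶ (SSFA.trivial : SSFA C)}
    (l : N ≫ (embed A.toAlgebraData).X ⟶ N)
    (h : IsRightDaggerModule A N.X ((inc N (ofObj A.X))† ≫ Hom.hom l)) : B ⟶ A where
  X := N.X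
  actL := N.actL
  actR := (inc N (ofObj A.X))† ≫ Hom.hom l
  isLeft := N.isLeft
  isRight := h
  comm := transfer_comm' (inc_dagger_inc_trivial N (ofObj A.X)) inc_isometry
    (actL_inc N (ofObj A.X)) (Hom.left l)

variable {M : (SSFA.trivial : SSFA C) ⟶ B} {N : B ⟶ (SSFA.trivial : SSFA C)}
  {f : (embed A.toAlgebraData).X ⟶ M ≫ N}

/-- The evaluation of the bimodules attached to a pair of pants algebra. -/
noncomputable def evalHom (l : (embed A.toAlgebraData).X ≫ M ⟶ M)
    (r : N ≫ (embed A.toAlgebraData).X ⟶ N)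
    (hl : IsLeftDaggerModule A M.X ((inc (ofObj A.X) M)† ≫ Hom.hom l))
    (hr : IsRightDaggerModule A N.X ((inc N (ofObj A.X))† ≫ Hom.hom r))
    (hf : f ≫ f† = 𝟙 _) (hf' : f† ≫ f = 𝟙 _)
    (h₁ : (embed A.toAlgebraData).mul ≫ f = Bicategory.whiskerLeft _ f ≫
      (Bicategory.associator _ M N).inv ≫ Bicategory.whiskerRight l N)
    (h₂ : (embed A.toAlgebraData).mul ≫ f = Bicategory.whiskerRight f _ ≫
      (Bicategory.associator M N _).hom ≫ Bicategory.whiskerLeft M r) :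
    bimoduleOfLeft l hl ≫ bimoduleOfRight r hr ⟶ 𝟙 A :=
  let g : A.X ⟶ (DaggerBimodule.rel M N).X := Hom.hom f
  have hg : g ≫ g† = 𝟙 _ := congrArg Hom.hom hf
  have hg' : g† ≫ g = 𝟙 _ := congrArg Hom.hom hf'
  Hom.mk (M := DaggerBimodule.rel (bimoduleOfLeft l hl) (bimoduleOfRight r hr))
    (N := DaggerBimodule.unit A) g†
    (dagger_intertwine_left hg hg' <|
      transfer_map_left (inc_dagger_inc_trivial (ofObj A.X) (ofObj A.X))
        (inc_dagger_inc_trivial (ofObj A.X) (M ≫ N)) (inc_isometry (M := ofObj A.X) (N := M))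
        (assocHom_dagger_inc (ofObj A.X) M N) (congrArg Hom.hom h₁))
    (dagger_intertwine_right hg hg' <|
      transfer_map_right (inc_dagger_inc_trivial (ofObj A.X) (ofObj A.X))
        (inc_dagger_inc_trivial (M ≫ N) (ofObj A.X)) (inc_isometry (M := N) (N := ofObj A.X))
        (assocHom_inc M N (ofObj A.X)) (congrArg Hom.hom h₂))

lemma coevHom_aux (l : (embed A.toAlgebraData).X ≫ M ⟶ M)
    (r : N ≫ (embed A.toAlgebraData).X ⟶ N)
    (hl : IsLeftDaggerModule A M.X ((inc (ofObj A.X) M)† ≫ Hom.hom l))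
    (hr : IsRightDaggerModule A N.X ((inc N (ofObj A.X))† ≫ Hom.hom r))
    (c : N ≫ M ⟶ 𝟙 B)
    (h : Bicategory.whiskerRight r† M ≫ (Bicategory.associator N _ M).hom ≫
      Bicategory.whiskerLeft N l = c ≫ c†) :
    (inc (bimoduleOfRight r hr) (bimoduleOfLeft l hl))† ≫
      inc (bimoduleOfRight r hr) (bimoduleOfLeft l hl) =
        (inc N M)† ≫ (Hom.hom c†)† ≫ Hom.hom c† ≫ inc N M := by
  refine (inc_dagger_inc.trans (idem_eq_right _ _)).trans ?_
  refine (transfer_idem (p := inc N M) (c := Hom.hom c) (inc_dagger_inc_trivial N M)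
    (inc_dagger_inc_trivial (N ≫ ofObj A.X) M)
    (inc_dagger_inc_trivial N (ofObj A.X ≫ M)) (congrArg Hom.hom h)).trans ?_
  exact congrArg (fun f => _ ≫ f ≫ _) (DaggerCategory.dagger_dagger (Hom.hom c)).symm

/-- The coevaluation of the bimodules attached to a pair of pants algebra. -/
noncomputable def coevHom (l : (embed A.toAlgebraData).X ≫ M ⟶ M)
    (r : N ≫ (embed A.toAlgebraData).X ⟶ N)
    (hl : IsLeftDaggerModule A M.X ((inc (ofObj A.X) M)† ≫ Hom.hom l))
    (hr : IsRightDaggerModule A N.X ((inc N (ofObj A.X))† ≫ Hom.hom r))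
    (c : N ≫ M ⟶ 𝟙 B) (hc : c† ≫ c = 𝟙 _)
    (h : Bicategory.whiskerRight r† M ≫ (Bicategory.associator N _ M).hom ≫
      Bicategory.whiskerLeft N l = c ≫ c†) :
    𝟙 B ⟶ bimoduleOfRight r hr ≫ bimoduleOfLeft l hl :=
  let v : B.X ⟶ (DaggerBimodule.rel N M).X := Hom.hom c†
  let z := inc (bimoduleOfRight r hr) (bimoduleOfLeft l hl)
  let i := inc N M
  have hv : v ≫ v† = 𝟙 _ :=
    (congrArg (v ≫ ·) (DaggerCategory.dagger_dagger _)).trans (congrArg Hom.hom hc)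
  have hz : z† ≫ z = i† ≫ v† ≫ v ≫ i := coevHom_aux l r hl hr c h
  Hom.mk (M := DaggerBimodule.unit B)
    (N := DaggerBimodule.rel (bimoduleOfRight r hr) (bimoduleOfLeft l hl)) (v ≫ i ≫ z†)
    (coev_left inc_isometry hv hz (actL_inc N M) (Hom.left c†))
    (coev_right inc_isometry hv hz (actR_inc N M) (Hom.right c†))

/-- A pair of pants algebra is Morita equivalent to the algebra at the other end. -/
theorem moritaEquivalent_of_maps (l : (embed A.toAlgebraData).X ≫ M ⟶ M)
    (r : N ≫ (embed A.toAlgebraData).X ⟶ N)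
    (hl : IsLeftDaggerModule A M.X ((inc (ofObj A.X) M)† ≫ Hom.hom l))
    (hr : IsRightDaggerModule A N.X ((inc N (ofObj A.X))† ≫ Hom.hom r))
    (hf : f ≫ f† = 𝟙 _) (hf' : f† ≫ f = 𝟙 _)
    (h₁ : (embed A.toAlgebraData).mul ≫ f = Bicategory.whiskerLeft _ f ≫
      (Bicategory.associator _ M N).inv ≫ Bicategory.whiskerRight l N)
    (h₂ : (embed A.toAlgebraData).mul ≫ f = Bicategory.whiskerRight f _ ≫
      (Bicategory.associator M N _).hom ≫ Bicategory.whiskerLeft M r)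
    (c : N ≫ M ⟶ 𝟙 B) (hc : c† ≫ c = 𝟙 _)
    (h : Bicategory.whiskerRight r† M ≫ (Bicategory.associator N _ M).hom ≫
      Bicategory.whiskerLeft N l = c ≫ c†) : MoritaEquivalent A B := by
  refine ⟨bimoduleOfLeft l hl, bimoduleOfRight r hr, coevHom l r hl hr c hc h,
    evalHom l r hl hr hf hf' h₁ h₂, ⟨hom_ext ?_, hom_ext ?_⟩, ⟨hom_ext ?_, hom_ext ?_⟩⟩
  · exact coev_isometry (v := Hom.hom c†) (i := inc N M) inc_isometry
      ((congrArg (_ ≫ ·) (DaggerCategory.dagger_dagger _)).trans (congrArg Hom.hom hc))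
      (coevHom_aux l r hl hr c h)
  · exact coev_coisometry (v := Hom.hom c†) (i := inc N M) inc_isometry
      (coevHom_aux l r hl hr c h)
  · exact (congrArg ((Hom.hom f)† ≫ ·) (DaggerCategory.dagger_dagger (Hom.hom f))).trans
      (congrArg Hom.hom hf')
  · exact (congrArg (· ≫ (Hom.hom f)†) (DaggerCategory.dagger_dagger (Hom.hom f))).trans
      (congrArg Hom.hom hf)

theorem moritaEquivalent_of_unitarilyStarIsomorphic (D : StandardDual M) (n : 𝟙 B ≅ 𝟙 B)
    (hn : IsPositive n.hom) (hD : n.hom ≫ n.hom = D.dimL)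
    (h : (embed A.toAlgebraData).UnitarilyStarIsomorphic (D.pairOfPants n)) :
    MoritaEquivalent A B := by
  obtain ⟨f, hf, hf₁, hf₂⟩ := h
  have hn' : n.hom† = n.hom := by
    obtain ⟨Y, g, hg⟩ := hn
    rw [hg, DaggerCategory.dagger_comp, DaggerCategory.dagger_dagger]
  have hn'' : n.inv† = n.inv := by
    have : n.inv† ≫ n.hom = 𝟙 _ := by
      rw [← congrArg (n.inv† ≫ ·) hn', ← DaggerCategory.dagger_comp, n.hom_inv_id,
        DaggerCategory.dagger_id]
    simpa using congrArg (· ≫ n.inv) this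
  -- Positivity has made `n`, hence `n⁻¹`, self-adjoint, and `dim_L = n²`. So the left side is `n⁻¹
  -- n² n⁻¹`.
  have hc : (D.adj.unit† ≫ n.inv)† ≫ D.adj.unit† ≫ n.inv = 𝟙 _ := by
    have : D.adj.unit ≫ D.adj.unit† = n.hom ≫ n.hom := hD.symm
    rw [DaggerCategory.dagger_comp, DaggerCategory.dagger_dagger, hn'', Category.assoc,
      reassoc_of% this]
    simp
  have hm : (embed A.toAlgebraData).mul ≫ f =
      (Bicategory.whiskerRight f _ ≫ Bicategory.whiskerLeft _ f) ≫
        Pants.mul (D.adj.unit† ≫ n.inv) := hf.map_mul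
  have s₁ := D.pairOfPants_snake_left n
  have s₂ := D.pairOfPants_snake_right n
  exact moritaEquivalent_of_maps (f := f)
    (Bicategory.whiskerRight f _ ≫ Pants.actL (D.adj.unit† ≫ n.inv))
    (Bicategory.whiskerLeft _ f ≫ Pants.actR (D.adj.unit† ≫ n.inv))
    (isLeftDaggerModule_of_embed _ (Pants.map_actL_assoc hm) (Pants.map_actL_unit s₁ hf.map_one)
      (Pants.map_actL_dagger s₁ hm hf.map_one hf₁ hf₂))
    (isRightDaggerModule_of_embed _ (Pants.map_actR_assoc hm) (Pants.map_actR_unit s₂ hf.map_one)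
      (Pants.map_actR_dagger s₂ hm hf.map_one hf₁ hf₂)) hf₁ hf₂ (Pants.mul_map_left hm)
    (Pants.mul_map_right hm) (D.adj.unit† ≫ n.inv) hc (Pants.map_actR_actL hf₂)

end OfPants

/-! ### Traces on finite-dimensional commutative C*-algebras. -/

section FiniteDimensionalStarAlgebras

/-- The properties of the involution of a commutative `C⋆`-algebra that are needed to identify a
finite-dimensional one with a power of `ℂ`. -/
structure IsDefiniteStar {R : Type*} [CommRing R] [Algebra ℂ R] (s : R → R) : Prop where
  involutive : ∀ a, s (s a) = a
  map_mul : ∀ a b, s (a * b) = s a * s b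
  map_smul : ∀ (c : ℂ) a, s (c • a) = (starRingEnd ℂ c) • s a
  map_sub : ∀ a b, s (a - b) = s a - s b
  definite : ∀ a, a * s a = 0 → a = 0

variable {R : Type*} [CommRing R] [Algebra ℂ R] [FiniteDimensional ℂ R]

/-- A reduced Artinian ring is the product of its residue fields, and each of them is finite over
the algebraically closed field `ℂ`. -/
lemma exists_algEquiv_pi [IsReduced R] :
    ∃ (n : ℕ), Nonempty (R ≃ₐ[ℂ] (Fin n → ℂ)) := by
  classical
  have : IsArtinianRing R := IsArtinianRing.of_finite ℂ R
  let Q : ∀ I : MaximalSpectrum R, (R ⧸ I.asIdeal) ≃ₐ[ℂ] ℂ := fun I =>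
    have := I.isMaximal
    letI := Ideal.Quotient.field I.asIdeal
    (AlgEquiv.ofBijective (Algebra.ofId ℂ (R ⧸ I.asIdeal))
      IsAlgClosed.algebraMap_bijective_of_isIntegral).symm
  let φ : R →ₐ[ℂ] (MaximalSpectrum R → ℂ) :=
    AlgHom.pi fun I => (Q I).toAlgHom.comp (Ideal.Quotient.mkₐ ℂ I.asIdeal)
  have hφ : Function.Bijective φ := by
    have h1 := (IsArtinianRing.equivPi R).bijective
    have h2 : Function.Bijective (Pi.map fun I => Q I : (∀ I, R ⧸ I.asIdeal) → _) :=
      Function.Bijective.piMap fun I => (Q I).bijective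
    exact h2.comp h1
  have := Fintype.ofFinite (MaximalSpectrum R)
  exact ⟨_, ⟨(AlgEquiv.ofBijective φ hφ).trans
    (AlgEquiv.piCongrLeft ℂ (fun _ => ℂ) (Fintype.equivFin (MaximalSpectrum R)))⟩⟩

lemma trace_mulLeft_eq_sum {ι : Type*} [Fintype ι] (e : R ≃ₐ[ℂ] (ι → ℂ)) (a : R) :
    LinearMap.trace ℂ R (LinearMap.mulLeft ℂ a) = ∑ i, e a i := by
  classical
  rw [← LinearMap.trace_conj' _ e.toLinearEquiv,
    LinearMap.trace_eq_matrix_trace ℂ (Pi.basisFun ℂ ι)]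
  refine Finset.sum_congr rfl fun i _ => ?_
  simp [LinearEquiv.conj_apply]

namespace IsDefiniteStar

variable {s : R → R}

/-- If `c² = 0`, then `c * s c` times its own star is `c² * (s c)² = 0`. Definiteness kills first `c
* s c`, then `c`. -/
lemma isReduced (hs : IsDefiniteStar s) : IsReduced R := by
  refine (isReduced_iff_pow_one_lt 2 one_lt_two).2 fun c hc => hs.definite c (hs.definite _ ?_)
  rw [hs.map_mul, hs.involutive]
  calc _ = c ^ 2 * (s c * s c) := by ring
    _ = 0 := by rw [hc, zero_mul]

lemma map_one (hs : IsDefiniteStar s) : s 1 = 1 := by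
  have := hs.map_mul 1 (s 1)
  rw [one_mul, hs.involutive] at this
  simpa using this.symm

/-- The star of `p * (1 - s p)` contains the factor `1 - p`, which `p` annihilates. Definiteness
gives `p = p * s p`, and the same for `s p` gives `s p = s p * p`. -/
lemma map_idempotent (hs : IsDefiniteStar s) {p : R} (hp : p * p = p) : s p = p := by
  have key : ∀ p : R, p * p = p → p = p * s p := by
    intro p hp
    have := hs.definite (p * (1 - s p)) (by
      rw [hs.map_mul, hs.map_sub, hs.involutive, hs.map_one]
      calc _ = (p - p * p) * (s p * (1 - s p)) := by ring
        _ = 0 := by rw [hp, sub_self, zero_mul])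
    rw [mul_sub, mul_one] at this
    exact sub_eq_zero.mp this
  have h2 := key (s p) (by rw [← hs.map_mul, hp])
  rw [hs.involutive, mul_comm, ← key p hp] at h2
  exact h2

/-- The involution fixes each coordinate idempotent and is conjugate-linear, so it can be applied to
`a * p = e a i • p`. -/
lemma algEquiv_apply (hs : IsDefiniteStar s) {ι : Type*}
    (e : R ≃ₐ[ℂ] (ι → ℂ)) (a : R) (i : ι) :
    e (s a) i = (starRingEnd ℂ) (e a i) := by
  classical
  set p := e.symm (Pi.single i 1) with hp
  have hep : e p = Pi.single i 1 := by simp [p]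
  have hpp : p * p = p := by
    apply e.injective
    rw [_root_.map_mul, hep, ← Pi.single_mul, one_mul]
  have hap : a * p = e a i • p := by
    apply e.injective
    rw [_root_.map_mul, _root_.map_smul, hep]
    ext j
    by_cases h : j = i
    · subst h; simp
    · simp [h]
  have h := congrArg (fun x => e (s x) i) hap
  simp only [hs.map_mul, hs.map_smul, hs.map_idempotent hpp, _root_.map_mul, _root_.map_smul,
    hep] at h
  simpa using h

/-- The trace is strictly positive. -/
lemma exists_pos_trace (hs : IsDefiniteStar s) {a : R} (h : a ≠ 0) :
    ∃ t : ℝ, 0 < t ∧ LinearMap.trace ℂ R (LinearMap.mulLeft ℂ (a * s a)) = t := by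
  have := hs.isReduced
  obtain ⟨n, ⟨e⟩⟩ := exists_algEquiv_pi (R := R)
  refine ⟨∑ i, Complex.normSq (e a i), ?_, ?_⟩
  · have h1 : ∃ i, e a i ≠ 0 := by
      by_contra! h2
      exact h (e.injective (by ext i; simp [h2]))
    obtain ⟨i, hi⟩ := h1
    exact Finset.sum_pos' (fun i _ => Complex.normSq_nonneg _)
      ⟨i, Finset.mem_univ i, Complex.normSq_pos.2 hi⟩
  · rw [trace_mulLeft_eq_sum e]
    push_cast
    refine Finset.sum_congr rfl fun i _ => ?_
    rw [_root_.map_mul, Pi.mul_apply, hs.algEquiv_apply, Complex.mul_conj]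

/-- A faithful positive functional is the trace weighted by the inverse fourth power of a positive
element. -/
lemma exists_weight (hs : IsDefiniteStar s) (ψ : R →ₗ[ℂ] ℂ)
    (hψ : ∀ a, a ≠ 0 → ∃ t : ℝ, 0 < t ∧ ψ (a * s a) = t) :
    ∃ k h h' : R, h = k * s k ∧ s h = h ∧ h * h' = 1 ∧
      ∀ a, LinearMap.trace ℂ R (LinearMap.mulLeft ℂ (h * h * a)) = ψ (h' * h' * a) := by
  classical
  have := hs.isReduced
  obtain ⟨n, ⟨e⟩⟩ := exists_algEquiv_pi (R := R)
  let p : Fin n → R := fun i => e.symm (Pi.single i 1)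
  have hep : ∀ i, e (p i) = Pi.single i 1 := fun i => by simp [p]
  have hpp : ∀ i, p i * p i = p i := fun i => by
    apply e.injective
    rw [_root_.map_mul, hep, ← Pi.single_mul, one_mul]
  have hp0 : ∀ i, p i ≠ 0 := fun i h => by
    have := congrFun (hep i) i
    rw [h] at this
    simp at this
  have ht : ∀ i, ∃ t : ℝ, 0 < t ∧ ψ (p i) = t := fun i => by
    have := hψ (p i) (hp0 i)
    rwa [hs.map_idempotent (hpp i), hpp] at this
  choose t ht0 ht using ht
  have hsum : ∀ a, ψ a = ∑ i, e a i * t i := fun a => by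
    have h1 : a = ∑ i, e a i • p i := by
      apply e.injective
      rw [map_sum]
      ext j
      simp [hep, Finset.sum_apply, Pi.single_apply]
    conv_lhs => rw [h1]
    simp [ht]
  -- In coordinates `ψ` has weights `t i` and the trace has weights `1`, so the required identity
  -- reads `h i ^ 4 = t i`. Since `h` is also to be of the form `k * s k`, the coordinates of `k`
  -- are eighth roots.
  let q : Fin n → ℝ := fun i => √(√(√(t i)))
  have hq0 : ∀ i, 0 < q i := fun i => by have := ht0 i; positivity
  have hq : ∀ i, q i ^ 8 = t i := fun i => by
    have h1 : q i ^ 2 = √(√(t i)) := Real.sq_sqrt (by positivity)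
    calc q i ^ 8 = ((q i ^ 2) ^ 2) ^ 2 := by ring
      _ = t i := by
        rw [h1, Real.sq_sqrt (by positivity), Real.sq_sqrt (ht0 i).le]
  let k := e.symm fun i => (q i : ℂ)
  have hek : ∀ i, e k i = q i := fun i => by simp [k]
  have hsk : s k = k := by
    apply e.injective
    ext i
    rw [hs.algEquiv_apply, hek, Complex.conj_ofReal]
  refine ⟨k, k * k, e.symm fun i => ((q i : ℂ) ^ 2)⁻¹, by rw [hsk], by rw [hs.map_mul, hsk], ?_, ?_⟩
  · apply e.injective
    ext i
    have := (hq0 i).ne'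
    simp only [_root_.map_mul, Pi.mul_apply, hek, AlgEquiv.apply_symm_apply, _root_.map_one,
      Pi.one_apply]
    rw [← pow_two, mul_inv_cancel₀]
    exact_mod_cast pow_ne_zero 2 this
  · intro a
    rw [trace_mulLeft_eq_sum e, hsum]
    refine Finset.sum_congr rfl fun i _ => ?_
    have : (q i : ℂ) ≠ 0 := by exact_mod_cast (hq0 i).ne'
    simp only [_root_.map_mul, Pi.mul_apply, hek, AlgEquiv.apply_symm_apply, ← hq]
    push_cast
    field_simp

end IsDefiniteStar

end FiniteDimensionalStarAlgebras

/-! ### Rescaling an adjunction to a standard one. -/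

section Rescaling

local infixr:80 (priority := 2000) " ⊗≫ " => CategoryTheory.bicategoricalComp
local infixr:81 (priority := 2000) " ◁ " => Bicategory.whiskerLeft
local infixl:81 (priority := 2000) " ▷ " => Bicategory.whiskerRight
local notation (priority := 2000) "α_" => Bicategory.associator
local notation (priority := 2000) "λ_" => Bicategory.leftUnitor
local notation (priority := 2000) "ρ_" => Bicategory.rightUnitor

namespace Rescaling

variable {𝓑 : Type u} [Bicategory.{w, v} 𝓑] {r s : 𝓑} {M : r ⟶ s} {N : s ⟶ r}

/-- The action of `End (𝟙 s)` on a 1-morphism with target `s`. -/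
def act (M : r ⟶ s) (z : 𝟙 s ⟶ 𝟙 s) : M ⟶ M := (ρ_ M).inv ≫ M ◁ z ≫ (ρ_ M).hom

lemma act_comp (z z' : 𝟙 s ⟶ 𝟙 s) : act M (z ≫ z') = act M z ≫ act M z' := by
  simp [act]

lemma act_id : act M (𝟙 (𝟙 s)) = 𝟙 M := by
  simp [act]

/-- The Eckmann–Hilton argument. -/
lemma end_comm (z z' : 𝟙 s ⟶ 𝟙 s) : z ≫ z' = z' ≫ z := by
  have h := Bicategory.whisker_exchange z z'
  have h1 : (λ_ (𝟙 s)).inv ≫ (𝟙 s ◁ z' ≫ z ▷ 𝟙 s) ≫ (ρ_ (𝟙 s)).hom = z' ≫ z := by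
    bicategory
  have h2 : (λ_ (𝟙 s)).inv ≫ (z ▷ 𝟙 s ≫ 𝟙 s ◁ z') ≫ (ρ_ (𝟙 s)).hom = z ≫ z' := by
    bicategory
  rw [← h1, ← h2, h]

/-- A scalar acting to the right of `M` lives in the outer region `s`, so interchange carries it
across the unit. -/
lemma unit_act (η : 𝟙 s ⟶ N ≫ M) (z : 𝟙 s ⟶ 𝟙 s) : η ≫ N ◁ act M z = z ≫ η := by
  calc _ = (ρ_ _).inv ≫ (η ▷ 𝟙 s ≫ (N ≫ M) ◁ z) ≫ (ρ_ _).hom := by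
        rw [act]; bicategory
    _ = _ := by
        rw [← Bicategory.whisker_exchange]; bicategory

/-- Rescaling of an adjunction by an invertible endomorphism of the identity. -/
@[simps]
def adjunction (adj : Bicategory.Adjunction N M) (h : 𝟙 s ≅ 𝟙 s) : Bicategory.Adjunction N M where
  unit := h.hom ≫ adj.unit
  counit := act M h.inv ▷ N ≫ adj.counit
  left_triangle := by
    rw [← adj.left_triangle]
    calc _ = (h.hom ≫ adj.unit ≫ N ◁ act M h.inv) ▷ N ⊗≫ N ◁ adj.counit := by
          bicategory
      _ = _ := by
          rw [unit_act, Iso.hom_inv_id_assoc]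
  right_triangle := by
    rw [← adj.right_triangle]
    calc _ = M ◁ h.hom ⊗≫ (M ◁ adj.unit ≫ act M h.inv ▷ (N ≫ M)) ⊗≫ adj.counit ▷ M := by
          bicategory
      _ = 𝟙 _ ⊗≫ ((ρ_ M).inv ≫ M ◁ h.hom ≫ (ρ_ M).hom ≫ act M h.inv) ⊗≫ M ◁ adj.unit ⊗≫
            adj.counit ▷ M := by
          rw [Bicategory.whisker_exchange]; bicategory
      _ = _ := by
          have : (ρ_ M).inv ≫ M ◁ h.hom ≫ (ρ_ M).hom ≫ act M h.inv = 𝟙 M := by simp [act]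
          rw [this]; bicategory

section Dagger

variable [∀ a b : 𝓑, DaggerCategory (a ⟶ b)] [IsDaggerBicategory 𝓑]

lemma act_dagger (z : 𝟙 s ⟶ 𝟙 s) : (act M z)† = act M z† := by
  simp [act]

/-- A snake equation recovers the action of `z` from `counit† ≫ act M z ▷ N`. This is what later
makes the weight functional faithful. -/
lemma act_eq_of_adjunction (adj : Bicategory.Adjunction N M) (z : 𝟙 s ⟶ 𝟙 s) : act M z =
    (λ_ M).inv ≫ (adj.counit† ≫ act M z ▷ N) ▷ M ≫ (α_ M N M).hom ≫ M ◁ adj.unit† ≫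
      (ρ_ M).hom := by
  have h1 : (act M z ▷ N) ▷ M ≫ (α_ M N M).hom ≫ M ◁ adj.unit† ≫ (ρ_ M).hom =
      (α_ M N M).hom ≫ M ◁ adj.unit† ≫ (ρ_ M).hom ≫ act M z := by
    calc _ = (α_ M N M).hom ≫ (act M z ▷ (N ≫ M) ≫ M ◁ adj.unit†) ≫ (ρ_ M).hom := by
          bicategory
      _ = _ := by
          rw [← Bicategory.whisker_exchange]; bicategory
  rw [Bicategory.comp_whiskerRight, Category.assoc, h1,
    reassoc_of% (counit_dagger_unit_dagger_left adj)]
  simp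

lemma inv_dagger {h : 𝟙 s ≅ 𝟙 s} (hh : h.hom† = h.hom) : h.inv† = h.inv := by
  have : h.inv† ≫ h.hom = 𝟙 _ := by
    rw [← congrArg (h.inv† ≫ ·) hh, ← DaggerCategory.dagger_comp, h.hom_inv_id,
      DaggerCategory.dagger_id]
  simpa using congrArg (· ≫ h.inv) this

variable [∀ a b : 𝓑, Preadditive (a ⟶ b)] [∀ a b : 𝓑, Linear ℂ (a ⟶ b)]

/-- A rescaled adjunction as a standard dual. -/
def standardDual (adj : Bicategory.Adjunction N M) (h : 𝟙 s ≅ 𝟙 s) (hh : h.hom† = h.hom)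
    (hE : ∀ T : M ⟶ M, canonicalTrace (adj.counit† ≫ T ▷ N ≫ adj.counit) =
      canonicalTrace (adj.counit† ≫ act M (adj.unit ≫ N ◁ T ≫ adj.unit†) ▷ N ≫ adj.counit))
    (hw : ∀ z : 𝟙 s ⟶ 𝟙 s, canonicalTrace (h.hom ≫ h.hom ≫ z) =
      canonicalTrace (adj.counit† ≫ act M (h.inv ≫ h.inv ≫ z) ▷ N ≫ adj.counit)) :
    StandardDual M where
  dual := N
  adj := adjunction adj h
  standard T := by
    have hh' := inv_dagger hh
    have h1 : (act M h.inv)† = act M h.inv := by rw [act_dagger, hh']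
    -- The self-adjoint factors `act M h.inv` on both sides of `T` slide through the unit and its
    -- dagger, and commute past the middle, which is an endomorphism of `𝟙 s`.
    have h2 : adj.unit ≫ N ◁ (act M h.inv ≫ T ≫ act M h.inv) ≫ adj.unit† =
        h.inv ≫ h.inv ≫ adj.unit ≫ N ◁ T ≫ adj.unit† := by
      have h3 : N ◁ act M h.inv ≫ adj.unit† = adj.unit† ≫ h.inv := by
        simpa [h1, hh'] using congrArg (fun f => f†) (unit_act adj.unit h.inv)
      simp only [Bicategory.whiskerLeft_comp, Category.assoc]
      rw [h3, ← Category.assoc, unit_act, Category.assoc]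
      congr 1
      rw [end_comm h.inv]
      simp
    have h4 : (adjunction adj h).unit ≫ N ◁ T ≫ (adjunction adj h).unit† =
        h.hom ≫ h.hom ≫ adj.unit ≫ N ◁ T ≫ adj.unit† := by
      rw [end_comm h.hom (adj.unit ≫ N ◁ T ≫ adj.unit†)]
      simp [hh]
    have h5 : (adjunction adj h).counit† ≫ T ▷ N ≫ (adjunction adj h).counit =
        adj.counit† ≫ (act M h.inv ≫ T ≫ act M h.inv) ▷ N ≫ adj.counit := by
      simp [h1]
    -- Writing `E` for the endomorphism of `𝟙 s` obtained from `T` by the original unit, the unit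
    -- side is the trace of `h² E`. By `hE` and `h2` the counit side is the weight of `h⁻² E`, and
    -- `hw` equates the two.
    rw [h4, h5, hE, h2, hw]

variable {adj : Bicategory.Adjunction N M} {h : 𝟙 s ≅ 𝟙 s} {hh : h.hom† = h.hom}
    {hE : ∀ T : M ⟶ M, canonicalTrace (adj.counit† ≫ T ▷ N ≫ adj.counit) =
      canonicalTrace (adj.counit† ≫ act M (adj.unit ≫ N ◁ T ≫ adj.unit†) ▷ N ≫ adj.counit)}
    {hw : ∀ z : 𝟙 s ⟶ 𝟙 s, canonicalTrace (h.hom ≫ h.hom ≫ z) =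
      canonicalTrace (adj.counit† ≫ act M (h.inv ≫ h.inv ≫ z) ▷ N ≫ adj.counit)}

/-- An isometric unit leaves `h²` as the left dimension, so `h` itself can serve as `n`. With this
choice the next two lemmas show that the pants algebra forgets the rescaling. -/
lemma standardDual_dimL (hη : adj.unit ≫ adj.unit† = 𝟙 _) :
    (standardDual adj h hh hE hw).dimL = h.hom ≫ h.hom := by
  change (h.hom ≫ adj.unit) ≫ (h.hom ≫ adj.unit)† = _
  rw [DaggerCategory.dagger_comp, Category.assoc, reassoc_of% hη, hh]

lemma standardDual_mul : ((standardDual adj h hh hE hw).pairOfPants h).mul =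
    Pants.mul adj.unit† := by
  refine (StandardDual.pairOfPants_mul _ _).trans (congrArg Pants.mul ?_)
  change (h.hom ≫ adj.unit)† ≫ h.inv = _
  rw [DaggerCategory.dagger_comp, hh, Category.assoc, h.hom_inv_id, Category.comp_id]

lemma standardDual_one : ((standardDual adj h hh hE hw).pairOfPants h).one = adj.counit† := by
  have hh' := inv_dagger hh
  refine (StandardDual.pairOfPants_one _ _).trans ?_
  change (act M h.inv ▷ N ≫ adj.counit)† ≫ M ◁ ((λ_ N).inv ≫ h.hom ▷ N ≫ (λ_ N).hom) = _
  have h1 : M ◁ ((λ_ N).inv ≫ h.hom ▷ N ≫ (λ_ N).hom) = act M h.hom ▷ N := by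
    rw [act]; bicategory
  rw [h1, DaggerCategory.dagger_comp, IsDaggerBicategory.dagger_whiskerRight, act_dagger, hh',
    Category.assoc, ← Bicategory.comp_whiskerRight, ← act_comp, h.inv_hom_id, act_id]
  simp

end Dagger

end Rescaling

end Rescaling

/-! ### Triangle identities of bimodules written in `C`. -/

lemma rightZigzag_eq {𝓑 : Type u} [Bicategory.{w, v} 𝓑] {r s : 𝓑} {M : r ⟶ s} {N : s ⟶ r}
    (η : 𝟙 s ⟶ N ≫ M) (ε : M ≫ N ⟶ 𝟙 r) : Bicategory.rightZigzag η ε =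
    Bicategory.whiskerLeft M η ≫ (Bicategory.associator M N M).inv ≫
      Bicategory.whiskerRight ε M := by
  bicategory

lemma leftZigzag_eq {𝓑 : Type u} [Bicategory.{w, v} 𝓑] {r s : 𝓑} {M : r ⟶ s} {N : s ⟶ r}
    (η : 𝟙 s ⟶ N ≫ M) (ε : M ≫ N ⟶ 𝟙 r) : Bicategory.leftZigzag η ε =
    Bicategory.whiskerRight η N ≫ (Bicategory.associator N M N).hom ≫
      Bicategory.whiskerLeft N ε := by
  bicategory

section Restriction

variable {C : Type u} [Category.{v} C] [Preadditive C] [Linear ℂ C]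
    [MonoidalCategory C] [MonoidalPreadditive C] [MonoidalLinear ℂ C] [RigidCStarTensorCategory C]
    {A B : SSFA C}

open DaggerBimodule

section Transfer

variable {K L M N P Q R S V Z : C}

/-- The triangle identity of an adjunction of bimodules in terms of the underlying morphisms. -/
lemma transfer_triangle_right {iR : R ⟶ M ⊗ K} {r : M ⊗ K ⟶ M} {iL : L ⟶ Z ⊗ M} {l : Z ⊗ M ⟶ M}
    {v : K ⟶ V} {q : V ⟶ N ⊗ M} {p : P ⟶ M ⊗ N} {j : S ⟶ M ⊗ V} {k : Q ⟶ P ⊗ M} {b : S ⟶ Q}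
    {e : P ⟶ Z} (hiR : iR† ≫ iR = r ≫ r†) (hiR' : iR ≫ r ≫ r† = iR) (hr : r† ≫ r = 𝟙 _)
    (hiL : iL† ≫ iL = l ≫ l†) (hiL' : iL ≫ iL† = 𝟙 _) (hl : l† ≫ l = 𝟙 _)
    (hp : p ≫ p† = 𝟙 _) (hb : b ≫ k ≫ p ▷ M = j ≫ M ◁ q ≫ (α_ M N M).inv)
    (hv : (iR ≫ M ◁ v ≫ j†) ≫ j = iR ≫ M ◁ v) (he : (k ≫ e ▷ M ≫ iL†) ≫ iL = k ≫ e ▷ M) :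
    (iR ≫ M ◁ v ≫ j†) ≫ b ≫ (k ≫ e ▷ M ≫ iL†) = (iR ≫ r) ≫ (iL ≫ l)† ↔
      r† ≫ M ◁ (v ≫ q) ≫ (α_ M N M).inv ≫ (p† ≫ e) ▷ M = l† := by
  have h1 : ((iR ≫ M ◁ v ≫ j†) ≫ b ≫ (k ≫ e ▷ M ≫ iL†)) ≫ iL =
      iR ≫ M ◁ (v ≫ q) ≫ (α_ M N M).inv ≫ (p† ≫ e) ▷ M := by
    have h2 : e ▷ M = p ▷ M ≫ (p† ≫ e) ▷ M := by
      rw [← comp_whiskerRight, reassoc_of% hp]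
    rw [Category.assoc, Category.assoc b, he, h2, reassoc_of% hb, ← Category.assoc _ j, hv]
    simp
  have h3 : ((iR ≫ r) ≫ (iL ≫ l)†) ≫ iL = iR ≫ r ≫ l† := by
    simp only [DaggerCategory.dagger_comp, Category.assoc]
    rw [hiL, reassoc_of% hl]
  constructor
  · intro h
    have h4 := congrArg (fun f => r† ≫ iR† ≫ f ≫ iL) h
    simp only [h1, h3] at h4
    rw [reassoc_of% hiR, reassoc_of% hr, reassoc_of% hiR, reassoc_of% hr, reassoc_of% hr] at h4
    exact h4
  · intro h
    have h4 : iR ≫ M ◁ (v ≫ q) ≫ (α_ M N M).inv ≫ (p† ≫ e) ▷ M = iR ≫ r ≫ l† := by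
      rw [← h, reassoc_of% hiR']
    rw [← h1, ← h3] at h4
    simpa only [Category.assoc, hiL', Category.comp_id] using congrArg (· ≫ iL†) h4

lemma transfer_triangle_left {iR : R ⟶ N ⊗ Z} {r : N ⊗ Z ⟶ N} {iL : L ⟶ K ⊗ N} {l : K ⊗ N ⟶ N}
    {v : K ⟶ V} {q : V ⟶ N ⊗ M} {p : P ⟶ M ⊗ N} {j : S ⟶ N ⊗ P} {k : Q ⟶ V ⊗ N} {a : Q ⟶ S}
    {e : P ⟶ Z} (hiR : iR† ≫ iR = r ≫ r†) (hiR' : iR ≫ iR† = 𝟙 _) (hr : r† ≫ r = 𝟙 _)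
    (hiL : iL† ≫ iL = l ≫ l†) (hiL' : iL ≫ l ≫ l† = iL) (hl : l† ≫ l = 𝟙 _)
    (hp : p ≫ p† = 𝟙 _) (ha : a ≫ j ≫ N ◁ p = k ≫ q ▷ N ≫ (α_ N M N).hom)
    (hv : (iL ≫ v ▷ N ≫ k†) ≫ k = iL ≫ v ▷ N) (he : (j ≫ N ◁ e ≫ iR†) ≫ iR = j ≫ N ◁ e) :
    (iL ≫ v ▷ N ≫ k†) ≫ a ≫ (j ≫ N ◁ e ≫ iR†) = (iL ≫ l) ≫ (iR ≫ r)† ↔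
      l† ≫ (v ≫ q) ▷ N ≫ (α_ N M N).hom ≫ N ◁ (p† ≫ e) = r† := by
  have h1 : ((iL ≫ v ▷ N ≫ k†) ≫ a ≫ (j ≫ N ◁ e ≫ iR†)) ≫ iR =
      iL ≫ (v ≫ q) ▷ N ≫ (α_ N M N).hom ≫ N ◁ (p† ≫ e) := by
    have h2 : N ◁ e = N ◁ p ≫ N ◁ (p† ≫ e) := by
      rw [← MonoidalCategory.whiskerLeft_comp, reassoc_of% hp]
    rw [Category.assoc, Category.assoc a, he, h2, reassoc_of% ha, ← Category.assoc _ k, hv]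
    simp
  have h3 : ((iL ≫ l) ≫ (iR ≫ r)†) ≫ iR = iL ≫ l ≫ r† := by
    simp only [DaggerCategory.dagger_comp, Category.assoc]
    rw [hiR, reassoc_of% hr]
  constructor
  · intro h
    have h4 := congrArg (fun f => l† ≫ iL† ≫ f ≫ iR) h
    simp only [h1, h3] at h4
    rw [reassoc_of% hiL, reassoc_of% hl, reassoc_of% hiL, reassoc_of% hl, reassoc_of% hl] at h4
    exact h4
  · intro h
    have h4 : iL ≫ (v ≫ q) ▷ N ≫ (α_ N M N).hom ≫ N ◁ (p† ≫ e) = iL ≫ l ≫ r† := by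
      rw [← h, reassoc_of% hiL']
    rw [← h1, ← h3] at h4
    simpa only [Category.assoc, hiR', Category.comp_id] using congrArg (· ≫ iR†) h4

end Transfer

variable {M : A ⟶ B} {N : B ⟶ A} (η : 𝟙 B ⟶ N ≫ M) (ε : M ≫ N ⟶ 𝟙 A)

/-- The underlying morphism of a unit, as a morphism to the tensor product in `C`. -/
noncomputable def cupHom : B.X ⟶ N.X ⊗ M.X := Hom.hom η ≫ inc N M

/-- The underlying morphism of a counit, as a morphism from the tensor product in `C`. -/
noncomputable def capHom : M.X ⊗ N.X ⟶ A.X := (inc M N)† ≫ Hom.hom ε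

/-- A unitor of bimodules is an inclusion followed by an action, so after cancelling inclusions the
unitors appear as the coactions `actR†` and `actL†`. One direction unpacks a given adjunction, the
other reassembles one after the `A`-actions are forgotten. -/
lemma triangle_right_iff : Bicategory.rightZigzag η ε =
    (Bicategory.rightUnitor M).hom ≫ (Bicategory.leftUnitor M).inv ↔
    M.actR† ≫ M.X ◁ cupHom η ≫ (α_ M.X N.X M.X).inv ≫ capHom ε ▷ M.X = M.actL† := by
  rw [rightZigzag_eq]
  refine Iff.trans ⟨fun h => congrArg Hom.hom h, fun h => hom_ext h⟩
    (transfer_triangle_right (incR_dagger_incR M) (incR_idem M) (actR_sep M)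
      (incL_dagger_incL M) (incL_isometry M) (actL_sep M) (inc_isometry (M := M) (N := N))
      (assocHom_dagger_inc M N M) (relLeft_inc M η) (relRight_inc ε M))

lemma triangle_left_iff : Bicategory.leftZigzag η ε =
    (Bicategory.leftUnitor N).hom ≫ (Bicategory.rightUnitor N).inv ↔
    N.actL† ≫ cupHom η ▷ N.X ≫ (α_ N.X M.X N.X).hom ≫ N.X ◁ capHom ε = N.actR† := by
  rw [leftZigzag_eq]
  refine Iff.trans ⟨fun h => congrArg Hom.hom h, fun h => hom_ext h⟩
    (transfer_triangle_left (incR_dagger_incR N) (incR_isometry N) (actR_sep N)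
      (incL_dagger_incL N) (incL_idem N) (actL_sep N) (inc_isometry (M := M) (N := N))
      (assocHom_inc N M N) (relRight_inc η N) (relLeft_inc N ε))

end Restriction

/-! ### Forgetting the actions of `A`. -/

section Restriction

variable {C : Type u} [Category.{v} C] [Preadditive C] [Linear ℂ C]
    [MonoidalCategory C] [MonoidalPreadditive C] [MonoidalLinear ℂ C] [RigidCStarTensorCategory C]
    {A B : SSFA C}

open DaggerBimodule

lemma isLeftDaggerModule_trivial (X : C) :
    IsLeftDaggerModule (SSFA.trivial : SSFA C) X (λ_ X).hom := (ofObj X).isLeft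

lemma isRightDaggerModule_trivial (X : C) :
    IsRightDaggerModule (SSFA.trivial : SSFA C) X (ρ_ X).hom := (ofObj X).isRight

/-- Forgetting the left action of a bimodule. -/
noncomputable def forgetLeft (X : A ⟶ B) : (SSFA.trivial : SSFA C) ⟶ B where
  X := X.X
  actL := (λ_ X.X).hom
  actR := X.actR
  isLeft := isLeftDaggerModule_trivial X.X
  isRight := X.isRight
  comm := by
    change (λ_ X.X).hom ▷ B.X ≫ X.actR = (α_ (𝟙_ C) X.X B.X).hom ≫ 𝟙_ C ◁ X.actR ≫ (λ_ X.X).hom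
    rw [leftUnitor_naturality]
    simp

/-- Forgetting the right action of a bimodule. -/
noncomputable def forgetRight (Y : B ⟶ A) : B ⟶ (SSFA.trivial : SSFA C) where
  X := Y.X
  actL := Y.actL
  actR := (ρ_ Y.X).hom
  isLeft := Y.isLeft
  isRight := isRightDaggerModule_trivial Y.X
  comm := by
    change Y.actL ▷ 𝟙_ C ≫ (ρ_ Y.X).hom = (α_ B.X Y.X (𝟙_ C)).hom ≫ B.X ◁ (ρ_ Y.X).hom ≫ Y.actL
    rw [rightUnitor_naturality]
    simp

section Transfer

variable {M N P Q R Y : C}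

lemma transfer_unit_actL {m : Y ⊗ Q ⟶ Q} {v : Q ⟶ P} {i : P ⟶ N ⊗ M} {z : R ⟶ N ⊗ M}
    {a : Y ⊗ N ⟶ N} {b : Y ⊗ P ⟶ P} (hz : z† ≫ z = 𝟙 _)
    (hb : b ≫ i = Y ◁ i ≫ (α_ Y N M).inv ≫ a ▷ M) (h : Y ◁ v ≫ b = m ≫ v) :
    Y ◁ ((v ≫ i) ≫ z†) ≫ Y ◁ z ≫ ((α_ Y N M).inv ≫ a ▷ M) ≫ z† = m ≫ (v ≫ i) ≫ z† := by
  rw [← whiskerLeft_comp_assoc, Category.assoc, hz, Category.comp_id,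
    MonoidalCategory.whiskerLeft_comp, Category.assoc _ i, ← reassoc_of% h, reassoc_of% hb]
  simp

lemma transfer_unit_actR {m : Q ⊗ Y ⟶ Q} {v : Q ⟶ P} {i : P ⟶ N ⊗ M} {z : R ⟶ N ⊗ M}
    {a : M ⊗ Y ⟶ M} {b : P ⊗ Y ⟶ P} (hz : z† ≫ z = 𝟙 _)
    (hb : b ≫ i = i ▷ Y ≫ (α_ N M Y).hom ≫ N ◁ a) (h : v ▷ Y ≫ b = m ≫ v) :
    ((v ≫ i) ≫ z†) ▷ Y ≫ z ▷ Y ≫ ((α_ N M Y).hom ≫ N ◁ a) ≫ z† = m ≫ (v ≫ i) ≫ z† := by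
  rw [← comp_whiskerRight_assoc, Category.assoc, hz, Category.comp_id,
    comp_whiskerRight, Category.assoc _ i, ← reassoc_of% h, reassoc_of% hb]
  simp

lemma transfer_isometry {v : Q ⟶ P} {i : P ⟶ Y} {z : R ⟶ Y} (hv : v ≫ v† = 𝟙 _)
    (hi : i ≫ i† = 𝟙 _) (hz : z† ≫ z = 𝟙 _) :
    ((v ≫ i) ≫ z†) ≫ ((v ≫ i) ≫ z†)† = 𝟙 _ := by
  simp [reassoc_of% hz, reassoc_of% hi, hv]

end Transfer

variable {X : A ⟶ B} {Y : B ⟶ A}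

/-- The unit of the adjunction obtained by forgetting the actions of `A`. -/
noncomputable def forgetUnit (η : 𝟙 B ⟶ Y ≫ X) : 𝟙 B ⟶ forgetRight Y ≫ forgetLeft X :=
  Hom.mk (M := DaggerBimodule.unit B) (N := DaggerBimodule.rel (forgetRight Y) (forgetLeft X))
    (cupHom η ≫ (inc (forgetRight Y) (forgetLeft X))†)
    (transfer_unit_actL (inc_dagger_inc_trivial (forgetRight Y) (forgetLeft X)) (actL_inc Y X)
      (Hom.left η))
    (transfer_unit_actR (inc_dagger_inc_trivial (forgetRight Y) (forgetLeft X)) (actR_inc Y X)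
      (Hom.right η))

/-- The counit of the adjunction obtained by forgetting the actions of `A`. -/
noncomputable def forgetCounit (ε : X ≫ Y ⟶ 𝟙 A) :
    forgetLeft X ≫ forgetRight Y ⟶ 𝟙 (SSFA.trivial : SSFA C) :=
  let e : (DaggerBimodule.rel X Y).X ⟶ 𝟙_ C := Hom.hom ε ≫ A.one†
  Hom.mk (M := DaggerBimodule.rel (forgetLeft X) (forgetRight Y))
    (N := DaggerBimodule.unit SSFA.trivial) e
    ((leftUnitor_naturality e).trans (congrArg (· ≫ e)
        (actL_trivial (DaggerBimodule.rel (forgetLeft X) (forgetRight Y))).symm))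
    ((congrArg (e ▷ 𝟙_ C ≫ ·) unitors_equal).trans <|
      (rightUnitor_naturality e).trans (congrArg (· ≫ e)
        (actR_trivial (DaggerBimodule.rel (forgetLeft X) (forgetRight Y))).symm))

lemma cupHom_forgetUnit (η : 𝟙 B ⟶ Y ≫ X) : cupHom (forgetUnit η) = cupHom η := by
  refine (Category.assoc _ _ _).trans
    ((congrArg (_ ≫ ·) (inc_dagger_inc_trivial (forgetRight Y) (forgetLeft X))).trans ?_)
  exact Category.comp_id (cupHom η)

lemma capHom_forgetCounit (ε : X ≫ Y ⟶ 𝟙 A) : capHom (forgetCounit ε) = capHom ε ≫ A.one† :=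
  (Category.assoc (inc X Y)† (Hom.hom ε) A.one†).symm

/-- The cup is the isometry `η` followed by the isometric inclusion of `Y ⊗_A X` into `Y ⊗ X`, and
the inclusion over the trivial algebra is unitary. -/
lemma forgetUnit_isometry {η : 𝟙 B ⟶ Y ≫ X} (h : η ≫ η† = 𝟙 _) :
    forgetUnit η ≫ (forgetUnit η)† = 𝟙 _ := hom_ext <| by
  have h1 : Hom.hom η ≫ (Hom.hom η)† = 𝟙 B.X := congrArg Hom.hom h
  exact transfer_isometry h1 (inc_isometry (M := Y) (N := X))
    (inc_dagger_inc_trivial (forgetRight Y) (forgetLeft X))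

/-- The adjunction obtained by forgetting the actions of `A`. -/
noncomputable def forgetAdjunction (adj : Bicategory.Adjunction Y X) :
    Bicategory.Adjunction (forgetRight Y) (forgetLeft X) where
  unit := forgetUnit adj.unit
  counit := forgetCounit adj.counit
  left_triangle := by
    rw [triangle_left_iff, cupHom_forgetUnit, capHom_forgetCounit]
    have h := (triangle_left_iff _ _).1 adj.left_triangle
    -- Following the triangle identity over `A` by `A.one†` turns the coaction of `A` into an
    -- inverse unitor, which is the coaction of the trivial algebra.
    have h1 : Y.actR† ≫ Y.X ◁ A.one† = (ρ_ Y.X).inv := by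
      simpa using congrArg (fun f => f†) Y.isRight.unit
    have h2 := congrArg (· ≫ Y.X ◁ A.one†) h
    simp only [Category.assoc, h1, ← MonoidalCategory.whiskerLeft_comp] at h2
    exact h2.trans (RigidCStarTensorCategory.dagger_rightUnitor Y.X).symm
  right_triangle := by
    rw [triangle_right_iff, cupHom_forgetUnit, capHom_forgetCounit]
    have h := (triangle_right_iff _ _).1 adj.right_triangle
    have h1 : X.actL† ≫ A.one† ▷ X.X = (λ_ X.X).inv := by
      simpa using congrArg (fun f => f†) X.isLeft.unit
    have h2 := congrArg (· ≫ A.one† ▷ X.X) h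
    simp only [Category.assoc, h1, ← comp_whiskerRight] at h2
    exact h2.trans (RigidCStarTensorCategory.dagger_leftUnitor X.X).symm

end Restriction

/-! ### Commutative endomorphism algebras and their canonical trace. -/

section CommutativeEnd

variable {D : Type u} [Category.{v} D] [Preadditive D] [Linear ℂ D] [DaggerCategory D] {Z : D}

/-- The endomorphisms of an object as a commutative ring. -/
abbrev endCommRing (hcomm : ∀ f g : Z ⟶ Z, f ≫ g = g ≫ f) : CommRing (End Z) :=
  { (inferInstance : Ring (End Z)) with mul_comm := fun a b => hcomm b a }

lemma isDefiniteStar_end (hcomm : ∀ f g : Z ⟶ Z, f ≫ g = g ≫ f)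
    (hsmul : ∀ (c : ℂ) (f : Z ⟶ Z), (c • f)† = (starRingEnd ℂ c) • f†)
    (hsub : ∀ f g : Z ⟶ Z, (f - g)† = f† - g†) (hpos : ∀ f : Z ⟶ Z, f ≫ f† = 0 → f = 0) :
    letI := endCommRing hcomm
    IsDefiniteStar (R := End Z) (fun a : Z ⟶ Z => (a† : Z ⟶ Z)) :=
  letI := endCommRing hcomm
  { involutive := DaggerCategory.dagger_dagger
    map_mul := fun a b => (DaggerCategory.dagger_comp (X := Z) b a).trans (hcomm _ _)
    map_smul := hsmul
    map_sub := hsub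
    definite := fun a h => hpos a ((hcomm _ _).trans h) }

lemma canonicalTrace_eq (hcomm : ∀ f g : Z ⟶ Z, f ≫ g = g ≫ f) (f : Z ⟶ Z) :
    letI := endCommRing hcomm
    canonicalTrace f = LinearMap.trace ℂ (End Z) (LinearMap.mulLeft (A := End Z) ℂ f) := by
  let := endCommRing hcomm
  have e : Linear.leftComp ℂ Z f = LinearMap.mulLeft (A := End Z) ℂ f := by
    ext g
    exact hcomm f g
  rw [canonicalTrace, e]
  rfl

variable [FiniteDimensional ℂ (Z ⟶ Z)]

lemma exists_pos_canonicalTrace (hcomm : ∀ f g : Z ⟶ Z, f ≫ g = g ≫ f)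
    (hsmul : ∀ (c : ℂ) (f : Z ⟶ Z), (c • f)† = (starRingEnd ℂ c) • f†)
    (hsub : ∀ f g : Z ⟶ Z, (f - g)† = f† - g†) (hpos : ∀ f : Z ⟶ Z, f ≫ f† = 0 → f = 0)
    {f : Z ⟶ Z} (hf : f ≠ 0) : ∃ t : ℝ, 0 < t ∧ canonicalTrace (f ≫ f†) = t := by
  let := endCommRing hcomm
  have : FiniteDimensional ℂ (End Z) := ‹_›
  obtain ⟨t, ht, h⟩ := (isDefiniteStar_end hcomm hsmul hsub hpos).exists_pos_trace hf
  exact ⟨t, ht, (canonicalTrace_eq hcomm _).trans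
    ((congrArg (fun x : End Z => LinearMap.trace ℂ (End Z) (LinearMap.mulLeft ℂ x))
      (hcomm f f†)).trans h)⟩

/-- `IsDefiniteStar.exists_weight` for the ring `End Z`, whose product is composition in the
opposite order; commutativity absorbs the difference. -/
lemma exists_weight_end (hcomm : ∀ f g : Z ⟶ Z, f ≫ g = g ≫ f)
    (hsmul : ∀ (c : ℂ) (f : Z ⟶ Z), (c • f)† = (starRingEnd ℂ c) • f†)
    (hsub : ∀ f g : Z ⟶ Z, (f - g)† = f† - g†) (hpos : ∀ f : Z ⟶ Z, f ≫ f† = 0 → f = 0)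
    (ψ : (Z ⟶ Z) →ₗ[ℂ] ℂ) (hψ : ∀ f : Z ⟶ Z, f ≠ 0 → ∃ t : ℝ, 0 < t ∧ ψ (f ≫ f†) = t) :
    ∃ (k : Z ⟶ Z) (h : Z ≅ Z), h.hom = k ≫ k† ∧ h.hom† = h.hom ∧
      ∀ f, canonicalTrace (h.hom ≫ h.hom ≫ f) = ψ (h.inv ≫ h.inv ≫ f) := by
  let := endCommRing hcomm
  have : FiniteDimensional ℂ (End Z) := ‹_›
  obtain ⟨k, h, h', h1, h2, h3, h4⟩ := (isDefiniteStar_end hcomm hsmul hsub hpos).exists_weight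
    (R := End Z) ψ (fun f hf => by
      obtain ⟨t, ht, h⟩ := hψ f hf
      exact ⟨t, ht, (congrArg ψ (hcomm _ _)).trans h⟩)
  have e : ∀ a b f : Z ⟶ Z, a ≫ b ≫ f = f ≫ b ≫ a := fun a b f => by
    rw [hcomm b f, hcomm a, Category.assoc]
  refine ⟨k, ⟨h, h', (hcomm _ _).trans h3, h3⟩, h1.trans (hcomm _ _), h2, fun f => ?_⟩
  change canonicalTrace (h ≫ h ≫ f) = ψ (h' ≫ h' ≫ f)
  exact (congrArg canonicalTrace (e h h f)).trans ((canonicalTrace_eq hcomm _).trans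
    ((h4 f).trans (congrArg ψ (e h' h' f).symm)))

end CommutativeEnd

section Trace

variable {D : Type u} [Category.{v} D] [Preadditive D] [Linear ℂ D] {Z : D}

lemma canonicalTrace_add (f g : Z ⟶ Z) :
    canonicalTrace (f + g) = canonicalTrace f + canonicalTrace g := by
  rw [canonicalTrace, canonicalTrace, canonicalTrace, ← map_add]
  congr 1
  ext h
  simp

lemma canonicalTrace_smul (c : ℂ) (f : Z ⟶ Z) :
    canonicalTrace (c • f) = c * canonicalTrace f := by
  rw [canonicalTrace, canonicalTrace, ← smul_eq_mul, ← map_smul]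
  congr 1
  ext h
  simp

end Trace

section CStar

variable {C : Type u} [Category.{v} C] [Preadditive C] [Linear ℂ C] [CStarCategory C]

lemma dagger_sub {X Y : C} (f g : X ⟶ Y) : (f - g)† = f† - g† := by
  have h : f - g = f + (-1 : ℂ) • g := by simp [sub_eq_add_neg]
  rw [h, CStarCategory.dagger_add, CStarCategory.dagger_smul]
  simp [sub_eq_add_neg]

/-- The C*-identity, with `norm 0 = 0` obtained from homogeneity. -/
lemma eq_zero_of_comp_dagger {X Y : C} (f : X ⟶ Y) (h : f ≫ f† = 0) : f = 0 := by
  apply CStarCategory.eq_zero_of_norm_eq_zero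
  have h1 := CStarCategory.norm_comp_dagger f
  have h2 := CStarCategory.norm_smul (0 : ℂ) (0 : X ⟶ X)
  rw [smul_zero, norm_zero, zero_mul] at h2
  rw [h, h2] at h1
  exact pow_eq_zero_iff two_ne_zero |>.1 h1.symm

end CStar

/-! ### The trace identity derived from the standardness of `A`. -/

section Standardness

variable {C : Type u} [Category.{v} C] [Preadditive C] [Linear ℂ C]
    [MonoidalCategory C] [MonoidalPreadditive C] [MonoidalLinear ℂ C] [RigidCStarTensorCategory C]
    {A B D : SSFA C}

open DaggerBimodule

namespace DaggerBimodule

lemma actL_inc_dagger (M : DaggerBimodule A B) (N : DaggerBimodule B D) :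
    A.X ◁ (M.inc N)† ≫ (M.rel N).actL = (α_ A.X M.X N.X).inv ≫ M.actL ▷ N.X ≫ (M.inc N)† := by
  change _ ≫ A.X ◁ M.inc N ≫ ((α_ A.X M.X N.X).inv ≫ M.actL ▷ N.X) ≫ (M.inc N)† = _
  have h := idem_actL M N
  rw [← whiskerLeft_comp_assoc, inc_dagger_inc, Category.assoc, reassoc_of% h, idem_inc_dagger]

lemma actR_inc_dagger (M : DaggerBimodule A B) (N : DaggerBimodule B D) :
    (M.inc N)† ▷ D.X ≫ (M.rel N).actR = (α_ M.X N.X D.X).hom ≫ M.X ◁ N.actR ≫ (M.inc N)† := by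
  change _ ≫ M.inc N ▷ D.X ≫ ((α_ M.X N.X D.X).hom ≫ M.X ◁ N.actR) ≫ (M.inc N)† = _
  have h := idem_actR M N
  rw [← comp_whiskerRight_assoc, inc_dagger_inc, Category.assoc, reassoc_of% h, idem_inc_dagger]

end DaggerBimodule

section Transfer

variable {X Y Z P : C}

lemma transfer_cap_left {p : P ⟶ X ⊗ Y} {m : Z ⊗ Z ⟶ Z} {e : P ⟶ Z} {b : Z ⊗ P ⟶ P}
    {l : Z ⊗ X ⟶ X} (hb : Z ◁ p† ≫ b = (α_ Z X Y).inv ≫ l ▷ Y ≫ p†) (he : Z ◁ e ≫ m = b ≫ e) :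
    Z ◁ (p† ≫ e) ≫ m = (α_ Z X Y).inv ≫ l ▷ Y ≫ p† ≫ e := by
  rw [MonoidalCategory.whiskerLeft_comp, Category.assoc, he, reassoc_of% hb]

lemma transfer_cap_right {p : P ⟶ X ⊗ Y} {m : Z ⊗ Z ⟶ Z} {e : P ⟶ Z} {b : P ⊗ Z ⟶ P}
    {r : Y ⊗ Z ⟶ Y} (hb : p† ▷ Z ≫ b = (α_ X Y Z).hom ≫ X ◁ r ≫ p†) (he : e ▷ Z ≫ m = b ≫ e) :
    (p† ≫ e) ▷ Z ≫ m = (α_ X Y Z).hom ≫ X ◁ r ≫ p† ≫ e := by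
  rw [comp_whiskerRight, Category.assoc, he, reassoc_of% hb]

lemma transfer_cap_dagger_right {p : P ⟶ X ⊗ Y} {m : Z ⊗ Z ⟶ Z} {e : P ⟶ Z} {b : P ⊗ Z ⟶ P}
    {r : Y ⊗ Z ⟶ Y} (hb : b ≫ p = p ▷ Z ≫ (α_ X Y Z).hom ≫ X ◁ r) (he : e† ▷ Z ≫ b = m ≫ e†) :
    (p† ≫ e)† ▷ Z ≫ (α_ X Y Z).hom ≫ X ◁ r = m ≫ (p† ≫ e)† := by
  rw [DaggerCategory.dagger_comp, DaggerCategory.dagger_dagger, comp_whiskerRight, Category.assoc,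
    ← hb, reassoc_of% he]

end Transfer

variable {X : A ⟶ B} {Y : B ⟶ A} (η : 𝟙 B ⟶ Y ≫ X) (ε : X ≫ Y ⟶ 𝟙 A)

lemma capHom_left : A.X ◁ capHom ε ≫ A.mul =
    (α_ A.X X.X Y.X).inv ≫ X.actL ▷ Y.X ≫ capHom ε :=
  transfer_cap_left (actL_inc_dagger X Y) (Hom.left ε)

lemma capHom_right : capHom ε ▷ A.X ≫ A.mul =
    (α_ X.X Y.X A.X).hom ≫ X.X ◁ Y.actR ≫ capHom ε :=
  transfer_cap_right (actR_inc_dagger X Y) (Hom.right ε)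

lemma capHom_dagger_right : (capHom ε)† ▷ A.X ≫ (α_ X.X Y.X A.X).hom ≫ X.X ◁ Y.actR =
    A.mul ≫ (capHom ε)† :=
  transfer_cap_dagger_right (actR_inc X Y) (Hom.right ε†)

variable {ε} in
-- The cap is thus a partial isometry whose initial projection is the idempotent of the relative
-- tensor product.
lemma capHom_comp_dagger (h : ε ≫ ε† = 𝟙 _) :
    capHom ε ≫ (capHom ε)† = DaggerBimodule.idem X Y := by
  have h1 : Hom.hom ε ≫ (Hom.hom ε)† = 𝟙 (DaggerBimodule.rel X Y).X := congrArg Hom.hom h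
  have h2 : ((inc X Y)† ≫ Hom.hom ε) ≫ ((inc X Y)† ≫ Hom.hom ε)† =
      (inc X Y)† ≫ (Hom.hom ε ≫ (Hom.hom ε)†) ≫ inc X Y := by simp
  rw [h1, Category.id_comp, inc_dagger_inc] at h2
  exact h2

/-- The cup takes values in a relative tensor product over `A`, and `d''` is the idempotent over `B`
on `M ⊗ N`. Linearity of `v` moves that idempotent back to `r ≫ r†`, which `r†` absorbs. -/
lemma transfer_cup {K V M N R : C} {r : M ⊗ K ⟶ M} {v : K ⟶ V} {q : V ⟶ N ⊗ R}
    {d : M ⊗ K ⟶ M ⊗ K} {d' : M ⊗ V ⟶ M ⊗ V} {d'' : M ⊗ N ⟶ M ⊗ N} (hr : r† ≫ r = 𝟙 _)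
    (hd : d = r ≫ r†) (hv : M ◁ v ≫ d' = d ≫ M ◁ v)
    (hd' : d' ≫ M ◁ q = M ◁ q ≫ (α_ M N R).inv ≫ d'' ▷ R ≫ (α_ M N R).hom) :
    r† ≫ M ◁ (v ≫ q) ≫ (α_ M N R).inv ≫ d'' ▷ R = r† ≫ M ◁ (v ≫ q) ≫ (α_ M N R).inv := by
  have h1 : M ◁ q ≫ (α_ M N R).inv ≫ d'' ▷ R = d' ≫ M ◁ q ≫ (α_ M N R).inv := by
    rw [reassoc_of% hd']; simp
  rw [MonoidalCategory.whiskerLeft_comp, Category.assoc, h1, reassoc_of% hv, hd]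
  simp [reassoc_of% hr]

lemma cupHom_idem : X.actR† ≫ X.X ◁ cupHom η ≫ (α_ X.X Y.X X.X).inv ≫
    DaggerBimodule.idem X Y ▷ X.X = X.actR† ≫ X.X ◁ cupHom η ≫ (α_ X.X Y.X X.X).inv :=
  transfer_cup (actR_sep X) (idem_unit_right X) (idem_left (M := X) η) (idem_rel_right X Y X)

/-- The triangle identity `h` expresses both `l` and `l†` through cup and cap. The two caps meet in
`γ ≫ γ†`, the idempotent `d`, which the cup absorbs by `hc`. -/
lemma transfer_sandwich {K Z M N : C} {r : M ⊗ K ⟶ M} {l : Z ⊗ M ⟶ M} {c : K ⟶ N ⊗ M}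
    {γ : M ⊗ N ⟶ Z} {d : M ⊗ N ⟶ M ⊗ N} (hd : γ ≫ γ† = d)
    (hc : r† ≫ M ◁ c ≫ (α_ M N M).inv ≫ d ▷ M = r† ≫ M ◁ c ≫ (α_ M N M).inv)
    (h : r† ≫ M ◁ c ≫ (α_ M N M).inv ≫ γ ▷ M = l†) (t : M ⟶ M) :
    l† ≫ Z ◁ t ≫ l = r† ≫ M ◁ (c ≫ N ◁ t ≫ c†) ≫ r := by
  have h' : l = γ† ▷ M ≫ (α_ M N M).hom ≫ M ◁ c† ≫ r := by
    simpa using (congrArg (fun f => f†) h).symm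
  rw [← h, h']
  simp only [Category.assoc]
  rw [whisker_exchange_assoc, ← comp_whiskerRight_assoc, hd, reassoc_of% hc]
  simp

lemma transfer_conj {Z M N : C} {l : Z ⊗ M ⟶ M} {γ : M ⊗ N ⟶ Z} {m : Z ⊗ Z ⟶ Z}
    (h : Z ◁ γ ≫ m = (α_ Z M N).inv ≫ l ▷ N ≫ γ) (t : M ⟶ M) :
    m† ≫ Z ◁ (γ† ≫ t ▷ N ≫ γ) ≫ m = γ† ≫ (l† ≫ Z ◁ t ≫ l) ▷ N ≫ γ := by
  have h' : m† ≫ Z ◁ γ† = γ† ≫ l† ▷ N ≫ (α_ Z M N).hom := by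
    simpa using congrArg (fun f => f†) h
  simp only [MonoidalCategory.whiskerLeft_comp, Category.assoc]
  rw [reassoc_of% h', h]
  simp

lemma transfer_linear {Z M N : C} {r : N ⊗ Z ⟶ N} {γ : M ⊗ N ⟶ Z} {m : Z ⊗ Z ⟶ Z}
    (h : γ† ▷ Z ≫ (α_ M N Z).hom ≫ M ◁ r = m ≫ γ†)
    (h' : γ ▷ Z ≫ m = (α_ M N Z).hom ≫ M ◁ r ≫ γ) (t : M ⟶ M) :
    (γ† ≫ t ▷ N ≫ γ) ▷ Z ≫ m = m ≫ γ† ≫ t ▷ N ≫ γ := by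
  rw [← reassoc_of% h, whisker_exchange_assoc]
  simp [h']

/-- For an endomorphism of the regular right module, the left and right traces. -/
lemma SSFA.canonicalTrace_linear (A : SSFA C) (τ : A.X ⟶ A.X) (h : τ ▷ A.X ≫ A.mul = A.mul ≫ τ) :
    canonicalTrace (A.one ≫ τ ≫ A.one†) =
      canonicalTrace (A.one ≫ (A.mul† ≫ A.X ◁ τ ≫ A.mul) ≫ A.one†) := by
  -- On the right side of standardness, linearity moves `τ` past the multiplication and separability
  -- removes `A.mul† ≫ A.mul`.
  have h1 := A.standard τ
  simp only [AlgebraData.cup, AlgebraData.cap, DaggerCategory.dagger_comp,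
    DaggerCategory.dagger_dagger, Category.assoc, reassoc_of% h, reassoc_of% A.separable] at h1
  simpa only [Category.assoc] using h1.symm

/-- The trace identity behind standardness of the dual of an invertible bimodule. -/
lemma canonicalTrace_cap_conj (hη : Bicategory.rightZigzag η ε =
    (Bicategory.rightUnitor X).hom ≫ (Bicategory.leftUnitor X).inv) (hε : ε ≫ ε† = 𝟙 _)
    (t : X.X ⟶ X.X) :
    canonicalTrace (A.one ≫ ((capHom ε)† ≫ t ▷ Y.X ≫ capHom ε) ≫ A.one†) =
      canonicalTrace (A.one ≫ ((capHom ε)† ≫ (X.actR† ≫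
        X.X ◁ (cupHom η ≫ Y.X ◁ t ≫ (cupHom η)†) ≫ X.actR) ▷ Y.X ≫ capHom ε) ≫ A.one†) := by
  -- The conjugate of `t` by the cap is right `A`-linear, so the left and right traces of `A` agree
  -- on it. Left linearity of the cap moves the resulting multiplications onto `X` as `l†` and `l`,
  -- and the sandwich identity trades these for the cup and the action of `B`.
  rw [SSFA.canonicalTrace_linear A _
      (transfer_linear (capHom_dagger_right ε) (capHom_right ε) t),
    transfer_conj (capHom_left ε), transfer_sandwich (capHom_comp_dagger hε) (cupHom_idem η)
      ((triangle_right_iff η ε).1 hη)]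

/-- The canonical trace is the trace of a multiplication operator, hence is preserved by the linear
identification of the two endomorphism algebras. -/
lemma canonicalTrace_hom
    (f : 𝟙 (SSFA.trivial : SSFA C) ⟶ 𝟙 (SSFA.trivial : SSFA C)) :
    canonicalTrace f = canonicalTrace (C := C) (X := 𝟙_ C) (Hom.hom f) := by
  let e : (𝟙 (SSFA.trivial : SSFA C) ⟶ 𝟙 (SSFA.trivial : SSFA C)) ≃ₗ[ℂ] (𝟙_ C ⟶ 𝟙_ C) :=
    { toFun := fun f => Hom.hom f
      invFun := fun g => Hom.mk (M := DaggerBimodule.unit SSFA.trivial)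
        (N := DaggerBimodule.unit SSFA.trivial) g (leftUnitor_naturality g)
        ((congrArg (g ▷ 𝟙_ C ≫ ·) unitors_equal).trans <| (rightUnitor_naturality g).trans
          (congrArg (· ≫ g) unitors_equal.symm))
      left_inv := fun f => rfl
      right_inv := fun f => rfl
      map_add' := fun f g => rfl
      map_smul' := fun c f => rfl }
  exact (LinearMap.trace_conj' _ e).symm

end Standardness

/-! ### The weight functional and its faithfulness. -/

section ForgetDual

variable {C : Type u} [Category.{v} C] [Preadditive C] [Linear ℂ C]
    [MonoidalCategory C] [MonoidalPreadditive C] [MonoidalLinear ℂ C] [RigidCStarTensorCategory C]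
    {A B : SSFA C}

open DaggerBimodule

lemma dagger_smul_bimodule {M N : A ⟶ B} (c : ℂ) (f : M ⟶ N) :
    (c • f)† = (starRingEnd ℂ c) • f† :=
  hom_ext (CStarCategory.dagger_smul c (Hom.hom f))

lemma dagger_sub_bimodule {M N : A ⟶ B} (f g : M ⟶ N) : (f - g)† = f† - g† := by
  have h : f - g = f + (-1 : ℂ) • g := by simp [sub_eq_add_neg]
  have h1 : (f + (-1 : ℂ) • g)† = f† + ((-1 : ℂ) • g)† :=
    hom_ext (CStarCategory.dagger_add (Hom.hom f) (Hom.hom ((-1 : ℂ) • g)))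
  rw [h, h1, dagger_smul_bimodule]
  simp [sub_eq_add_neg]

lemma eq_zero_of_comp_dagger_bimodule {M N : A ⟶ B} (f : M ⟶ N) (h : f ≫ f† = 0) : f = 0 :=
  hom_ext (eq_zero_of_comp_dagger (Hom.hom f) (congrArg Hom.hom h))

instance (M : A ⟶ B) : FiniteDimensional ℂ (M ⟶ M) := by
  let e : (M ⟶ M) →ₗ[ℂ] (M.X ⟶ M.X) :=
    { toFun := fun f => Hom.hom f
      map_add' := fun f g => rfl
      map_smul' := fun c f => rfl }
  have := RigidCStarTensorCategory.finiteDimensional_end M.X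
  exact FiniteDimensional.of_injective e fun f g h => hom_ext h

section Transfer

variable {X Y Z V P Q R S : C}

lemma transfer_counit {p : P ⟶ V} {e : P ⟶ X} {u : R ⟶ X} {t : V ⟶ V} :
    (e ≫ u†)† ≫ (p ≫ t ≫ p†) ≫ (e ≫ u†) = u ≫ ((p† ≫ e)† ≫ t ≫ (p† ≫ e)) ≫ u† := by
  simp

lemma transfer_unit {q : P ⟶ V} {z : R ⟶ V} {t : V ⟶ V} (hz : z† ≫ z = 𝟙 _) :
    (q ≫ z†) ≫ (z ≫ t ≫ z†) ≫ (q ≫ z†)† = q ≫ t ≫ q† := by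
  simp [reassoc_of% hz]

lemma transfer_act {i : P ⟶ Q} {r : Q ⟶ R} {t : Q ⟶ Q} (hi : i† ≫ i = r ≫ r†)
    (hr : r† ≫ r = 𝟙 _) : (i ≫ r)† ≫ (i ≫ t ≫ i†) ≫ (i ≫ r) = r† ≫ t ≫ r := by
  simp [reassoc_of% hi, reassoc_of% hr, hr]

variable {M N K : C} {e : R ⟶ P} {p : P ⟶ M ⊗ N} {p' : X ⊗ N ⟶ Q} {r : M ⟶ Y ⊗ K}
  {r' : Y ⊗ K ⟶ X} {z z' : K ⟶ K} {e' : Q ⟶ S}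

lemma transfer_add : e ≫ (p ≫ (r ≫ Y ◁ (z + z') ≫ r') ▷ N ≫ p') ≫ e' =
    e ≫ (p ≫ (r ≫ Y ◁ z ≫ r') ▷ N ≫ p') ≫ e' + e ≫ (p ≫ (r ≫ Y ◁ z' ≫ r') ▷ N ≫ p') ≫ e' := by
  simp only [MonoidalPreadditive.whiskerLeft_add, MonoidalPreadditive.add_whiskerRight,
    Preadditive.comp_add, Preadditive.add_comp]

lemma transfer_smul {c : ℂ} : e ≫ (p ≫ (r ≫ Y ◁ (c • z) ≫ r') ▷ N ≫ p') ≫ e' =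
    c • e ≫ (p ≫ (r ≫ Y ◁ z ≫ r') ▷ N ≫ p') ≫ e' := by
  simp only [MonoidalLinear.whiskerLeft_smul, MonoidalLinear.smul_whiskerRight,
    Linear.comp_smul, Linear.smul_comp]

end Transfer

lemma act_hom (M : A ⟶ B) (z : 𝟙 B ⟶ 𝟙 B) :
    Hom.hom (Rescaling.act M z) = M.actR† ≫ M.X ◁ Hom.hom z ≫ M.actR :=
  transfer_act (incR_dagger_incR M) (actR_sep M)

variable {X : A ⟶ B} {Y : B ⟶ A} (η : 𝟙 B ⟶ Y ≫ X) (ε : X ≫ Y ⟶ 𝟙 A)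

lemma forgetCounit_conj_hom (T : forgetLeft X ⟶ forgetLeft X) :
    Hom.hom ((forgetCounit ε)† ≫ Bicategory.whiskerRight T (forgetRight Y) ≫ forgetCounit ε) =
      A.one ≫ ((capHom ε)† ≫ Hom.hom (M := forgetLeft X) (N := forgetLeft X) T ▷ Y.X ≫ capHom ε) ≫ A.one† :=
  transfer_counit

lemma forgetUnit_conj_hom (T : forgetLeft X ⟶ forgetLeft X) :
    Hom.hom (forgetUnit η ≫ Bicategory.whiskerLeft (forgetRight Y) T ≫ (forgetUnit η)†) =
      cupHom η ≫ Y.X ◁ Hom.hom (M := forgetLeft X) (N := forgetLeft X) T ≫ (cupHom η)† :=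
  transfer_unit (inc_dagger_inc_trivial (forgetRight Y) (forgetLeft X))

/-- This is the hypothesis `hE` of `Rescaling.standardDual` for the adjunction with the `A`-actions
forgotten. -/
lemma canonicalTrace_forget (hη : Bicategory.rightZigzag η ε =
    (Bicategory.rightUnitor X).hom ≫ (Bicategory.leftUnitor X).inv) (hε : ε ≫ ε† = 𝟙 _)
    (T : forgetLeft X ⟶ forgetLeft X) :
    canonicalTrace
        ((forgetCounit ε)† ≫ Bicategory.whiskerRight T (forgetRight Y) ≫ forgetCounit ε) =
      canonicalTrace ((forgetCounit ε)† ≫ Bicategory.whiskerRight (Rescaling.act (forgetLeft X)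
        (forgetUnit η ≫ Bicategory.whiskerLeft (forgetRight Y) T ≫ (forgetUnit η)†))
          (forgetRight Y) ≫ forgetCounit ε) := by
  rw [canonicalTrace_hom, canonicalTrace_hom]
  have h1 := act_hom (forgetLeft X)
    (forgetUnit η ≫ Bicategory.whiskerLeft (forgetRight Y) T ≫ (forgetUnit η)†)
  have h2 := h1.trans (congrArg (fun f => X.actR† ≫ X.X ◁ f ≫ X.actR) (forgetUnit_conj_hom η T))
  exact (congrArg (canonicalTrace (C := C) (X := 𝟙_ C)) (forgetCounit_conj_hom ε T)).trans <|
    (canonicalTrace_cap_conj η ε hη hε (Hom.hom (M := forgetLeft X) (N := forgetLeft X) T)).trans <|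
    (congrArg (canonicalTrace (C := C) (X := 𝟙_ C)) ((forgetCounit_conj_hom ε _).trans
      (congrArg (fun f : X.X ⟶ X.X => A.one ≫ ((capHom ε)† ≫ f ▷ Y.X ≫ capHom ε) ≫ A.one†)
        h2))).symm

lemma weight_hom {r : SSFA C} (M : r ⟶ B) {N : B ⟶ r} (ε : M ≫ N ⟶ 𝟙 r) (z : 𝟙 B ⟶ 𝟙 B) :
    Hom.hom (ε† ≫ Bicategory.whiskerRight (Rescaling.act M z) N ≫ ε) =
      (Hom.hom ε)† ≫ (inc M N ≫ (M.actR† ≫ M.X ◁ Hom.hom z ≫ M.actR) ▷ N.X ≫ (inc M N)†) ≫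
        Hom.hom ε :=
  congrArg (fun f : M.X ⟶ M.X => (Hom.hom ε)† ≫ (inc M N ≫ f ▷ N.X ≫ (inc M N)†) ≫ Hom.hom ε)
    (act_hom M z)

/-- The functional on `End (𝟙 B)` obtained from a dual of a bimodule. -/
noncomputable def weight {r : SSFA C} (M : r ⟶ B) {N : B ⟶ r} (ε : M ≫ N ⟶ 𝟙 r) :
    (𝟙 B ⟶ 𝟙 B) →ₗ[ℂ] ℂ where
  toFun z := canonicalTrace (ε† ≫ Bicategory.whiskerRight (Rescaling.act M z) N ≫ ε)
  map_add' z z' := by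
    rw [← canonicalTrace_add]
    congr 1
    refine hom_ext ((weight_hom M ε (z + z')).trans
      (Eq.trans ?_ (congrArg₂ (· + ·) (weight_hom M ε z) (weight_hom M ε z')).symm))
    exact transfer_add
  map_smul' c z := by
    change _ = c * _
    rw [← canonicalTrace_smul]
    congr 1
    refine hom_ext ((weight_hom M ε (c • z)).trans
      (Eq.trans ?_ (congrArg (c • ·) (weight_hom M ε z)).symm))
    exact transfer_smul

lemma whiskerRight_zero {r s t : SSFA C} {M M' : r ⟶ s} (N : s ⟶ t) :
    Bicategory.whiskerRight (0 : M ⟶ M') N = 0 :=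
  hom_ext <| by
    change inc M N ≫ (0 : M.X ⟶ M'.X) ▷ N.X ≫ (inc M' N)† = 0
    simp

lemma whiskerLeft_zero {r s t : SSFA C} (M : r ⟶ s) {N N' : s ⟶ t} :
    Bicategory.whiskerLeft M (0 : N ⟶ N') = 0 :=
  hom_ext <| by
    change inc M N ≫ M.X ◁ (0 : N.X ⟶ N'.X) ≫ (inc M N')† = 0
    simp

lemma unit_comm (f g : 𝟙_ C ⟶ 𝟙_ C) : f ≫ g = g ≫ f := by
  have h := whisker_exchange f g
  have h1 := congrArg (fun x => (λ_ (𝟙_ C)).inv ≫ x ≫ (λ_ (𝟙_ C)).hom) h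
  simpa [← unitors_equal, ← unitors_inv_equal] using h1.symm

/-- The positivity axiom replaces `t`, whose target is arbitrary, by an endomorphism `g` of the
unit, where the commutative theory applies. -/
lemma exists_pos_canonicalTrace_unit {P : C} (t : 𝟙_ C ⟶ P) (ht : t ≠ 0) :
    ∃ r : ℝ, 0 < r ∧ canonicalTrace (t ≫ t†) = r := by
  obtain ⟨g, hg⟩ := CStarCategory.positive t
  have := RigidCStarTensorCategory.finiteDimensional_end (𝟙_ C)
  rw [hg]
  refine exists_pos_canonicalTrace unit_comm CStarCategory.dagger_smul dagger_sub
    eq_zero_of_comp_dagger ?_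
  rintro rfl
  exact ht (eq_zero_of_comp_dagger t (by rw [hg]; simp))

/-- The weight of `z ≫ z†` is the trace of `t ≫ t†`. If `t = 0`, a snake equation gives `act M z =
0`, hence `z ≫ η = 0`, and the isometric unit `η` forces `z = 0`. -/
lemma weight_pos {M : (SSFA.trivial : SSFA C) ⟶ B} {N : B ⟶ SSFA.trivial}
    (adj : Bicategory.Adjunction N M) (hη : adj.unit ≫ adj.unit† = 𝟙 _) (z : 𝟙 B ⟶ 𝟙 B)
    (hz : z ≠ 0) : ∃ r : ℝ, 0 < r ∧ weight M adj.counit (z ≫ z†) = r := by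
  let t := adj.counit† ≫ Bicategory.whiskerRight (Rescaling.act M z) N
  have h1 : weight M adj.counit (z ≫ z†) = canonicalTrace (t ≫ t†) := by
    change canonicalTrace _ = _
    rw [Rescaling.act_comp, Bicategory.comp_whiskerRight, ← Rescaling.act_dagger]
    simp [t]
  rw [h1, canonicalTrace_hom]
  refine exists_pos_canonicalTrace_unit (Hom.hom t) fun h0 => hz ?_
  have ht : t = 0 := hom_ext h0
  have h2 : Rescaling.act M z = 0 := by
    rw [Rescaling.act_eq_of_adjunction adj z]
    change _ ≫ Bicategory.whiskerRight t M ≫ _ = _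
    rw [ht, whiskerRight_zero]
    simp
  have h3 := Rescaling.unit_act adj.unit z
  rw [h2, whiskerLeft_zero, Limits.comp_zero] at h3
  rw [← Category.comp_id z, ← hη, ← reassoc_of% h3, Limits.zero_comp]

end ForgetDual

/-! ### Unitary adjoint equivalences. -/

section AdjointEquivalence

local infixr:80 (priority := 2000) " ⊗≫ " => CategoryTheory.bicategoricalComp
local infixr:81 (priority := 2000) " ◁ " => Bicategory.whiskerLeft
local infixl:81 (priority := 2000) " ▷ " => Bicategory.whiskerRight
local notation (priority := 2000) "α_" => Bicategory.associator
local notation (priority := 2000) "λ_" => Bicategory.leftUnitor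
local notation (priority := 2000) "ρ_" => Bicategory.rightUnitor


variable {𝓑 : Type u} [Bicategory.{w, v} 𝓑] [∀ a b : 𝓑, DaggerCategory (a ⟶ b)]
  [IsDaggerBicategory 𝓑] {r s : 𝓑}

lemma Pants.map_mul_of_actL {M : r ⟶ s} {N : s ⟶ r} {A : AlgebraData (r ⟶ r)} {c : N ≫ M ⟶ 𝟙 s}
    {f : A.X ⟶ M ≫ N}
    (h : A.mul ≫ f = A.X ◁ f ≫ (α_ A.X M N).inv ≫ (f ▷ M ≫ actL c) ▷ N) :
    A.mul ≫ f = (f ▷ A.X ≫ (M ≫ N) ◁ f) ≫ mul c := by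
  rw [h, ← Bicategory.whisker_exchange, mul_eq_actL]
  simp

/-- A unitary equivalence can be refined to a unitary adjoint equivalence. -/
lemma exists_unitary_adjunction {X : r ⟶ s} {Y : s ⟶ r} {η : 𝟙 s ⟶ Y ≫ X} {ε : X ≫ Y ⟶ 𝟙 r}
    (hη : IsUnitary η) (hε : IsUnitary ε) :
    ∃ adj : Bicategory.Adjunction Y X, adj.unit = η ∧ IsUnitary adj.counit := by
  let η' : 𝟙 s ≅ Y ≫ X := ⟨η, η†, hη.1, hη.2⟩
  let ε' : X ≫ Y ≅ 𝟙 r := ⟨ε, ε†, hε.1, hε.2⟩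
  let e := Bicategory.adjointifyCounit η' ε'
  -- The adjusted counit is composed of whiskered copies of `η` and `ε`, their inverses and
  -- structure isomorphisms, all of them unitary.
  have he : e.hom† = e.inv := by
    simp [e, η', ε', Bicategory.adjointifyCounit, bicategoricalIsoComp]
  have h := congrArg Iso.hom (Bicategory.adjointifyCounit_left_triangle η' ε')
  exact ⟨⟨η, e.hom, h, Bicategory.right_triangle_of_left_triangle η' e h⟩, rfl,
    by rw [he]; exact e.hom_inv_id, by rw [he]; exact e.inv_hom_id⟩

end AdjointEquivalence

/-! ### The comparison of `A` with the pants algebra of an invertible bimodule. -/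

section ToPants

variable {C : Type u} [Category.{v} C] [Preadditive C] [Linear ℂ C]
    [MonoidalCategory C] [MonoidalPreadditive C] [MonoidalLinear ℂ C] [RigidCStarTensorCategory C]
    {A B : SSFA C}

open DaggerBimodule

section Transfer

variable {K L M N P Q R S V Z : C}

lemma transfer_pants_actL {i : L ⟶ Z ⊗ M} {f : Z ⟶ P} {k : Q ⟶ P ⊗ M} {a : Q ⟶ S}
    {j : S ⟶ M ⊗ V} {q : V ⟶ N ⊗ M} {p : P ⟶ M ⊗ N} {d : N ⊗ M ⟶ K} {iR : R ⟶ M ⊗ K}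
    {r : M ⊗ K ⟶ M} {l : Z ⊗ M ⟶ M} (hk : k† ≫ k = 𝟙 _)
    (ha : a ≫ j ≫ M ◁ q = k ≫ p ▷ M ≫ (α_ M N M).hom)
    (hiR : iR† ≫ iR = r ≫ r†) (hr : r† ≫ r = 𝟙 _)
    (h : l = (f ≫ p) ▷ M ≫ (α_ M N M).hom ≫ M ◁ d ≫ r) :
    (i ≫ f ▷ M ≫ k†) ≫ a ≫ (j ≫ M ◁ (q ≫ d) ≫ iR†) ≫ iR ≫ r = i ≫ l := by
  simp only [MonoidalCategory.whiskerLeft_comp, Category.assoc, reassoc_of% hiR, hr,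
    Category.comp_id]
  rw [reassoc_of% ha, reassoc_of% hk, h]
  simp

lemma transfer_pants_mul {j : Q ⟶ Z ⊗ Z} {m : Z ⊗ Z ⟶ Z} {f : Z ⟶ P} {j' : R ⟶ Z ⊗ P}
    {a : R ⟶ S} {k : S ⟶ L ⊗ N} {i : L ⟶ Z ⊗ M} {p : P ⟶ M ⊗ N} {l : Z ⊗ M ⟶ M}
    {b : Z ⊗ P ⟶ P} (hj : j'† ≫ j' = 𝟙 _)
    (ha : a ≫ k ≫ i ▷ N = j' ≫ Z ◁ p ≫ (α_ Z M N).inv)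
    (hb : b = Z ◁ p ≫ ((α_ Z M N).inv ≫ l ▷ N) ≫ p†) (hf : Z ◁ f ≫ b = m ≫ f) :
    (j ≫ m) ≫ f = (j ≫ Z ◁ f ≫ j'†) ≫ a ≫ (k ≫ (i ≫ l) ▷ N ≫ p†) := by
  rw [Category.assoc, ← hf, hb]
  simp only [comp_whiskerRight, Category.assoc]
  rw [reassoc_of% ha, reassoc_of% hj]

lemma transfer_cap_dagger {e : P ⟶ Z} {p : P ⟶ Q} : e† ≫ p = (p† ≫ e)† := by
  simp

lemma transfer_one {u : R ⟶ Z} {e : P ⟶ Z} : u ≫ e† = (e ≫ u†)† := by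
  simp

end Transfer

variable {X : A ⟶ B} {Y : B ⟶ A}

/-- The comparison from the algebra `A` to the pair of pants algebra of an invertible bimodule. -/
noncomputable def toPants (ε : X ≫ Y ⟶ 𝟙 A) :
    (embed A.toAlgebraData).X ⟶ forgetLeft X ≫ forgetRight Y :=
  let g : A.X ⟶ (DaggerBimodule.rel X Y).X := (Hom.hom ε)†
  Hom.mk (M := ofObj A.X) (N := DaggerBimodule.rel (forgetLeft X) (forgetRight Y)) g
    ((congrArg (𝟙_ C ◁ g ≫ ·)
      (actL_trivial (DaggerBimodule.rel (forgetLeft X) (forgetRight Y)))).trans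
        (leftUnitor_naturality g))
    ((congrArg (g ▷ 𝟙_ C ≫ ·)
      (actR_trivial (DaggerBimodule.rel (forgetLeft X) (forgetRight Y)))).trans
        (rightUnitor_naturality g))

lemma toPants_unitary {ε : X ≫ Y ⟶ 𝟙 A} (h : IsUnitary ε) : IsUnitary (toPants ε) :=
  ⟨hom_ext ((congrArg ((Hom.hom ε)† ≫ ·) (DaggerCategory.dagger_dagger (Hom.hom ε))).trans
      (congrArg Hom.hom h.2)),
    hom_ext ((congrArg (· ≫ (Hom.hom ε)†) (DaggerCategory.dagger_dagger (Hom.hom ε))).trans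
      (congrArg Hom.hom h.1))⟩

lemma toPants_one (ε : X ≫ Y ⟶ 𝟙 A) :
    (embed A.toAlgebraData).one ≫ toPants ε = (forgetCounit ε)† :=
  hom_ext (transfer_one (u := A.one) (e := Hom.hom ε))

/-- The triangle identity, daggered, says that `A` acts on `X` by splitting through the daggered cap
and closing with the daggered cup; this is the pants action pulled back along `ε†`. -/
lemma toPants_actL (adj : Bicategory.Adjunction Y X) :
    Hom.hom (Bicategory.whiskerRight (toPants adj.counit) (forgetLeft X) ≫
      Pants.actL (forgetUnit adj.unit)†) = inc (ofObj A.X) (forgetLeft X) ≫ X.actL := by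
  have h : X.actL = (capHom adj.counit)† ▷ X.X ≫ (α_ X.X Y.X X.X).hom ≫
      X.X ◁ (cupHom adj.unit)† ≫ X.actR := by
    simpa using (congrArg (fun f => f†) ((triangle_right_iff _ _).1 adj.right_triangle)).symm
  have h1 : Hom.hom (forgetUnit adj.unit)† = inc (forgetRight Y) (forgetLeft X) ≫
      (cupHom (N := Y) (M := X) adj.unit)† := transfer_one.symm
  have h2 : (Hom.hom adj.counit)† ≫ inc X Y = (capHom adj.counit)† := transfer_cap_dagger
  rw [← h2] at h
  exact (congrArg (fun d : (DaggerBimodule.rel (forgetRight Y) (forgetLeft X)).X ⟶ B.X => _ ≫ _ ≫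
      (inc (forgetLeft X) (DaggerBimodule.rel (forgetRight Y) (forgetLeft X)) ≫ X.X ◁ d ≫ _) ≫ _)
    h1).trans (transfer_pants_actL (f := (Hom.hom adj.counit)†)
      (inc_dagger_inc_trivial (forgetLeft X ≫ forgetRight Y) (forgetLeft X))
      (assocHom_inc (forgetLeft X) (forgetRight Y) (forgetLeft X)) (incR_dagger_incR (forgetLeft X))
      (actR_sep X) h)

/-- Since the pulled-back action is the given one, multiplicativity of `ε†` is nothing but its left
`A`-linearity. -/
lemma toPants_mul (adj : Bicategory.Adjunction Y X) :
    (embed A.toAlgebraData).mul ≫ toPants adj.counit =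
      (Bicategory.whiskerRight (toPants adj.counit) _ ≫
        Bicategory.whiskerLeft _ (toPants adj.counit)) ≫ Pants.mul (forgetUnit adj.unit)† := by
  refine Pants.map_mul_of_actL (hom_ext ?_)
  exact (transfer_pants_mul (f := (Hom.hom adj.counit)†)
    (inc_dagger_inc_trivial (ofObj A.X) (forgetLeft X ≫ forgetRight Y))
    (assocHom_dagger_inc (ofObj A.X) (forgetLeft X) (forgetRight Y)) rfl
    (Hom.left adj.counit†)).trans
    (congrArg (fun l : (DaggerBimodule.rel (ofObj A.X) (forgetLeft X)).X ⟶ X.X => _ ≫ _ ≫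
      inc (DaggerBimodule.rel (ofObj A.X) (forgetLeft X)) (forgetRight Y) ≫ l ▷ Y.X ≫ _)
      (toPants_actL adj).symm)

end ToPants

/-! ### From a Morita equivalence to the pair of pants, and the theorem. -/

section Forward

variable {C : Type u} [Category.{v} C] [Preadditive C] [Linear ℂ C]
    [MonoidalCategory C] [MonoidalPreadditive C] [MonoidalLinear ℂ C] [RigidCStarTensorCategory C]
    {A B : SSFA C}

open DaggerBimodule

theorem exists_pairOfPants_of_adjunction {X : A ⟶ B} {Y : B ⟶ A} (adj : Bicategory.Adjunction Y X)
    (hη : IsUnitary adj.unit) (hε : IsUnitary adj.counit) :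
    ∃ (M : (SSFA.trivial : SSFA C) ⟶ B) (D : StandardDual M), D.IsSeparable ∧
      ∃ n : 𝟙 B ≅ 𝟙 B, IsPositive n.hom ∧ n.hom ≫ n.hom = D.dimL ∧
        (embed A.toAlgebraData).UnitarilyStarIsomorphic (D.pairOfPants n) := by
  let adj₀ := forgetAdjunction adj
  have hη₀ : adj₀.unit ≫ adj₀.unit† = 𝟙 _ := forgetUnit_isometry hη.1
  -- `n` corrects the discrepancy between the canonical trace on `End (𝟙 B)` and the weight. It
  -- serves both as the rescaling factor and as the square root of the left dimension.
  obtain ⟨k, n, hk, hn, hw⟩ := exists_weight_end (Z := 𝟙 B) Rescaling.end_comm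
    dagger_smul_bimodule dagger_sub_bimodule eq_zero_of_comp_dagger_bimodule
    (weight (forgetLeft X) adj₀.counit) (weight_pos adj₀ hη₀)
  let D := Rescaling.standardDual adj₀ n hn
    (canonicalTrace_forget adj.unit adj.counit adj.right_triangle hε.1) hw
  have hD : D.dimL = n.hom ≫ n.hom := Rescaling.standardDual_dimL hη₀
  have hm : (D.pairOfPants n).mul = Pants.mul adj₀.unit† := Rescaling.standardDual_mul
  have hu : (D.pairOfPants n).one = adj₀.counit† := Rescaling.standardDual_one
  refine ⟨forgetLeft X, D, ?_, n, ⟨_, k, hk⟩, hD.symm, toPants adj.counit,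
    ⟨?_, ?_, ?_⟩, toPants_unitary hε⟩
  · change IsIso D.dimL
    rw [hD]
    infer_instance
  · rw [hm]
    exact toPants_mul adj
  · rw [hu]
    exact toPants_one adj.counit
  · rw [AlgebraData.cap, hm, hu]
    exact Pants.map_star (counit_dagger_unit_dagger_left adj₀) (counit_dagger_unit_dagger_right adj₀)
      (toPants_mul adj) (toPants_one adj.counit) (toPants_unitary hε).1 (toPants_unitary hε).2

end Forward

end BimodT

theorem mainTheorem7 {C : Type u} [Category.{v} C] [Preadditive C] [Linear ℂ C]
    [MonoidalCategory C] [MonoidalPreadditive C] [MonoidalLinear ℂ C]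
    [BimodT.RigidCStarTensorCategory C] (A A' : BimodT.SSFA C) :
    BimodT.MoritaEquivalent A A' ↔
      ∃ (M : (BimodT.SSFA.trivial : BimodT.SSFA C) ⟶ A') (D : BimodT.StandardDual M),
        D.IsSeparable ∧
        ∃ n : 𝟙 A' ≅ 𝟙 A', BimodT.IsPositive n.hom ∧ n.hom ≫ n.hom = D.dimL ∧
          (BimodT.embed A.toAlgebraData).UnitarilyStarIsomorphic (D.pairOfPants n) := by
  constructor
  · rintro ⟨X, Y, η, ε, hη, hε⟩
    -- The given `η` and `ε` need not satisfy the snake equations; `η` is kept and `ε` is replaced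
    -- by a unitary counit.
    obtain ⟨adj, rfl, h⟩ := BimodT.exists_unitary_adjunction hη hε
    exact BimodT.exists_pairOfPants_of_adjunction adj hη h
  · rintro ⟨M, D, -, n, hn, hD, h⟩
    exact BimodT.moritaEquivalent_of_unitarilyStarIsomorphic D n hn hD h
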